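/- Let $d\ge 1$ and $n\ge 0$ be integers, and let $A=(A_1,\dots,A_d)$ be real $n\times n$ matrices such that for every $\xi\in\mathbb R^d$ the matrix $A\cdot\xi=\sum_i\xi_iA_i$ is diagonalizable with real eigenvalues (so that $\partial_t w+A\cdot\nabla w=0$ is hyperbolic). For a matrix $B=S\Lambda S^{-1}$ with $\Lambda$ real diagonal put $|B|=S|\Lambda|S^{-1}$. Let $\mathbb R^d$ be covered by a conforming locally finite simplicial mesh that is invariant under all translations by vectors of $\mathbb Z^d$; let $\mathcal N$ be its set of nodes, $r_j$ the radius-vector of $j\in\mathcal N$, and $\mathcal N^1$ a system of representatives of $\mathcal N$ modulo translations by $\mathbb Z^d$. Let $K_j$ be the median dual cell of $j$: the union, over the $d$-simplices $e\ni j$ of the mesh, of the points of $e$ whose barycentric coordinate at $j$ is the largest one. Let $|K_j|$ be its volume, let $N(j)$ be the set of nodes $k\ne j$ such that $\partial K_j\cap\partial K_k$ has nonzero $(d-1)$-dimensional measure, and put $$\boldsymbol n_{jk}=\int_{\partial K_j\cap\partial K_k}\boldsymbol n\,dS,\qquad v_{jk}=\frac1{2d}(r_k-r_j)\cdot \boldsymbol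 n_{jk},$$ where $\boldsymbol n$ is the unit normal oriented inside $K_k$. Let $P_p$ be the space of polynomials of degree at most $p$ in $d$ variables with complex coefficients, and let $\Pi$ take a function to its values at the nodes. Let $G$ be a linear operator on mesh functions $u\in(\mathbb C^{n})^{\mathcal N}$ with $G\Pi f=\Pi\nabla f$ for all $f\in(P_2)^n$, and put $$R_{jk}[u]=u_j+\frac{r_k-r_j}2\cdot(Gu)_j,\qquad F_{jk}[u]=\frac{A\cdot \boldsymbol n_{jk}+|A\cdot \boldsymbol n_{jk}|}2R_{jk}[u]+\frac{A\cdot \boldsymbol n_{jk}-|A\cdot \boldsymbol n_{jk}|}2R_{kj}[u].$$ For $j\in\mathcal N$ and $k\in N(j)$ let $s_{jk}$ be linear maps from mesh functions to $\mathbb C^n$ such that $$s_{jk}[\Pi p]=p(r_j)-\frac d{4(d+2)}\big((r_k-r_j)\cdot\nabla\big)^2p\,(r_j)\qquad\text{for all }p\in(P_2)^n .$$ Assume that, for all $j\in\mathcal N$ and $k\in N(j)$, $F_{jk}[u]$ and $s_{jk}[u]$ depend on finitely many values of $u$ and are invariant under the translations of the mesh by $\mathbb Z^d$. Consider the flux correction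 method with the "extended Galerkin formula", $$\sum_{k\in N(j)}v_{jk}\,s_{jk}\Big[\frac{du}{dt}\Big]+\sum_{k\in N(j)}F_{jk}[u]=0,\qquad j\in\mathcal N,$$ with the truncation error $$\epsilon_j(f,\Pi)=\frac1{|K_j|}\Big(-\sum_{k\in N(j)}v_{jk}\,s_{jk}[\Pi(A\cdot\nabla f)]+\sum_{k\in N(j)}F_{jk}[\Pi f]\Big).$$ Then the method is 2-exact, i.e. $\epsilon_j(f,\Pi)=0$ for all $f\in(P_2)^n$ and $j\in\mathcal N$, and it has zero mean error on the third order polynomials, i.e. for every choice of $\mathcal N^1$ $$\sum_{j\in\mathcal N^1}|K_j|\,\epsilon_j(f,\Pi)=0\qquad\text{for all }f\in(P_3)^n .$$ -/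

import Mathlib

open MeasureTheory
open scoped BigOperators

noncomputable section

namespace FluxCorrection

/-- The space `ℝ^d` with its Euclidean norm. -/
abbrev Space (d : ℕ) : Type := EuclideanSpace ℝ (Fin d)

/-- The vector of `ℝ^d` with the given integer components. -/
def latticeVec {d : ℕ} (z : Fin d → ℤ) : Space d := WithLp.toLp 2 (fun i => (z i : ℝ))

/-! ### Periodic simplicial meshes -/

/-- A conforming, locally finite simplicial mesh of `ℝ^d` that is invariant under all translations
by vectors with integer components. The mesh elements are the faces with `d + 1` vertices; every
point of the space lies in an element. -/
structure PeriodicMesh (d : ℕ) extends Geometry.SimplicialComplex ℝ (Space d) where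
  cover : ∀ x : Space d, ∃ e ∈ faces, e.card = d + 1 ∧ x ∈ convexHull ℝ (e : Set (Space d))
  periodic : ∀ s ∈ faces, ∀ z : Fin d → ℤ, s.map (addRightEmbedding (latticeVec z)) ∈ faces
  locallyFinite : ∀ C : Set (Space d), IsCompact C →
    {s | s ∈ faces ∧ (convexHull ℝ (s : Set (Space d)) ∩ C).Nonempty}.Finite

namespace PeriodicMesh

variable {d : ℕ} (M : PeriodicMesh d)

/-- The mesh nodes; the radius-vector of a node is the node itself, as a point of `ℝ^d`. -/
def Node : Type := {x : Space d // ({x} : Finset (Space d)) ∈ M.faces}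

/-- The radius-vector of a node. -/
def pos (j : M.Node) : Space d := j.1

/-- The mesh elements (`d`-dimensional simplices, given by their vertex sets). -/
def elements : Set (Finset (Space d)) := {e | e ∈ M.faces ∧ e.card = d + 1}

/-- Translation of a node by an integer vector. -/
def shift (z : Fin d → ℤ) (j : M.Node) : M.Node :=
  ⟨M.pos j + latticeVec z, by simpa [pos] using M.periodic _ j.2 z⟩

/-- The median dual cell of a node `j`: all the points of elements containing `j` whose largest
barycentric coordinate is the one at `j`. -/
def dualCell (j : M.Node) : Set (Space d) :=
  {x | ∃ e ∈ M.elements, M.pos j ∈ e ∧ ∃ α : Space d → ℝ,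
    (∀ l ∈ e, 0 ≤ α l) ∧ ∑ l ∈ e, α l = 1 ∧ (∀ l ∈ e, α l ≤ α (M.pos j)) ∧
      ∑ l ∈ e, α l • l = x}

/-- The volume of a dual cell. -/
def cellVolume (j : M.Node) : ℝ := (volume (M.dualCell j)).toReal

/-- The common boundary of two dual cells. -/
def interface (j k : M.Node) : Set (Space d) := frontier (M.dualCell j) ∩ frontier (M.dualCell k)

end PeriodicMesh

/-- `ν` is the unit normal at `x` to the interface between `K` and `L`, oriented inside `L`: near
`x`, the two open half-spaces bounded by the hyperplane through `x` orthogonal to `ν` lie in `K` and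
in `L`, and `ν` points to the one in `L`. For polyhedral sets it exists at almost all points of the
interface. -/
def IsUnitNormal {d : ℕ} (K L : Set (Space d)) (x ν : Space d) : Prop :=
  ‖ν‖ = 1 ∧ ∃ ε > 0, ∀ y ∈ Metric.ball x ε,
    (inner ℝ ν (y - x) < 0 → y ∈ K) ∧ (0 < inner ℝ ν (y - x) → y ∈ L)

open Classical in
/-- The unit normal field (with value `0` where there is no normal, which is a null set of the
interface of two dual cells). -/
def unitNormal {d : ℕ} (K L : Set (Space d)) (x : Space d) : Space d :=
  if h : ∃ ν, IsUnitNormal K L x ν then h.choose else 0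

namespace PeriodicMesh

variable {d : ℕ} (M : PeriodicMesh d)

/-- `N(j)`: the nodes `k ≠ j` whose dual cell shares with that of `j` a part of the boundary of
nonzero `(d-1)`-dimensional measure. -/
def neighborSet (j : M.Node) : Set M.Node :=
  {k | k ≠ j ∧ Measure.euclideanHausdorffMeasure (d - 1) (M.interface j k) ≠ 0}

/-- The union of the elements that contain a node. -/
def star (j : M.Node) : Set (Space d) :=
  ⋃ e ∈ {e | e ∈ M.elements ∧ M.pos j ∈ e}, convexHull ℝ (e : Set (Space d))

theorem star_isCompact (j : M.Node) : IsCompact (M.star j) := by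
  refine Set.Finite.isCompact_biUnion ?_ (fun e _ => e.finite_toSet.isCompact_convexHull ℝ)
  refine (M.locallyFinite {M.pos j} isCompact_singleton).subset ?_
  rintro e ⟨he, hj⟩
  exact ⟨he.1, M.pos j, subset_convexHull ℝ _ (by exact_mod_cast hj), rfl⟩

theorem dualCell_subset_star (j : M.Node) : M.dualCell j ⊆ M.star j := by
  rintro x ⟨e, he, hj, α, h0, h1, -, rfl⟩
  refine Set.mem_biUnion (show e ∈ {e | e ∈ M.elements ∧ M.pos j ∈ e} from ⟨he, hj⟩) ?_
  exact (convex_convexHull ℝ _).sum_mem h0 h1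
    (fun l hl => subset_convexHull ℝ _ (by exact_mod_cast hl))

theorem frontier_dualCell_subset_star (j : M.Node) : frontier (M.dualCell j) ⊆ M.star j :=
  frontier_subset_closure.trans
    (closure_minimal (M.dualCell_subset_star j) (M.star_isCompact j).isClosed)

theorem neighborSet_finite (j : M.Node) : (M.neighborSet j).Finite := by
  have hfin := M.locallyFinite (M.star j) (M.star_isCompact j)
  have hfin2 : (⋃ e ∈ {s | s ∈ M.faces ∧
      (convexHull ℝ (s : Set (Space d)) ∩ M.star j).Nonempty}, (e : Set (Space d))).Finite :=
    hfin.biUnion (fun e _ => e.finite_toSet)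
  refine Set.Finite.subset (hfin2.preimage (f := M.pos) (Subtype.val_injective.injOn)) ?_
  rintro k ⟨-, hk⟩
  obtain ⟨x, hxj, hxk⟩ : (M.interface j k).Nonempty := by
    rw [Set.nonempty_iff_ne_empty]
    intro h
    exact hk (by rw [h]; simp)
  have hx := M.frontier_dualCell_subset_star k hxk
  obtain ⟨e, ⟨he, hke⟩, hxe⟩ := Set.mem_iUnion₂.1 hx
  exact Set.mem_biUnion (show e ∈ {s | s ∈ M.faces ∧
      (convexHull ℝ (s : Set (Space d)) ∩ M.star j).Nonempty} from
    ⟨he.1, x, hxe, M.frontier_dualCell_subset_star j hxj⟩) (by exact_mod_cast hke)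

/-- `N(j)` as a finite set. -/
def neighbors (j : M.Node) : Finset M.Node := (M.neighborSet_finite j).toFinset

/-- `n_{jk}`: the integral over the common boundary of the cells of `j` and `k` of the unit normal
oriented inside the cell of `k`. -/
def areaVec (j k : M.Node) : Space d :=
  ∫ x in M.interface j k, unitNormal (M.dualCell j) (M.dualCell k) x
    ∂(Measure.euclideanHausdorffMeasure (d - 1))

/-- A system of representatives of the mesh nodes modulo translations by integer vectors. -/
def IsPeriodCell (T : Finset M.Node) : Prop :=
  ∀ j : M.Node, ∃! k, k ∈ T ∧ ∃ z : Fin d → ℤ, j = M.shift z k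

/-- The nodes in the half-open unit cube form a system of representatives. -/
theorem exists_isPeriodCell : ∃ T : Finset M.Node, M.IsPeriodCell T := by
  have hfin : {j : M.Node | ∀ i, 0 ≤ M.pos j i ∧ M.pos j i < 1}.Finite := by
    let C : Set (Space d) := (WithLp.toLp 2) '' (Set.Icc (0 : Fin d → ℝ) 1)
    have hC : IsCompact C := isCompact_Icc.image (PiLp.continuous_toLp 2 _)
    have h := M.locallyFinite C hC
    refine Set.Finite.of_injOn (f := fun j : M.Node => ({M.pos j} : Finset (Space d)))
      ?_ ?_ h
    · intro j hj
      refine ⟨j.2, M.pos j, by simp, ?_⟩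
      exact ⟨fun i => M.pos j i, ⟨fun i => (hj i).1, fun i => (hj i).2.le⟩, rfl⟩
    · intro j _ k _ hjk
      exact Subtype.ext (Finset.singleton_injective hjk)
  refine ⟨hfin.toFinset, fun j => ?_⟩
  have hcoord : ∀ (z : Fin d → ℤ) (k : M.Node) (i : Fin d),
      M.pos (M.shift z k) i = M.pos k i + z i := fun z k i => rfl
  refine ⟨M.shift (fun i => -⌊M.pos j i⌋) j, ⟨?_, fun i => ⌊M.pos j i⌋, ?_⟩, ?_⟩
  · simp only [Set.Finite.mem_toFinset, Set.mem_ofPred_eq, hcoord]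
    intro i
    push_cast
    exact ⟨by linarith [Int.floor_le (M.pos j i)], by linarith [Int.lt_floor_add_one (M.pos j i)]⟩
  · apply Subtype.ext
    ext i
    change M.pos j i = M.pos (M.shift _ (M.shift _ j)) i
    simp [hcoord]
  · rintro k ⟨hk, z, rfl⟩
    simp only [Set.Finite.mem_toFinset, Set.mem_ofPred_eq] at hk
    apply Subtype.ext
    ext i
    change M.pos k i = M.pos (M.shift _ (M.shift z k)) i
    have : ⌊M.pos k i⌋ = 0 := Int.floor_eq_zero_iff.2 (hk i)
    simp [hcoord, this]

/-- `Π`: the pointwise mapping of functions to mesh functions. -/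
def sample {V : Type*} (f : Space d → V) : M.Node → V := fun j => f (M.pos j)

end PeriodicMesh

/-! ### Functions, derivatives, polynomials -/

/-- The derivative `(h · ∇) f`. -/
def dirDeriv {d n : ℕ} (h : Space d) (f : Space d → Fin n → ℂ) : Space d → Fin n → ℂ :=
  fun r => fderiv ℝ f r h

/-- The partial derivative with respect to the `i`-th coordinate. -/
def partialDeriv {d n : ℕ} (i : Fin d) (f : Space d → Fin n → ℂ) : Space d → Fin n → ℂ :=
  dirDeriv (EuclideanSpace.single i 1) f

/-- `f ∈ (P_p)^n`: each component of `f` is a polynomial of degree at most `p` in `d` variables. -/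
def IsPolynomial {d n : ℕ} (p : ℕ) (f : Space d → Fin n → ℂ) : Prop :=
  ∃ q : Fin n → MvPolynomial (Fin d) ℂ, (∀ a, (q a).totalDegree ≤ p) ∧
    ∀ r a, f r a = MvPolynomial.eval (fun i => (r i : ℂ)) (q a)

/-! ### The hyperbolic system -/

/-- A real matrix acting on `ℂ^n`. -/
def act {n : ℕ} (B : Matrix (Fin n) (Fin n) ℝ) (u : Fin n → ℂ) : Fin n → ℂ :=
  (B.map Complex.ofReal).mulVec u

/-- `A · ξ` for a vector `ξ`. -/
def symbol {d n : ℕ} (A : Fin d → Matrix (Fin n) (Fin n) ℝ) (ξ : Space d) :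
    Matrix (Fin n) (Fin n) ℝ := ∑ i, ξ i • A i

/-- `A · ∇ f`. -/
def advection {d n : ℕ} (A : Fin d → Matrix (Fin n) (Fin n) ℝ) (f : Space d → Fin n → ℂ) :
    Space d → Fin n → ℂ := fun r => ∑ i, act (A i) (partialDeriv i f r)

/-- The system `∂w/∂t + A · ∇ w = 0` is hyperbolic: all the matrices `A · ξ` are diagonalizable
with real eigenvalues. -/
def IsHyperbolic {d n : ℕ} (A : Fin d → Matrix (Fin n) (Fin n) ℝ) : Prop :=
  ∀ ξ : Space d, ∃ (S : Matrix (Fin n) (Fin n) ℝ) (lam : Fin n → ℝ),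
    IsUnit S.det ∧ symbol A ξ = S * Matrix.diagonal lam * S⁻¹

open Classical in
/-- `|B| = S |Λ| S⁻¹` where `B = S Λ S⁻¹` with a diagonal matrix `Λ` (the result does not depend on
the choice of `S` and `Λ`). -/
def matrixAbs {n : ℕ} (B : Matrix (Fin n) (Fin n) ℝ) : Matrix (Fin n) (Fin n) ℝ :=
  if h : ∃ p : Matrix (Fin n) (Fin n) ℝ × (Fin n → ℝ),
      IsUnit p.1.det ∧ B = p.1 * Matrix.diagonal p.2 * p.1⁻¹ then
    h.choose.1 * Matrix.diagonal (fun i => |h.choose.2 i|) * h.choose.1⁻¹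
  else 0

/-! ### Schemes and truncation errors -/

section Schemes

variable {d n : ℕ} (M : PeriodicMesh d) (A : Fin d → Matrix (Fin n) (Fin n) ℝ)

/-- The truncation error of the scheme `mass (du/dt) + stiff u = 0` on `f`, in the sense of the
pointwise mapping. -/
def truncationError (mass stiff : (M.Node → Fin n → ℂ) → (M.Node → Fin n → ℂ))
    (f : Space d → Fin n → ℂ) (j : M.Node) : Fin n → ℂ :=
  -mass (M.sample (advection A f)) j + stiff (M.sample f) j

/-- The scheme is `p`-exact. -/
def IsExact (mass stiff : (M.Node → Fin n → ℂ) → (M.Node → Fin n → ℂ)) (p : ℕ) : Prop :=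
  ∀ f : Space d → Fin n → ℂ, IsPolynomial p f → ∀ j, truncationError M A mass stiff f j = 0

/-- The scheme is `p`-exact and has zero mean error on the polynomials of order `p + 1`. The mean
error is taken over any system of representatives of the nodes modulo integer translations. -/
def HasZeroMeanError (mass stiff : (M.Node → Fin n → ℂ) → (M.Node → Fin n → ℂ)) (p : ℕ) : Prop :=
  IsExact M A mass stiff p ∧
    ∀ f : Space d → Fin n → ℂ, IsPolynomial (p + 1) f →
      ∀ T : Finset M.Node, M.IsPeriodCell T →
        ∑ j ∈ T, M.cellVolume j • truncationError M A mass stiff f j = 0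

/-- A map on mesh functions depends on finitely many of their values. -/
def IsLocal {V W : Type*} (L : (M.Node → V) → W) : Prop :=
  ∃ S : Finset M.Node, ∀ u v : M.Node → V, (∀ l ∈ S, u l = v l) → L u = L v

/-- `R_{jk}[u] = u_j + ((r_k - r_j) / 2) · (G u)_j`. -/
def reconstruction (G : (M.Node → Fin n → ℂ) → (M.Node → Fin d → Fin n → ℂ)) (j k : M.Node)
    (u : M.Node → Fin n → ℂ) : Fin n → ℂ :=
  u j + ∑ i, ((M.pos k i - M.pos j i) / 2) • G u j i

/-- The upwind numerical flux `F_{jk}[u]`. -/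
def flux (G : (M.Node → Fin n → ℂ) → (M.Node → Fin d → Fin n → ℂ)) (j k : M.Node)
    (u : M.Node → Fin n → ℂ) : Fin n → ℂ :=
  act ((1 / 2 : ℝ) • (symbol A (M.areaVec j k) + matrixAbs (symbol A (M.areaVec j k))))
      (reconstruction M G j k u) +
    act ((1 / 2 : ℝ) • (symbol A (M.areaVec j k) - matrixAbs (symbol A (M.areaVec j k))))
      (reconstruction M G k j u)

/-- `v_{jk} = (r_k - r_j) · n_{jk} / (2d)`. -/
def edgeVolume (j k : M.Node) : ℝ :=
  1 / (2 * (d : ℝ)) * inner ℝ (M.pos k - M.pos j) (M.areaVec j k)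

/-- The data of a flux correction method with the extended Galerkin formula: a 2-exact approximation
`G` of the gradient and functionals `s_{jk}`. The functionals `s_{jk}` and the resulting fluxes are
linear, depend on a finite number of values and are invariant with respect to the translations of
the mesh. -/
structure ExtendedGalerkin where
  G : (M.Node → Fin n → ℂ) →ₗ[ℂ] (M.Node → Fin d → Fin n → ℂ)
  G_exact : ∀ f : Space d → Fin n → ℂ, IsPolynomial 2 f →
    ∀ j i, G (M.sample f) j i = partialDeriv i f (M.pos j)
  flux_local : ∀ j, ∀ k ∈ M.neighbors j, IsLocal M (flux M A G j k)
  flux_shift : ∀ j, ∀ k ∈ M.neighbors j, ∀ (z : Fin d → ℤ) (u : M.Node → Fin n → ℂ),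
    flux M A G (M.shift z j) (M.shift z k) u = flux M A G j k (fun l => u (M.shift z l))
  s : M.Node → M.Node → ((M.Node → Fin n → ℂ) →ₗ[ℂ] (Fin n → ℂ))
  s_exact : ∀ j, ∀ k ∈ M.neighbors j, ∀ p : Space d → Fin n → ℂ, IsPolynomial 2 p →
    s j k (M.sample p) = p (M.pos j) - ((d : ℝ) / (4 * ((d : ℝ) + 2))) •
      dirDeriv (M.pos k - M.pos j) (dirDeriv (M.pos k - M.pos j) p) (M.pos j)
  s_local : ∀ j, ∀ k ∈ M.neighbors j, IsLocal M (s j k)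
  s_shift : ∀ j, ∀ k ∈ M.neighbors j, ∀ (z : Fin d → ℤ) (u : M.Node → Fin n → ℂ),
    s (M.shift z j) (M.shift z k) u = s j k (fun l => u (M.shift z l))

variable {M A}

/-- The discretization of the unsteady term, normalized by the cell volume:
`|K_j|⁻¹ ∑_{k ∈ N(j)} v_{jk} s_{jk}[u]`. -/
def ExtendedGalerkin.mass (X : ExtendedGalerkin M A) (u : M.Node → Fin n → ℂ) :
    M.Node → Fin n → ℂ :=
  fun j => (M.cellVolume j)⁻¹ • ∑ k ∈ M.neighbors j, edgeVolume M j k • X.s j k u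

/-- The discretization of the transport term, normalized by the cell volume:
`|K_j|⁻¹ ∑_{k ∈ N(j)} F_{jk}[u]`. -/
def ExtendedGalerkin.stiff (X : ExtendedGalerkin M A) (u : M.Node → Fin n → ℂ) :
    M.Node → Fin n → ℂ :=
  fun j => (M.cellVolume j)⁻¹ • ∑ k ∈ M.neighbors j, flux M A X.G j k u

end Schemes

end FluxCorrection

end

/-!
Everything is reduced to an identity for the gradients of barycentric coordinates. Write `λ_l` for
the barycentric coordinate at the vertex `l` of an element `e` and `φ_l` for the piecewise affine
hat function of the node `l`.

*Geometry.* The part in `e` of the interface between the dual cells of `j` and `k` lies in the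
hyperplane `λ_j = λ_k`. By Fubini's theorem its area is obtained from the volume of a cylinder over
it in the direction of the edge `jk`, and this volume, computed in barycentric coordinates, is a
multiple of `|e|` with a factor depending only on `d`. Hence (`exists_areaVec_eq`)
`n_jk = κ ∑ |e| (∇λ_k - ∇λ_j)`, the sum being over the elements with the edge `jk`. On the other
hand, the integral of `∇ ∏_{l ∈ σ} φ_l` over the space is zero, and on an element `e ⊇ σ` the mean
value of this gradient is proportional to `∑_{l ∈ σ} ∇λ_l`. Therefore
(`sum_simplexVolume_smul_sum_grad`) `∑_{e ⊇ σ} |e| ∑_{l ∈ σ} ∇λ_l = 0` for every nonempty set `σ`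
of vertices.

*Local exactness.* On quadratic polynomials both reconstructed values at the middle of an edge
coincide, so the upwind flux is the central one (`flux_sample`). The identities for vertices and
edges give `∑_k n_jk = 0` and the exactness of `∑_k (r_k - r_j) ⊗ n_jk` (`sum_starAt_linear`,
`sum_starAt_bilin`), by which the terms with `f` and `∇f` at `r_j` cancel. No second
derivatives of `f` occur. This proves 2-exactness, and on cubic polynomials it leaves
two contributions (`cellVolume_smul_truncationError`).

*The mean error.* One contribution is the difference between the upwind flux and the flux
`centralFlux`, which is conservative as well. This difference vanishes on quadratic polynomials.
A translation changes a cubic polynomial by a quadratic one, so on cubic polynomials the difference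
is antisymmetric and translation-invariant, and it cancels in the sum over a period. The
other contribution is a constant tensor contracted with the edge vectors. In each element its
sum over the vertices equals a combination of the vectors `∇λ_p + ∇λ_l + ∇λ_m` with coefficients
that depend on the points `p`, `l`, `m` but not on the element (`IsSimplex.sum_quadrilinear`); this
is where the factor `d / (4 (d + 2))` in the functionals `s_jk` is needed. The redistribution
between the vertices of an element does not affect the sum over a period (`sum_starAt_eq_zero`), and
then the gradient identity for the faces with at most three vertices applies (`sum_period_quadrilinear`).
-/

namespace FluxCorrection

open Filter Topology

/-! ### Barycentric coordinates in a simplex -/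

/-- `e` is the vertex set of a nondegenerate `d`-dimensional simplex of `ℝ^d`. -/
structure IsSimplex {d : ℕ} (e : Finset (Space d)) : Prop where
  indep : AffineIndependent ℝ ((↑) : e → Space d)
  card : e.card = d + 1

/-- The vertices of a simplex as an affine basis. -/
noncomputable def IsSimplex.basis {d : ℕ} {e : Finset (Space d)} (h : IsSimplex e) :
    AffineBasis e ℝ (Space d) where
  toFun := (↑)
  ind' := h.indep
  tot' := by
    rw [h.indep.affineSpan_eq_top_iff_card_eq_finrank_add_one]
    simp [h.card]

open Classical in
/-- The barycentric coordinate at `l` with respect to the simplex `e`, as an affine function on the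
whole space; it is zero if `l` is not a vertex of `e`. -/
noncomputable def bary {d : ℕ} (e : Finset (Space d)) (l : Space d) : Space d →ᵃ[ℝ] ℝ :=
  if h : IsSimplex e ∧ l ∈ e then h.1.basis.coord ⟨l, h.2⟩ else 0

/-- The gradient of the barycentric coordinate at `l` with respect to the simplex `e`. -/
noncomputable def grad {d : ℕ} (e : Finset (Space d)) (l : Space d) : Space d :=
  (InnerProductSpace.toDual ℝ (Space d)).symm (LinearMap.toContinuousLinearMap (bary e l).linear)

section

variable {d : ℕ} {e : Finset (Space d)} {l m x y v : Space d}

lemma bary_of_notMem (hl : l ∉ e) : bary e l = 0 := by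
  simp [bary, hl]

lemma inner_grad (e : Finset (Space d)) (l v : Space d) :
    inner ℝ (grad e l) v = (bary e l).linear v := by
  simp [grad]

lemma bary_sub_bary (e : Finset (Space d)) (l x y : Space d) :
    bary e l y - bary e l x = inner ℝ (grad e l) (y - x) := by
  rw [inner_grad]
  simpa using ((bary e l).linearMap_vsub y x).symm

lemma bary_add (e : Finset (Space d)) (l x v : Space d) :
    bary e l (x + v) = bary e l x + inner ℝ (grad e l) v := by
  have := bary_sub_bary e l x (x + v)
  rw [add_sub_cancel_left] at this
  linarith

lemma grad_of_notMem (hl : l ∉ e) : grad e l = 0 := by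
  simp [grad, bary_of_notMem hl]

@[fun_prop]
lemma continuous_bary (e : Finset (Space d)) (l : Space d) : Continuous (bary e l) :=
  (bary e l).continuous_of_finiteDimensional

lemma IsSimplex.bary_eq_coord (h : IsSimplex e) (l : e) : bary e l = h.basis.coord l := by
  simp [bary, h]

lemma IsSimplex.sum_bary (h : IsSimplex e) (x : Space d) : ∑ l ∈ e, bary e l x = 1 := by
  rw [← Finset.sum_coe_sort, ← h.basis.sum_coord_apply_eq_one x]
  exact Finset.sum_congr rfl fun l _ => by rw [h.bary_eq_coord]

lemma IsSimplex.sum_bary_smul (h : IsSimplex e) (x : Space d) :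
    ∑ l ∈ e, bary e l x • l = x := by
  rw [← Finset.sum_coe_sort]
  conv_rhs => rw [← h.basis.linear_combination_coord_eq_self x]
  exact Finset.sum_congr rfl fun l _ => by rw [h.bary_eq_coord]; rfl

lemma IsSimplex.bary_eq (h : IsSimplex e) {α : Space d → ℝ} (h1 : ∑ l ∈ e, α l = 1)
    (hx : ∑ l ∈ e, α l • l = x) (hl : l ∈ e) : bary e l x = α l := by
  rw [show bary e l = h.basis.coord ⟨l, hl⟩ from h.bary_eq_coord ⟨l, hl⟩]
  rw [← Finset.sum_coe_sort] at h1 hx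
  have := h.basis.coord_apply_combination_of_mem (Finset.mem_univ (⟨l, hl⟩ : e))
    (w := fun i : e => α i) h1
  rw [Finset.univ.affineCombination_eq_linear_combination _ _ h1] at this
  rw [← hx]
  exact this

lemma IsSimplex.bary_self (h : IsSimplex e) (hl : l ∈ e) : bary e l l = 1 := by
  rw [show bary e l = h.basis.coord ⟨l, hl⟩ from h.bary_eq_coord ⟨l, hl⟩]
  exact h.basis.coord_apply_eq ⟨l, hl⟩

lemma IsSimplex.bary_of_ne (h : IsSimplex e) (hm : m ∈ e) (hlm : l ≠ m) : bary e l m = 0 := by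
  by_cases hl : l ∈ e
  · rw [show bary e l = h.basis.coord ⟨l, hl⟩ from h.bary_eq_coord ⟨l, hl⟩]
    exact h.basis.coord_apply_ne (i := ⟨l, hl⟩) (j := ⟨m, hm⟩) (by simpa using hlm)
  · simp [bary_of_notMem hl]

lemma IsSimplex.mem_convexHull_iff (h : IsSimplex e) :
    x ∈ convexHull ℝ (e : Set (Space d)) ↔ ∀ l ∈ e, 0 ≤ bary e l x := by
  rw [Finset.mem_convexHull']
  constructor
  · rintro ⟨w, h0, h1, hx⟩ l hl
    rw [h.bary_eq h1 hx hl]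
    exact h0 l hl
  · exact fun h0 => ⟨fun l => bary e l x, h0, h.sum_bary x, h.sum_bary_smul x⟩

lemma IsSimplex.bary_nonneg (h : IsSimplex e) (hx : x ∈ convexHull ℝ (e : Set (Space d)))
    (l : Space d) : 0 ≤ bary e l x := by
  by_cases hl : l ∈ e
  · exact h.mem_convexHull_iff.1 hx l hl
  · simp [bary_of_notMem hl]

lemma IsSimplex.bary_le_one (h : IsSimplex e) (hx : x ∈ convexHull ℝ (e : Set (Space d)))
    (l : Space d) : bary e l x ≤ 1 := by
  by_cases hl : l ∈ e
  · rw [← h.sum_bary x]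
    exact Finset.single_le_sum (fun l _ => h.bary_nonneg hx l) hl
  · simp [bary_of_notMem hl]

lemma IsSimplex.sum_grad (h : IsSimplex e) : ∑ l ∈ e, grad e l = 0 := by
  refine ext_inner_right ℝ fun v => ?_
  have h1 := h.sum_bary v
  have h0 := h.sum_bary 0
  simp only [sum_inner, inner_zero_left]
  have : ∀ l ∈ e, inner ℝ (grad e l) v = bary e l v - bary e l 0 := fun l _ => by
    rw [bary_sub_bary, sub_zero]
  rw [Finset.sum_congr rfl this, Finset.sum_sub_distrib, h1, h0, sub_self]

lemma IsSimplex.sum_inner_grad_smul (h : IsSimplex e) (v : Space d) :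
    ∑ l ∈ e, (inner ℝ (grad e l) v : ℝ) • l = v := by
  have h1 := h.sum_bary_smul v
  have h0 := h.sum_bary_smul 0
  have : ∀ l ∈ e, (inner ℝ (grad e l) v : ℝ) • l = bary e l v • l - bary e l 0 • l :=
    fun l _ => by rw [← sub_smul, bary_sub_bary, sub_zero]
  rw [Finset.sum_congr rfl this, Finset.sum_sub_distrib, h1, h0, sub_zero]

lemma IsSimplex.inner_grad_self_sub (h : IsSimplex e) (hl : l ∈ e) (hm : m ∈ e) (hlm : l ≠ m) :
    inner ℝ (grad e l) (l - m) = 1 := by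
  rw [← bary_sub_bary, h.bary_self hl, h.bary_of_ne hm hlm, sub_zero]

lemma IsSimplex.translate (h : IsSimplex e) (v : Space d) :
    IsSimplex (e.map (addRightEmbedding v)) := by
  refine ⟨?_, by simpa using h.card⟩
  have h1 := (affineIndependent_vadd (k := ℝ) (v := v) (p := ((↑) : e → Space d))).2 h.indep
  have h2 : Set.range (v +ᵥ ((↑) : e → Space d)) =
      ((e.map (addRightEmbedding v) : Finset (Space d)) : Set (Space d)) := by
    ext x
    simp only [Set.mem_range, Pi.vadd_apply, vadd_eq_add, Subtype.exists, Finset.coe_map,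
      addRightEmbedding_apply, Set.mem_image, Finset.mem_coe, exists_prop, add_comm v]
  have h3 := h1.range
  rw [h2] at h3
  exact h3

lemma bary_translate (h : IsSimplex e) (v l x : Space d) :
    bary (e.map (addRightEmbedding v)) (l + v) (x + v) = bary e l x := by
  by_cases hl : l ∈ e
  · refine (h.translate v).bary_eq (α := fun m => bary e (m - v) x) ?_ ?_ ?_ |>.trans ?_
    · simp [h.sum_bary]
    · simp only [Finset.sum_map, addRightEmbedding_apply, add_sub_cancel_right, smul_add,
        Finset.sum_add_distrib, h.sum_bary_smul, ← Finset.sum_smul, h.sum_bary, one_smul]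
    · simpa using hl
    · simp
  · rw [bary_of_notMem hl, bary_of_notMem (by simpa using hl)]
    simp

lemma grad_translate (h : IsSimplex e) (v l : Space d) :
    grad (e.map (addRightEmbedding v)) (l + v) = grad e l := by
  refine ext_inner_right ℝ fun w => ?_
  have h1 := bary_sub_bary (e.map (addRightEmbedding v)) (l + v) (0 + v) (w + v)
  have h2 := bary_sub_bary e l 0 w
  rw [bary_translate h, bary_translate h, h2] at h1
  simpa using h1.symm

/-- The volume of the simplex with vertex set `e`. -/
noncomputable def simplexVolume (e : Finset (Space d)) : ℝ :=
  volume.real (convexHull ℝ (e : Set (Space d)))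

lemma IsSimplex.simplexVolume_pos (h : IsSimplex e) : 0 < simplexVolume e := by
  have h1 : (interior (convexHull ℝ (e : Set (Space d)))).Nonempty := by
    rw [interior_convexHull_nonempty_iff_affineSpan_eq_top]
    have := h.basis.tot
    rwa [show Set.range h.basis = (e : Set (Space d)) from Subtype.range_coe] at this
  refine ENNReal.toReal_pos (Measure.measure_pos_of_nonempty_interior _ h1).ne' ?_
  exact (e.finite_toSet.isCompact_convexHull ℝ).measure_ne_top

open scoped Pointwise in
lemma simplexVolume_translate (e : Finset (Space d)) (v : Space d) :
    simplexVolume (e.map (addRightEmbedding v)) = simplexVolume e := by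
  have : convexHull ℝ ((e.map (addRightEmbedding v) : Finset (Space d)) : Set (Space d)) =
      v +ᵥ convexHull ℝ (e : Set (Space d)) := by
    rw [← convexHull_vadd]
    congr 1
    ext x
    simp only [Finset.coe_map, addRightEmbedding_apply, Set.mem_image, Finset.mem_coe,
      Set.mem_vadd_set, vadd_eq_add, add_comm v]
  rw [simplexVolume, this, measureReal_def, measure_vadd]
  rfl

/-- The point of `ℝ^{d+1}` whose last `d` coordinates are those of `t` and whose sum of coordinates
is one. -/
def stdCoord {d : ℕ} (t : Fin d → ℝ) : Fin (d + 1) → ℝ := Fin.cons (1 - ∑ i, t i) t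

/-- Up to a constant factor, the map that takes a point to its barycentric coordinates (one of them
omitted) preserves the Lebesgue measure. -/
lemma IsSimplex.exists_map_volume (h : IsSimplex e) (σ : Fin (d + 1) ≃ e) :
    ∃ Ψ : Space d → Fin d → ℝ, MeasurableEmbedding Ψ ∧
      (∀ x i, stdCoord (Ψ x) i = bary e (σ i) x) ∧
      ∃ c : NNReal, Measure.map Ψ volume = c • (volume : Measure (Fin d → ℝ)) := by
  have hsum : ∀ f : Space d → ℝ, ∑ l ∈ e, f l = f (σ 0) + ∑ i : Fin d, f (σ i.succ) := by
    intro f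
    rw [← Finset.sum_coe_sort, ← σ.sum_comp, Fin.sum_univ_succ]
  let A : Space d →ₗ[ℝ] (Fin d → ℝ) := LinearMap.pi fun i => (bary e (σ i.succ)).linear
  have hA : Function.Injective A := by
    rw [← LinearMap.ker_eq_bot, LinearMap.ker_eq_bot']
    intro v hv
    have hi : ∀ i : Fin d, inner ℝ (grad e (σ i.succ)) v = (0 : ℝ) := fun i => by
      rw [inner_grad]; exact congrFun hv i
    have h0 : inner ℝ (grad e (σ 0)) v = (0 : ℝ) := by
      have := congrArg (fun u => (inner ℝ u v : ℝ)) h.sum_grad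
      simp only [sum_inner, inner_zero_left] at this
      rw [hsum (fun l => inner ℝ (grad e l) v)] at this
      simpa [hi] using this
    rw [← h.sum_inner_grad_smul v, ← Finset.sum_coe_sort, ← σ.sum_comp, Fin.sum_univ_succ]
    simp [hi, h0]
  let B : Space d ≃ₗ[ℝ] (Fin d → ℝ) := LinearEquiv.ofInjectiveOfFinrankEq A hA (by simp)
  let C : Space d ≃L[ℝ] (Fin d → ℝ) := B.toContinuousLinearEquiv
  let w : Fin d → ℝ := fun i => bary e (σ i.succ) 0
  have hC : ∀ x i, C x i = (bary e (σ i.succ)).linear x := fun x i => rfl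
  have hCm : MeasurableEmbedding C := C.toHomeomorph.measurableEmbedding
  refine ⟨fun x => C x + w, ?_, ?_, ?_⟩
  · exact (MeasurableEquiv.addRight w).measurableEmbedding.comp hCm
  · have hs : ∀ x (i : Fin d), C x i + w i = bary e (σ i.succ) x := by
      intro x i
      rw [hC, ← inner_grad]
      have := bary_sub_bary e (σ i.succ) 0 x
      rw [sub_zero] at this
      rw [← this]
      exact sub_add_cancel _ _
    intro x i
    refine Fin.cases ?_ (fun i => ?_) i
    · simp only [stdCoord, Fin.cons_zero, Pi.add_apply, hs]
      have := h.sum_bary x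
      rw [hsum (fun l => bary e l x)] at this
      linarith
    · simp only [stdCoord, Fin.cons_succ, Pi.add_apply, hs]
  · refine ⟨Measure.addHaarScalarFactor (Measure.map C volume) volume, ?_⟩
    have h1 : Measure.map C volume = Measure.addHaarScalarFactor (Measure.map C volume) volume •
        (volume : Measure (Fin d → ℝ)) := Measure.isAddLeftInvariant_eq_smul _ _
    have h2 : (fun x => C x + w) = (fun y => y + w) ∘ C := rfl
    rw [h2, ← Measure.map_map (measurable_add_const w) hCm.measurable, map_add_right_eq_self]
    exact h1

/-- The integral over the space of a fixed function of the barycentric coordinates is proportional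
to the volume of the simplex, with a factor that depends neither on the simplex nor on the
enumeration of its vertices. -/
lemma exists_integral_bary_eq (F : (Fin (d + 1) → ℝ) → ℝ) :
    ∃ κ : ℝ, ∀ e : Finset (Space d), IsSimplex e → ∀ σ : Fin (d + 1) ≃ e,
      ∫ x, F (fun i => bary e (σ i) x) = κ * simplexVolume e := by
  let S : Set (Fin d → ℝ) := {t | ∀ i, 0 ≤ stdCoord t i}
  refine ⟨(∫ t, F (stdCoord t)) / volume.real S, fun e h σ => ?_⟩
  obtain ⟨Ψ, hΨ, hco, c, hc⟩ := h.exists_map_volume σ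
  have h1 : ∫ x, F (fun i => bary e (σ i) x) = c * ∫ t, F (stdCoord t) := by
    have := hΨ.integral_map (μ := volume) (fun t => F (stdCoord t))
    rw [hc, integral_smul_nnreal_measure] at this
    rw [NNReal.smul_def, smul_eq_mul] at this
    rw [this]
    refine integral_congr_ae (Filter.Eventually.of_forall fun x => ?_)
    simp only
    congr 1
    ext i
    exact (hco x i).symm
  have h2 : simplexVolume e = c * volume.real S := by
    have : convexHull ℝ (e : Set (Space d)) = Ψ ⁻¹' S := by
      ext x
      rw [h.mem_convexHull_iff]
      simp only [S, Set.mem_preimage, Set.mem_ofPred_eq, hco]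
      exact ⟨fun hx i => hx _ (σ i).2, fun hx l hl => by simpa using hx (σ.symm ⟨l, hl⟩)⟩
    rw [simplexVolume, this, measureReal_def, ← hΨ.map_apply, hc]
    simp [measureReal_def]
  have h3 := h.simplexVolume_pos
  rw [h2] at h3
  have h4 : volume.real S ≠ 0 := by
    rintro h0
    simp [h0] at h3
  rw [h1, h2]
  field_simp

end

/-! ### Hat functions -/

/-- A function that near every point `x` grows at most as `C ‖y - x‖` is Lipschitz. -/
lemma lipschitzWith_of_forall_eventually {E : Type*} [NormedAddCommGroup E] [NormedSpace ℝ E]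
    {f : E → ℝ} {C : NNReal} (h : ∀ x, ∀ᶠ y in 𝓝 x, |f y - f x| ≤ C * ‖y - x‖) :
    LipschitzWith C f := by
  have hcont : Continuous f := by
    refine continuous_iff_continuousAt.2 fun x => ?_
    rw [ContinuousAt, tendsto_iff_dist_tendsto_zero]
    refine squeeze_zero' (Eventually.of_forall fun _ => dist_nonneg)
      ((h x).mono fun y hy => hy) ?_
    have : Tendsto (fun y => (C : ℝ) * ‖y - x‖) (𝓝 x) (𝓝 (C * ‖x - x‖)) :=
      (Continuous.tendsto (by fun_prop) x)
    simpa using this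
  have key : ∀ x y, f y - f x ≤ C * ‖y - x‖ := by
    intro x y
    have hline : Continuous fun t : ℝ => x + t • (y - x) := by fun_prop
    have := image_le_of_liminf_slope_right_le_deriv_boundary (a := 0) (b := 1)
      (f := fun t : ℝ => f (x + t • (y - x)) - f x) (B := fun t => C * ‖y - x‖ * t)
      (B' := fun _ => C * ‖y - x‖) (by fun_prop) (by simp) (by fun_prop)
      (fun t _ => by simpa using ((hasDerivAt_id t).const_mul (C * ‖y - x‖)).hasDerivWithinAt)
      (fun t _ r hr => by
        refine Eventually.frequently ?_
        have h1 := (hline.tendsto t).eventually (h (x + t • (y - x)))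
        filter_upwards [h1.filter_mono nhdsWithin_le_nhds, self_mem_nhdsWithin] with z hz hzt
        refine lt_of_le_of_lt ?_ hr
        have hzt' : 0 < z - t := sub_pos.2 hzt
        rw [slope_def_field, div_le_iff₀ hzt']
        have e1 : x + z • (y - x) - (x + t • (y - x)) = (z - t) • (y - x) := by
          rw [sub_smul]; abel
        rw [e1, norm_smul, Real.norm_eq_abs, abs_of_pos hzt'] at hz
        have := le_abs_self (f (x + z • (y - x)) - f (x + t • (y - x)))
        linarith)
      (x := 1) (by simp)
    simpa using this
  refine LipschitzWith.of_dist_le_mul fun x y => ?_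
  rw [Real.dist_eq, dist_eq_norm, abs_le]
  constructor
  · have := key x y
    rw [norm_sub_rev] at this
    linarith
  · exact key y x

/-- The product of two Lipschitz functions with values in `[0, 1]` is Lipschitz. -/
lemma lipschitzWith_mul_of_mem_Icc {E : Type*} [PseudoMetricSpace E] {f g : E → ℝ} {C D : NNReal}
    (hf : LipschitzWith C f) (hg : LipschitzWith D g) (hf1 : ∀ x, f x ∈ Set.Icc (0 : ℝ) 1)
    (hg1 : ∀ x, g x ∈ Set.Icc (0 : ℝ) 1) : LipschitzWith (C + D) fun x => f x * g x := by
  refine LipschitzWith.of_dist_le_mul fun x y => ?_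
  have h1 := hf.dist_le_mul x y
  have h2 := hg.dist_le_mul x y
  rw [Real.dist_eq] at *
  have e1 : f x * g x - f y * g y = (f x - f y) * g x + f y * (g x - g y) := by ring
  rw [e1]
  refine (abs_add_le _ _).trans ?_
  rw [abs_mul, abs_mul, abs_of_nonneg (hg1 x).1, abs_of_nonneg (hf1 y).1]
  push_cast
  nlinarith [abs_nonneg (f x - f y), abs_nonneg (g x - g y), (hg1 x).1, (hg1 x).2, (hf1 y).1,
    (hf1 y).2]

namespace PeriodicMesh

variable {d : ℕ} (M : PeriodicMesh d) {e e' : Finset (Space d)} {l p x y : Space d}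

lemma isSimplex (he : e ∈ M.elements) : IsSimplex e := ⟨M.indep he.1, he.2⟩

lemma finite_starAt (p : Space d) : {e | e ∈ M.elements ∧ p ∈ e}.Finite := by
  refine (M.locallyFinite {p} isCompact_singleton).subset ?_
  rintro e ⟨he, hp⟩
  exact ⟨he.1, p, subset_convexHull ℝ _ (by exact_mod_cast hp), rfl⟩

/-- The elements that have the vertex `p`. -/
noncomputable def starAt (p : Space d) : Finset (Finset (Space d)) := (M.finite_starAt p).toFinset

lemma mem_starAt : e ∈ M.starAt p ↔ e ∈ M.elements ∧ p ∈ e := by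
  simp [starAt]

/-- Barycentric coordinates of a common point of two elements agree; this is where the conformity
of the mesh is used. -/
lemma bary_eq_bary (he : e ∈ M.elements) (he' : e' ∈ M.elements)
    (hx : x ∈ convexHull ℝ (e : Set (Space d))) (hx' : x ∈ convexHull ℝ (e' : Set (Space d)))
    (l : Space d) : bary e l x = bary e' l x := by
  classical
  have hxx := M.inter_subset_convexHull he.1 he'.1 ⟨hx, hx'⟩
  rw [← Finset.coe_inter, Finset.mem_convexHull'] at hxx
  obtain ⟨w, -, h1, hw⟩ := hxx
  have key : ∀ e₁ ∈ M.elements, e ∩ e' ⊆ e₁ → bary e₁ l x = if l ∈ e ∩ e' then w l else 0 := by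
    intro e₁ he₁ hsub
    by_cases hl : l ∈ e₁
    · refine (M.isSimplex he₁).bary_eq (α := fun l => if l ∈ e ∩ e' then w l else 0) ?_ ?_ hl
      · rw [← Finset.sum_filter, Finset.filter_mem_eq_inter, Finset.inter_eq_right.2 hsub, h1]
      · simp only [ite_smul, zero_smul]
        rw [← Finset.sum_filter, Finset.filter_mem_eq_inter, Finset.inter_eq_right.2 hsub, hw]
    · rw [bary_of_notMem hl, if_neg fun h => hl (hsub h)]
      rfl
  rw [key e he Finset.inter_subset_left, key e' he' Finset.inter_subset_right]

/-- The hat function of `l`: the continuous function that is affine on each element, equals `1` at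
`l` and vanishes at the other nodes (identically zero if `l` is not a node). -/
noncomputable def hat (l x : Space d) : ℝ := bary (M.cover x).choose l x

lemma hat_eq (he : e ∈ M.elements) (hx : x ∈ convexHull ℝ (e : Set (Space d))) (l : Space d) :
    M.hat l x = bary e l x := by
  obtain ⟨h1, h2, h3⟩ := (M.cover x).choose_spec
  exact M.bary_eq_bary ⟨h1, h2⟩ he h3 hx l

lemma exists_mem_element (x : Space d) :
    ∃ e ∈ M.elements, x ∈ convexHull ℝ (e : Set (Space d)) := by
  obtain ⟨e, h1, h2, h3⟩ := M.cover x
  exact ⟨e, ⟨h1, h2⟩, h3⟩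

lemma hat_mem_Icc (l x : Space d) : M.hat l x ∈ Set.Icc (0 : ℝ) 1 := by
  obtain ⟨e, he, hx⟩ := M.exists_mem_element x
  rw [M.hat_eq he hx]
  exact ⟨(M.isSimplex he).bary_nonneg hx l, (M.isSimplex he).bary_le_one hx l⟩

lemma mem_of_hat_pos (he : e ∈ M.elements) (hx : x ∈ convexHull ℝ (e : Set (Space d)))
    (h : 0 < M.hat l x) : l ∈ e := by
  by_contra hl
  rw [M.hat_eq he hx, bary_of_notMem hl] at h
  exact lt_irrefl _ h

/-- By local finiteness, points close to `x` share an element with `x`. -/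
lemma eventually_exists_element (x : Space d) :
    ∀ᶠ y in 𝓝 x, ∃ e ∈ M.elements, x ∈ convexHull ℝ (e : Set (Space d)) ∧
      y ∈ convexHull ℝ (e : Set (Space d)) := by
  have hfin := M.locallyFinite (Metric.closedBall x 1) (isCompact_closedBall x 1)
  have h1 : ∀ᶠ y in 𝓝 x, ∀ s ∈ {s | s ∈ M.faces ∧
      (convexHull ℝ (s : Set (Space d)) ∩ Metric.closedBall x 1).Nonempty},
      y ∈ convexHull ℝ (s : Set (Space d)) → x ∈ convexHull ℝ (s : Set (Space d)) := by
    rw [eventually_all_finite hfin]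
    intro s _
    by_cases hx : x ∈ convexHull ℝ (s : Set (Space d))
    · exact Eventually.of_forall fun _ _ => hx
    · have : (convexHull ℝ (s : Set (Space d)))ᶜ ∈ 𝓝 x :=
        (s.finite_toSet.isCompact_convexHull ℝ).isClosed.isOpen_compl.mem_nhds hx
      filter_upwards [this] with y hy hy'
      exact absurd hy' hy
  filter_upwards [h1, Metric.closedBall_mem_nhds x one_pos] with y hy hyx
  obtain ⟨e, he, hye⟩ := M.exists_mem_element y
  exact ⟨e, he, hy e ⟨he.1, y, hye, hyx⟩ hye, hye⟩

lemma exists_lipschitzWith_hat (l : Space d) : ∃ C, LipschitzWith C (M.hat l) := by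
  refine ⟨∑ e ∈ M.starAt l, ‖grad e l‖₊, lipschitzWith_of_forall_eventually fun x => ?_⟩
  filter_upwards [M.eventually_exists_element x] with y ⟨e, he, hx, hy⟩
  rw [M.hat_eq he hx, M.hat_eq he hy, bary_sub_bary]
  refine (abs_real_inner_le_norm _ _).trans ?_
  gcongr
  by_cases hl : l ∈ e
  · push_cast
    exact Finset.single_le_sum (f := fun e => ‖grad e l‖) (fun _ _ => norm_nonneg _)
      (M.mem_starAt.2 ⟨he, hl⟩)
  · rw [grad_of_notMem hl, norm_zero]
    positivity

@[fun_prop]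
lemma continuous_hat (l : Space d) : Continuous (M.hat l) :=
  (M.exists_lipschitzWith_hat l).choose_spec.continuous

/-- The interior of the simplex `e`. -/
def openSimplex (e : Finset (Space d)) : Set (Space d) := {x | ∀ l ∈ e, 0 < bary e l x}

lemma isOpen_openSimplex (e : Finset (Space d)) : IsOpen (openSimplex e) := by
  have : openSimplex e = ⋂ l ∈ e, {x | 0 < bary e l x} := by ext; simp [openSimplex]
  rw [this]
  exact isOpen_biInter_finset fun l _ => isOpen_lt continuous_const (by fun_prop)

lemma openSimplex_subset (he : e ∈ M.elements) :
    openSimplex e ⊆ convexHull ℝ (e : Set (Space d)) := fun _ hx =>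
  (M.isSimplex he).mem_convexHull_iff.2 fun l hl => (hx l hl).le

/-- An interior point of an element belongs to no other element. -/
lemma eq_of_mem_openSimplex (he : e ∈ M.elements) (he' : e' ∈ M.elements) (hx : x ∈ openSimplex e)
    (hx' : x ∈ convexHull ℝ (e' : Set (Space d))) : e = e' := by
  refine Finset.eq_of_subset_of_card_le (fun l hl => ?_) (by rw [he.2, he'.2])
  refine M.mem_of_hat_pos he' hx' ?_
  rw [M.hat_eq he (M.openSimplex_subset he hx)]
  exact hx l hl

lemma exists_element_of_node (j : M.Node) : ∃ e ∈ M.elements, M.pos j ∈ e := by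
  obtain ⟨e, he, hx⟩ := M.exists_mem_element (M.pos j)
  refine ⟨e, he, ?_⟩
  have := M.inter_subset_convexHull j.2 he.1 ⟨subset_convexHull ℝ _ (by simp [pos]), hx⟩
  by_contra h
  have h0 : ((({j.1} : Finset (Space d)) : Set (Space d)) ∩ (e : Set (Space d))) = ∅ := by
    ext y
    simp only [Finset.coe_singleton, Set.mem_inter_iff, Set.mem_singleton_iff, Finset.mem_coe,
      Set.mem_empty_iff_false, iff_false, not_and]
    rintro rfl
    exact h
  rw [h0, convexHull_empty] at this
  exact this

/-- The vertices of an element are nodes. -/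
lemma exists_node (he : e ∈ M.elements) (hl : l ∈ e) : ∃ k : M.Node, M.pos k = l :=
  ⟨⟨l, M.down_closed he.1 (by simpa using hl) (by simp)⟩, rfl⟩

/-- The median dual cell is the set where the hat function of its node is the largest one. -/
lemma dualCell_eq (j : M.Node) :
    M.dualCell j = {x | ∀ l, M.hat l x ≤ M.hat (M.pos j) x} := by
  ext x
  constructor
  · rintro ⟨e, he, hj, α, h0, h1, hmax, rfl⟩ l
    have hx : ∑ l ∈ e, α l • l ∈ convexHull ℝ (e : Set (Space d)) := by
      rw [Finset.mem_convexHull']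
      exact ⟨α, h0, h1, rfl⟩
    rw [M.hat_eq he hx, M.hat_eq he hx, (M.isSimplex he).bary_eq h1 rfl hj]
    by_cases hl : l ∈ e
    · rw [(M.isSimplex he).bary_eq h1 rfl hl]
      exact hmax l hl
    · rw [bary_of_notMem hl]
      exact h0 _ hj
  · intro hmax
    obtain ⟨e, he, hx⟩ := M.exists_mem_element x
    have hj : M.pos j ∈ e := by
      by_contra hj
      have h1 := (M.isSimplex he).sum_bary x
      rw [Finset.sum_eq_zero] at h1
      · exact zero_ne_one h1
      · intro l _
        refine le_antisymm ?_ ((M.isSimplex he).bary_nonneg hx l)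
        have := hmax l
        rwa [M.hat_eq he hx, M.hat_eq he hx, bary_of_notMem hj] at this
    refine ⟨e, he, hj, fun l => bary e l x, (M.isSimplex he).mem_convexHull_iff.1 hx,
      (M.isSimplex he).sum_bary x, fun l _ => ?_, (M.isSimplex he).sum_bary_smul x⟩
    have := hmax l
    rwa [M.hat_eq he hx, M.hat_eq he hx] at this

lemma isClosed_dualCell (j : M.Node) : IsClosed (M.dualCell j) := by
  have : M.dualCell j = ⋂ l, {x | M.hat l x ≤ M.hat (M.pos j) x} := by
    rw [dualCell_eq]; ext; simp
  rw [this]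
  exact isClosed_iInter fun l => isClosed_le (by fun_prop) (by fun_prop)

lemma hat_pos_of_mem_dualCell {j : M.Node} (hx : x ∈ M.dualCell j) : 0 < M.hat (M.pos j) x := by
  rw [dualCell_eq] at hx
  obtain ⟨e, he, hxe⟩ := M.exists_mem_element x
  obtain ⟨l, -, hl⟩ := Finset.exists_lt_of_sum_lt (s := e) (f := fun _ => (0 : ℝ))
    (g := fun l => bary e l x) (by simp [(M.isSimplex he).sum_bary])
  have := hx l
  rw [M.hat_eq he hxe l] at this
  exact hl.trans_le this

lemma cellVolume_ne_zero (j : M.Node) : M.cellVolume j ≠ 0 := by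
  obtain ⟨e, he, hj⟩ := M.exists_element_of_node j
  have hs := M.isSimplex he
  have hopen : IsOpen (openSimplex e ∩
      ⋂ l ∈ e.erase (M.pos j), {x | bary e l x < bary e (M.pos j) x}) :=
    (isOpen_openSimplex e).inter
      (isOpen_biInter_finset fun l _ => isOpen_lt (by fun_prop) (by fun_prop))
  have hsub : openSimplex e ∩ (⋂ l ∈ e.erase (M.pos j), {x | bary e l x < bary e (M.pos j) x}) ⊆
      M.dualCell j := by
    rintro x ⟨hx, hx'⟩
    rw [dualCell_eq]
    intro l
    have hxe := M.openSimplex_subset he hx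
    rw [M.hat_eq he hxe, M.hat_eq he hxe]
    by_cases hl : l ∈ e
    · by_cases hlj : l = M.pos j
      · rw [hlj]
      · simp only [Set.mem_iInter] at hx'
        exact (hx' l (Finset.mem_erase.2 ⟨hlj, hl⟩)).le
    · rw [bary_of_notMem hl]
      exact (hx _ hj).le
  have hne : (openSimplex e ∩
      ⋂ l ∈ e.erase (M.pos j), {x | bary e l x < bary e (M.pos j) x}).Nonempty := by
    classical
    -- the barycentric coordinates are proportional to `1` at the other vertices and to `2` at `j`
    let α : Space d → ℝ := fun l => (if l = M.pos j then 2 else 1) / (d + 2)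
    have h1 : ∑ l ∈ e, α l = 1 := by
      have : ∀ l, α l = 1 / (d + 2) + if l = M.pos j then (1 : ℝ) / (d + 2) else 0 := by
        intro l
        simp only [α]
        split_ifs <;> ring
      have hd : (d : ℝ) + 2 ≠ 0 := by positivity
      simp only [this, Finset.sum_add_distrib, Finset.sum_const, he.2, Finset.sum_ite_eq', hj,
        if_true, nsmul_eq_mul]
      push_cast
      field_simp
      ring
    have hα : ∀ l ∈ e, bary e l (∑ l ∈ e, α l • l) = α l := fun l hl => hs.bary_eq h1 rfl hl
    refine ⟨∑ l ∈ e, α l • l, fun l hl => ?_, ?_⟩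
    · rw [hα l hl]
      simp only [α]
      split_ifs <;> positivity
    · simp only [Set.mem_iInter]
      intro l hl
      rw [Set.mem_ofPred_eq, hα l (Finset.mem_of_mem_erase hl), hα _ hj]
      simp only [α, if_neg (Finset.ne_of_mem_erase hl), if_true]
      gcongr
      norm_num
  refine (ENNReal.toReal_pos ?_ ?_).ne'
  · exact ((hopen.measure_pos volume hne).trans_le (measure_mono hsub)).ne'
  · exact ((measure_mono (M.dualCell_subset_star j)).trans_lt
      (M.star_isCompact j).measure_lt_top).ne

end PeriodicMesh

/-! ### The gradient identity on a face of the mesh -/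

/-- The zero set of an affine function that is not identically zero is a null set. -/
lemma volume_setOf_affineMap_eq_zero {d : ℕ} (a : Space d →ᵃ[ℝ] ℝ) {x₀ : Space d} (h : a x₀ ≠ 0) :
    volume {x | a x = 0} = 0 := by
  have h1 : ((AffineSubspace.mk' (0 : ℝ) ⊥).comap a : Set (Space d)) = {x | a x = 0} := by
    ext x
    simp [AffineSubspace.mem_mk']
  rw [← h1]
  refine Measure.addHaar_affineSubspace volume _ fun htop => h ?_
  have : x₀ ∈ ((AffineSubspace.mk' (0 : ℝ) ⊥).comap a : Set (Space d)) := by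
    rw [htop]; trivial
  rw [h1] at this
  exact this

/-- An enumeration of a finite set that starts with the elements of a given subset. -/
lemma exists_equiv_filter_image {α : Type*} [DecidableEq α] {N : ℕ} {e s : Finset α} (hs : s ⊆ e)
    (hN : e.card = N) :
    ∃ σ : Fin N ≃ e, ∀ f : α → ℝ,
      ∏ i : Fin N with i.1 < s.card, f (σ i) = ∏ m ∈ s, f m := by
  let τ := s.equivFin.symm
  have hsN : s.card ≤ N := hN ▸ Finset.card_le_card hs
  rcases s.eq_empty_or_nonempty with rfl | ⟨a₀, ha₀⟩
  · exact ⟨(e.equivFinOfCardEq hN).symm, by simp⟩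
  let f : Fin N → α := fun i => if h : i.1 < s.card then τ ⟨i, h⟩ else a₀
  have hf : ∀ i (h : i.1 < s.card), f i = τ ⟨i, h⟩ := fun i h => dif_pos h
  have himage : (Finset.univ.filter fun i : Fin N => i.1 < s.card).image f = s := by
    ext a
    simp only [Finset.mem_image, Finset.mem_filter, Finset.mem_univ, true_and]
    constructor
    · rintro ⟨i, hi, rfl⟩
      rw [hf i hi]
      exact (τ _).2
    · intro ha
      refine ⟨⟨(s.equivFin ⟨a, ha⟩).1, (s.equivFin ⟨a, ha⟩).2.trans_le hsN⟩,
        (s.equivFin ⟨a, ha⟩).2, ?_⟩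
      rw [hf _ (s.equivFin ⟨a, ha⟩).2]
      simp [τ]
  have hinj : Set.InjOn f (Finset.univ.filter fun i : Fin N => i.1 < s.card) := by
    intro i hi k hk hik
    simp only [Finset.coe_filter, Finset.mem_univ, true_and, Set.mem_ofPred_eq] at hi hk
    rw [hf i hi, hf k hk] at hik
    have := τ.injective (Subtype.ext hik)
    exact Fin.ext (by simpa using this)
  obtain ⟨g, hg⟩ := Finset.exists_equiv_extend_of_card_eq (by simpa using hN.symm)
    (himage.trans_subset hs) hinj
  refine ⟨g, fun F => ?_⟩
  have h1 := Finset.prod_image (f := F) hinj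
  rw [himage] at h1
  rw [h1]
  exact Finset.prod_congr rfl fun i hi => by rw [← hg i hi]

namespace PeriodicMesh

variable {d : ℕ}

lemma integrableOn_openSimplex {e : Finset (Space d)} (he : IsSimplex e) {f : Space d → ℝ}
    (hf : Continuous f) : IntegrableOn f (openSimplex e) := by
  refine (hf.continuousOn.integrableOn_compact
    (e.finite_toSet.isCompact_convexHull ℝ)).mono_set fun x hx => ?_
  exact he.mem_convexHull_iff.2 fun l hl => (hx l hl).le

/-- The mean value over a simplex of a product of `r` different barycentric coordinates is a
nonzero number that depends only on `r` and on the dimension. -/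
lemma exists_integral_prod_bary (d r : ℕ) :
    ∃ κ : ℝ, ∀ e : Finset (Space d), IsSimplex e → ∀ s ⊆ e, s.card = r →
      ∫ x in openSimplex e, ∏ m ∈ s, bary e m x = κ * simplexVolume e ∧ κ ≠ 0 := by
  classical
  obtain ⟨κ, hκ⟩ := exists_integral_bary_eq (d := d) (fun α =>
    {α : Fin (d + 1) → ℝ | ∀ i, 0 < α i}.indicator
      (fun α => ∏ i : Fin (d + 1) with i.1 < r, α i) α)
  refine ⟨κ, fun e he s hs hr => ?_⟩
  obtain ⟨σ, hσ⟩ := exists_equiv_filter_image hs he.card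
  have h1 : ∫ x in openSimplex e, ∏ m ∈ s, bary e m x = κ * simplexVolume e := by
    rw [← hκ e he σ, ← integral_indicator (isOpen_openSimplex e).measurableSet]
    refine integral_congr_ae (Eventually.of_forall fun x => ?_)
    simp only [Set.indicator]
    have : x ∈ openSimplex e ↔ (fun i => bary e (σ i) x) ∈
        {α : Fin (d + 1) → ℝ | ∀ i, 0 < α i} := by
      simp only [openSimplex, Set.mem_ofPred_eq]
      exact ⟨fun hx i => hx _ (σ i).2, fun hx l hl => by simpa using hx (σ.symm ⟨l, hl⟩)⟩
    rw [← hr, hσ fun m => bary e m x]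
    by_cases hx : x ∈ openSimplex e
    · rw [if_pos hx, if_pos (this.1 hx)]
    · rw [if_neg hx, if_neg fun h => hx (this.2 h)]
  refine ⟨h1, ?_⟩
  have hcont : Continuous fun x => ∏ m ∈ s, bary e m x := by fun_prop
  have hpos : ∀ x ∈ openSimplex e, 0 < ∏ m ∈ s, bary e m x := fun x hx =>
    Finset.prod_pos fun m hm => hx m (hs hm)
  have h2 : 0 < ∫ x in openSimplex e, ∏ m ∈ s, bary e m x := by
    rw [setIntegral_pos_iff_support_of_nonneg_ae
      ((ae_restrict_iff' (isOpen_openSimplex e).measurableSet).2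
        (Eventually.of_forall fun x hx => (hpos x hx).le)) (integrableOn_openSimplex he hcont)]
    have h3 : (Function.support fun x => ∏ m ∈ s, bary e m x) ∩ openSimplex e = openSimplex e :=
      Set.inter_eq_right.2 fun x hx => (hpos x hx).ne'
    rw [h3]
    refine (isOpen_openSimplex e).measure_pos volume ⟨∑ l ∈ e, ((d : ℝ) + 1)⁻¹ • l, fun l hl => ?_⟩
    rw [he.bary_eq (α := fun _ => ((d : ℝ) + 1)⁻¹) _ rfl hl]
    · positivity
    · rw [Finset.sum_const, he.card, nsmul_eq_mul]
      push_cast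
      exact mul_inv_cancel₀ (by positivity)
  rw [h1] at h2
  rintro rfl
  simp at h2

variable (M : PeriodicMesh d)

lemma exists_lipschitzWith_prod_hat (σ : Finset (Space d)) :
    (∃ C, LipschitzWith C fun x => ∏ l ∈ σ, M.hat l x) := by
  classical
  induction σ using Finset.induction_on with
  | empty => exact ⟨0, by simp⟩
  | insert a s ha ih =>
    obtain ⟨C, hC⟩ := M.exists_lipschitzWith_hat a
    obtain ⟨D, hD⟩ := ih
    refine ⟨C + D, ?_⟩
    simp only [Finset.prod_insert ha]
    exact lipschitzWith_mul_of_mem_Icc hC hD (fun x => M.hat_mem_Icc a x) fun x =>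
      ⟨Finset.prod_nonneg fun l _ => (M.hat_mem_Icc l x).1,
        Finset.prod_le_one (fun l _ => (M.hat_mem_Icc l x).1) fun l _ => (M.hat_mem_Icc l x).2⟩

lemma hat_eq_zero_of_notMem {l x : Space d}
    (hx : x ∉ ⋃ e ∈ M.starAt l, convexHull ℝ (e : Set (Space d))) : M.hat l x = 0 := by
  obtain ⟨e, he, hxe⟩ := M.exists_mem_element x
  rw [M.hat_eq he hxe]
  by_cases hl : l ∈ e
  · exact absurd (Set.mem_biUnion (M.mem_starAt.2 ⟨he, hl⟩) hxe) hx
  · simp [bary_of_notMem hl]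

lemma isCompact_iUnion_starAt (l : Space d) :
    IsCompact (⋃ e ∈ M.starAt l, convexHull ℝ (e : Set (Space d))) :=
  (M.starAt l).isCompact_biUnion fun e _ => e.finite_toSet.isCompact_convexHull ℝ

/-- The integral of the derivative of a compactly supported Lipschitz function is zero. -/
lemma integral_lineDeriv_eq_zero {g : Space d → ℝ} {C : NNReal} (hg : LipschitzWith C g)
    (hc : HasCompactSupport g) (v : Space d) : ∫ x, lineDeriv ℝ g x v = 0 := by
  have h := (LipschitzWith.const (α := Space d) (1 : ℝ)).integral_lineDeriv_mul_eq
    (μ := volume) hg hc (-v)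
  have h0 : ∀ x w : Space d, lineDeriv ℝ (fun _ : Space d => (1 : ℝ)) x w = 0 := fun x w => by
    simp [lineDeriv]
  simpa [h0] using h.symm

lemma lineDeriv_prod_hat {e : Finset (Space d)} (he : e ∈ M.elements) {x : Space d}
    (hx : x ∈ openSimplex e) (σ : Finset (Space d)) [DecidableEq (Space d)] (v : Space d) :
    lineDeriv ℝ (fun x => ∏ l ∈ σ, M.hat l x) x v =
      ∑ i ∈ σ, inner ℝ (grad e i) v * ∏ m ∈ σ.erase i, bary e m x := by
  have h1 : HasDerivAt (fun t : ℝ => ∏ l ∈ σ, bary e l (x + t • v))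
      (∑ i ∈ σ, inner ℝ (grad e i) v * ∏ m ∈ σ.erase i, bary e m x) 0 := by
    have h2 : ∀ l ∈ σ, HasDerivAt (fun t : ℝ => bary e l (x + t • v)) (inner ℝ (grad e l) v) 0 := by
      intro l _
      have h3 : (fun t : ℝ => bary e l (x + t • v)) =
          fun t => bary e l x + t * inner ℝ (grad e l) v := by
        ext t
        rw [bary_add, inner_smul_right]
      rw [h3]
      simpa using ((hasDerivAt_id (0 : ℝ)).mul_const (inner ℝ (grad e l) v)).const_add (bary e l x)
    refine (HasDerivAt.fun_finsetProd h2).congr_deriv ?_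
    refine Finset.sum_congr rfl fun i _ => ?_
    rw [smul_eq_mul, mul_comm]
    simp
  have h2 : (fun t : ℝ => ∏ l ∈ σ, M.hat l (x + t • v)) =ᶠ[𝓝 0]
      fun t => ∏ l ∈ σ, bary e l (x + t • v) := by
    have hc : ContinuousAt (fun t : ℝ => x + t • v) 0 := by fun_prop
    have := hc.preimage_mem_nhds (t := openSimplex e)
      ((isOpen_openSimplex e).mem_nhds (by simpa using hx))
    filter_upwards [this] with t ht
    exact Finset.prod_congr rfl fun l _ => M.hat_eq he (M.openSimplex_subset he ht) l
  exact (h1.congr_of_eventuallyEq h2).deriv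

/-- Gradient identity on the face `σ`: the integral of the gradient of `∏ φ_l`, `l ∈ σ`, is zero. On
an element `e ⊇ σ` the mean value of this gradient is a constant times `∑ ∇φ_l`; on the other
elements the product vanishes. -/
theorem sum_simplexVolume_smul_sum_grad {σ : Finset (Space d)} {i₀ : Space d} (h₀ : i₀ ∈ σ)
    [DecidableEq (Space d)] :
    ∑ e ∈ M.starAt i₀ with σ ⊆ e, simplexVolume e • ∑ i ∈ σ, grad e i = 0 := by
  refine ext_inner_right ℝ fun v => ?_
  set K := ⋃ e ∈ M.starAt i₀, convexHull ℝ (e : Set (Space d)) with hK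
  have hKc := M.isCompact_iUnion_starAt i₀
  obtain ⟨C, hC⟩ := M.exists_lipschitzWith_prod_hat σ
  have hzero : ∀ x ∉ K, ∏ l ∈ σ, M.hat l x = 0 := fun x hx =>
    Finset.prod_eq_zero h₀ (M.hat_eq_zero_of_notMem hx)
  have hint := integral_lineDeriv_eq_zero hC (HasCompactSupport.intro hKc hzero) v
  let D : Finset (Space d) → Space d → ℝ := fun e x =>
    ∑ i ∈ σ, inner ℝ (grad e i) v * ∏ m ∈ σ.erase i, bary e m x
  have hae : (fun x => lineDeriv ℝ (fun x => ∏ l ∈ σ, M.hat l x) x v) =ᵐ[volume]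
      fun x => ∑ e ∈ M.starAt i₀, (openSimplex e).indicator (D e) x := by
    have hnull : volume (⋃ e ∈ M.starAt i₀, ⋃ l ∈ e, {x | bary e l x = 0}) = 0 := by
      refine (measure_biUnion_null_iff (M.starAt i₀).countable_toSet).2 fun e he => ?_
      refine (measure_biUnion_null_iff e.countable_toSet).2 fun l hl => ?_
      refine volume_setOf_affineMap_eq_zero (x₀ := l) _ ?_
      rw [(M.isSimplex (M.mem_starAt.1 he).1).bary_self hl]
      exact one_ne_zero
    filter_upwards [compl_mem_ae_iff.2 hnull] with x hx
    by_cases hxK : x ∈ K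
    · simp only [hK, Set.mem_iUnion] at hxK
      obtain ⟨e, he, hxe⟩ := hxK
      have heM := (M.mem_starAt.1 he).1
      have hxo : x ∈ openSimplex e := by
        intro l hl
        refine lt_of_le_of_ne ((M.isSimplex heM).bary_nonneg hxe l) fun h => hx ?_
        simp only [Set.mem_iUnion]
        exact ⟨e, he, l, hl, h.symm⟩
      rw [M.lineDeriv_prod_hat heM hxo, Finset.sum_eq_single e, Set.indicator_of_mem hxo]
      · intro e' he' hne
        refine Set.indicator_of_notMem (fun hxe' => hne ?_) _
        exact M.eq_of_mem_openSimplex (M.mem_starAt.1 he').1 heM hxe' hxe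
      · exact fun h => absurd he h
    · rw [Finset.sum_eq_zero]
      · have h1 : (fun x => ∏ l ∈ σ, M.hat l x) =ᶠ[𝓝 x] fun _ => 0 := by
          filter_upwards [hKc.isClosed.isOpen_compl.mem_nhds hxK] with y hy using hzero y hy
        rw [h1.lineDeriv_eq]
        simp [lineDeriv]
      · intro e he
        refine Set.indicator_of_notMem (fun hxe => hxK ?_) _
        exact Set.mem_biUnion he (M.openSimplex_subset (M.mem_starAt.1 he).1 hxe)
  rw [integral_congr_ae hae, integral_finsetSum] at hint
  swap
  · intro e he
    rw [integrable_indicator_iff (isOpen_openSimplex e).measurableSet]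
    exact integrableOn_openSimplex (M.isSimplex (M.mem_starAt.1 he).1) (by fun_prop)
  obtain ⟨κ, hκ⟩ := exists_integral_prod_bary d (σ.card - 1)
  have hterm : ∀ e ∈ M.starAt i₀, ∫ x, (openSimplex e).indicator (D e) x =
      if σ ⊆ e then κ * inner ℝ (simplexVolume e • ∑ i ∈ σ, grad e i) v else 0 := by
    intro e he
    have hs := M.isSimplex (M.mem_starAt.1 he).1
    rw [integral_indicator (isOpen_openSimplex e).measurableSet]
    simp only [D]
    split_ifs with hσ
    · rw [integral_finsetSum _ fun i _ => integrableOn_openSimplex hs (by fun_prop),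
        inner_smul_left, sum_inner, Finset.mul_sum, Finset.mul_sum]
      refine Finset.sum_congr rfl fun i hi => ?_
      rw [integral_const_mul, (hκ e hs (σ.erase i) ((Finset.erase_subset _ _).trans hσ)
        (Finset.card_erase_of_mem hi)).1]
      simp only [conj_trivial]
      ring
    · obtain ⟨m, hm, hme⟩ := Finset.not_subset.1 hσ
      refine integral_eq_zero_of_ae (Eventually.of_forall fun x => ?_)
      refine Finset.sum_eq_zero fun i hi => ?_
      by_cases him : i = m
      · rw [him, grad_of_notMem hme, inner_zero_left, zero_mul]
      · rw [Finset.prod_eq_zero (i := m) (Finset.mem_erase.2 ⟨fun h => him h.symm, hm⟩), mul_zero]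
        simp [bary_of_notMem hme]
  rw [Finset.sum_congr rfl hterm, ← Finset.sum_filter, ← Finset.mul_sum, ← sum_inner] at hint
  rw [inner_zero_left]
  rcases (M.starAt i₀ |>.filter (σ ⊆ ·)).eq_empty_or_nonempty with hE | ⟨e, he⟩
  · rw [hE]; simp
  · rw [Finset.mem_filter] at he
    have := (hκ e (M.isSimplex (M.mem_starAt.1 he.1).1) (σ.erase i₀)
      ((Finset.erase_subset _ _).trans he.2) (Finset.card_erase_of_mem h₀)).2
    exact (mul_eq_zero.1 hint).resolve_left this

end PeriodicMesh

/-! ### Area vectors of the interfaces of median dual cells -/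

section

variable {d : ℕ}

/-- The volume of an oblique cylinder of unit height (measured by the linear function `⟨g, ·⟩`) over
a set in a hyperplane, in terms of the `(d-1)`-dimensional measure of the base: by Fubini's theorem,
since all the sections are translates of the base. -/
lemma volume_cylinder {g w p : Space d} (hg : g ≠ 0) (hgw : inner ℝ g w = (1 : ℝ))
    {Z : Set (Space d)} (hZm : MeasurableSet Z) (hZ : ∀ x ∈ Z, inner ℝ g (x - p) = (0 : ℝ)) :
    volume {x | (inner ℝ g (x - p) : ℝ) ∈ Set.Icc (0 : ℝ) 1 ∧
        x - (inner ℝ g (x - p) : ℝ) • w ∈ Z} =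
      ‖(‖g‖ ^ 2)⁻¹ • g‖ₑ * Measure.euclideanHausdorffMeasure (d - 1) Z := by
  set P := {x | (inner ℝ g (x - p) : ℝ) ∈ Set.Icc (0 : ℝ) 1 ∧
        x - (inner ℝ g (x - p) : ℝ) • w ∈ Z} with hP
  have hcont : Continuous fun x : Space d => (inner ℝ g (x - p) : ℝ) := by fun_prop
  have hPm : MeasurableSet P := by
    refine (hcont.measurable measurableSet_Icc).inter ?_
    have : Continuous fun x : Space d => x - (inner ℝ g (x - p) : ℝ) • w := by fun_prop
    exact this.measurable hZm
  have hn : ‖g‖ ^ 2 ≠ 0 := pow_ne_zero _ (norm_ne_zero_iff.2 hg)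
  have hv : (‖g‖ ^ 2)⁻¹ • g ≠ 0 := smul_ne_zero (inv_ne_zero hn) hg
  have h := EuclideanGeometry.euclideanHausdorffMeasure_eq_lintegral p hv hPm
  rw [InnerProductSpace.euclideanHausdorffMeasure_eq_volume, finrank_euclideanSpace,
    Fintype.card_fin] at h
  rw [h]
  congr 1
  have hslice : ∀ t : ℝ, P ∩ (AffineSubspace.mk' (t • ((‖g‖ ^ 2)⁻¹ • g) +ᵥ p)
      (ℝ ∙ ((‖g‖ ^ 2)⁻¹ • g))ᗮ : AffineSubspace ℝ (Space d)) =
      if t ∈ Set.Icc (0 : ℝ) 1 then (fun x => -(t • w) + x) ⁻¹' Z else ∅ := by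
    intro t
    have hmem : ∀ x : Space d, x ∈ (AffineSubspace.mk' (t • ((‖g‖ ^ 2)⁻¹ • g) +ᵥ p)
      (ℝ ∙ ((‖g‖ ^ 2)⁻¹ • g))ᗮ : AffineSubspace ℝ (Space d)) ↔ (inner ℝ g (x - p) : ℝ) = t := by
      intro x
      rw [AffineSubspace.mem_mk', Submodule.mem_orthogonal_singleton_iff_inner_right,
        inner_smul_left, vsub_eq_sub, vadd_eq_add]
      have : x - (t • ((‖g‖ ^ 2)⁻¹ • g) + p) = (x - p) - (t * (‖g‖ ^ 2)⁻¹) • g := by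
        rw [smul_smul]; abel
      rw [this, inner_sub_right, inner_smul_right, real_inner_self_eq_norm_sq]
      simp only [conj_trivial, mul_eq_zero, inv_eq_zero, hn, false_or, inv_mul_cancel_right₀ hn]
      rw [sub_eq_zero]
    ext x
    rw [Set.mem_inter_iff, SetLike.mem_coe, hmem]
    split_ifs with ht
    · simp only [hP, Set.mem_ofPred_eq, Set.mem_preimage, neg_add_eq_sub]
      constructor
      · rintro ⟨⟨-, h2⟩, rfl⟩
        exact h2
      · intro hx
        have h3 := hZ _ hx
        have h4 : x - t • w - p = (x - p) - t • w := by abel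
        rw [h4, inner_sub_right, inner_smul_right, hgw, mul_one, sub_eq_zero] at h3
        rw [h3]
        exact ⟨⟨ht, hx⟩, rfl⟩
    · simp only [hP, Set.mem_ofPred_eq, Set.mem_empty_iff_false, iff_false, not_and]
      rintro ⟨h1, -⟩ rfl
      exact ht h1
  have hind : ∀ t : ℝ, Measure.euclideanHausdorffMeasure (d - 1)
      (P ∩ (AffineSubspace.mk' (t • ((‖g‖ ^ 2)⁻¹ • g) +ᵥ p)
        (ℝ ∙ ((‖g‖ ^ 2)⁻¹ • g))ᗮ : AffineSubspace ℝ (Space d))) =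
      (Set.Icc (0 : ℝ) 1).indicator
        (fun _ => Measure.euclideanHausdorffMeasure (d - 1) Z) t := by
    intro t
    rw [hslice, Set.indicator]
    split_ifs
    · exact measure_preimage_add _ _ _
    · simp
  simp_rw [hind]
  rw [lintegral_indicator measurableSet_Icc]
  simp

/-- The part of the boundary between the dual cells of `j` and `k` that lies in the simplex `e`. -/
def cellFace (e : Finset (Space d)) (j k : Space d) : Set (Space d) :=
  {x | (∀ l ∈ e, 0 ≤ bary e l x) ∧ (∀ l ∈ e, bary e l x ≤ bary e j x) ∧ bary e j x = bary e k x}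

/-- The relative interior of `cellFace e j k`. -/
def openCellFace (e : Finset (Space d)) (j k : Space d) : Set (Space d) :=
  {x | (∀ l ∈ e, 0 < bary e l x) ∧ bary e j x = bary e k x ∧
    ∀ l ∈ e, l ≠ j → l ≠ k → bary e l x < bary e j x}

variable {e : Finset (Space d)} {j k : Space d}

lemma measurableSet_openCellFace (e : Finset (Space d)) (j k : Space d) :
    MeasurableSet (openCellFace e j k) := by
  have h : openCellFace e j k = (⋂ l ∈ e, {x | 0 < bary e l x}) ∩
      ({x | bary e j x = bary e k x} ∩
        ⋂ l ∈ e, {x | l ≠ j → l ≠ k → bary e l x < bary e j x}) := by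
    ext x
    simp [openCellFace]
  rw [h]
  refine (Finset.measurableSet_biInter _ fun l _ => ?_).inter (MeasurableSet.inter ?_
    (Finset.measurableSet_biInter _ fun l _ => ?_))
  · exact (isOpen_lt continuous_const (by fun_prop)).measurableSet
  · exact (isClosed_eq (by fun_prop) (by fun_prop)).measurableSet
  · by_cases hj : l = j
    · simp [hj]
    by_cases hk : l = k
    · simp [hk]
    simp only [ne_eq, hj, hk, not_false_eq_true, true_imp_iff]
    exact (isOpen_lt (by fun_prop) (by fun_prop)).measurableSet

lemma IsSimplex.inner_grad_sub_sub (he : IsSimplex e) (hj : j ∈ e) (hk : k ∈ e) (hjk : j ≠ k) :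
    inner ℝ (grad e k - grad e j) (k - j) = (2 : ℝ) := by
  have h1 := he.inner_grad_self_sub hk hj hjk.symm
  have h2 := he.inner_grad_self_sub hj hk hjk
  rw [← neg_sub k j, inner_neg_right] at h2
  rw [inner_sub_left, h1]
  linarith

lemma IsSimplex.grad_sub_ne_zero (he : IsSimplex e) (hj : j ∈ e) (hk : k ∈ e) (hjk : j ≠ k) :
    grad e k - grad e j ≠ 0 := by
  intro h
  have := he.inner_grad_sub_sub hj hk hjk
  rw [h, inner_zero_left] at this
  norm_num at this

lemma IsSimplex.inner_grad_sub_sub_midpoint (he : IsSimplex e) (hj : j ∈ e) (hk : k ∈ e)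
    (hjk : j ≠ k) (x : Space d) :
    inner ℝ (grad e k - grad e j) (x - (j + (2⁻¹ : ℝ) • (k - j))) = bary e k x - bary e j x := by
  have h1 := he.inner_grad_sub_sub hj hk hjk
  have h2 := bary_sub_bary e k j x
  have h3 := bary_sub_bary e j j x
  rw [he.bary_of_ne hj hjk.symm] at h2
  rw [he.bary_self hj] at h3
  rw [← sub_sub, inner_sub_right, inner_smul_right, h1, inner_sub_left, ← h2, ← h3]
  ring

lemma IsSimplex.inner_grad_half_edge (he : IsSimplex e) (hj : j ∈ e) (hk : k ∈ e) (hjk : j ≠ k)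
    (l : Space d) : inner ℝ (grad e l) ((2⁻¹ : ℝ) • (k - j)) =
      if l = k then (1 / 2 : ℝ) else if l = j then -(1 / 2 : ℝ) else 0 := by
  rw [inner_smul_right, ← bary_sub_bary]
  split_ifs with h1 h2
  · rw [h1, he.bary_self hk, he.bary_of_ne hj hjk.symm]; norm_num
  · rw [h2, he.bary_self hj, he.bary_of_ne hk hjk]; norm_num
  · rw [he.bary_of_ne hk h1, he.bary_of_ne hj h2]; norm_num

/-- The set cut from the hyperplane `λ_j = λ_k` by a transversal hyperplane parallel to the edge
`jk` has zero `(d-1)`-dimensional measure. -/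
lemma IsSimplex.hausdorffMeasure_inter_eq_zero (he : IsSimplex e) (hj : j ∈ e) (hk : k ∈ e)
    (hjk : j ≠ k) (a : Space d →ᵃ[ℝ] ℝ) (ha : a.linear (k - j) = 0) {x₀ : Space d} (h₀ : a x₀ ≠ 0) :
    Measure.euclideanHausdorffMeasure (d - 1) {x | bary e j x = bary e k x ∧ a x = 0} = 0 := by
  have hg := he.grad_sub_ne_zero hj hk hjk
  -- the cylinder over this set in the direction of the edge lies in the null set `a = 0`
  have hac : Continuous a := a.continuous_of_finiteDimensional
  have hm : MeasurableSet {x | bary e j x = bary e k x ∧ a x = 0} :=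
    ((isClosed_eq (by fun_prop) (by fun_prop)).inter
      (isClosed_eq hac continuous_const)).measurableSet
  have hcyl := volume_cylinder (w := (2⁻¹ : ℝ) • (k - j)) (p := j + (2⁻¹ : ℝ) • (k - j)) hg
    (by rw [inner_smul_right, he.inner_grad_sub_sub hj hk hjk]; norm_num) hm
    (fun x hx => by rw [he.inner_grad_sub_sub_midpoint hj hk hjk, hx.1, sub_self])
  have h0 : volume {x | a x = 0} = 0 := volume_setOf_affineMap_eq_zero a h₀
  rw [measure_mono_null _ h0] at hcyl
  · refine (mul_eq_zero.1 hcyl.symm).resolve_left ?_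
    refine enorm_ne_zero.2 ?_
    exact smul_ne_zero (inv_ne_zero (pow_ne_zero _ (norm_ne_zero_iff.2 hg))) hg
  · rintro x ⟨-, -, hx⟩
    rw [sub_eq_add_neg, add_comm, ← vadd_eq_add, a.map_vadd, map_neg, map_smul, map_smul, ha] at hx
    simpa using hx

lemma IsSimplex.hausdorffMeasure_cellFace_diff (he : IsSimplex e) (hj : j ∈ e) (hk : k ∈ e)
    (hjk : j ≠ k) :
    Measure.euclideanHausdorffMeasure (d - 1) (cellFace e j k \ openCellFace e j k) = 0 := by
  have hsub : cellFace e j k \ openCellFace e j k ⊆ ⋃ l ∈ (e : Set (Space d)) \ {j, k},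
      ({x | bary e j x = bary e k x ∧ bary e l x = 0} ∪
        {x | bary e j x = bary e k x ∧
          (bary e l - (2⁻¹ : ℝ) • (bary e j + bary e k)) x = 0}) := by
    rintro x ⟨⟨h0, hle, hxjk⟩, hx⟩
    have hpos : 0 < bary e j x := by
      refine lt_of_le_of_ne (h0 j hj) fun h => ?_
      have h1 := he.sum_bary x
      rw [Finset.sum_eq_zero fun l hl => le_antisymm (h ▸ hle l hl) (h0 l hl)] at h1
      exact zero_ne_one h1
    have hcase : (∃ l ∈ e, bary e l x = 0) ∨ ∃ l ∈ e, l ≠ j ∧ l ≠ k ∧ bary e l x = bary e j x := by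
      by_contra hcon
      push Not at hcon
      exact hx ⟨fun l hl => lt_of_le_of_ne (h0 l hl) (hcon.1 l hl).symm, hxjk,
        fun l hl h1 h2 => lt_of_le_of_ne (hle l hl) (hcon.2 l hl h1 h2)⟩
    rcases hcase with ⟨l, hl, hl0⟩ | ⟨l, hl, h1, h2, hlj⟩
    · have h1 : l ≠ j := by rintro rfl; exact hpos.ne' hl0
      have h2 : l ≠ k := by rintro rfl; exact hpos.ne' (hxjk.trans hl0)
      exact Set.mem_biUnion (x := l) ⟨hl, by simp [h1, h2]⟩ (Or.inl ⟨hxjk, hl0⟩)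
    · refine Set.mem_biUnion (x := l) ⟨hl, by simp [h1, h2]⟩ (Or.inr ⟨hxjk, ?_⟩)
      simp only [AffineMap.coe_sub, AffineMap.coe_smul, AffineMap.coe_add, Pi.sub_apply,
        Pi.smul_apply, Pi.add_apply, smul_eq_mul]
      rw [← hxjk, hlj]
      ring
  refine measure_mono_null hsub ?_
  refine (measure_biUnion_null_iff ((e.finite_toSet.subset Set.sdiff_subset).countable)).2 ?_
  rintro l ⟨hl, hljk⟩
  simp only [Set.mem_insert_iff, Set.mem_singleton_iff, not_or] at hljk
  have hlin : ∀ m, (bary e m).linear (k - j) = bary e m k - bary e m j := fun m => by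
    rw [← inner_grad, bary_sub_bary]
  refine measure_union_null ?_ ?_
  · refine he.hausdorffMeasure_inter_eq_zero hj hk hjk _ ?_ (x₀ := l) ?_
    · rw [hlin, he.bary_of_ne hk hljk.2, he.bary_of_ne hj hljk.1, sub_self]
    · rw [he.bary_self hl]; exact one_ne_zero
  · refine he.hausdorffMeasure_inter_eq_zero hj hk hjk _ ?_ (x₀ := l) ?_
    · simp only [AffineMap.sub_linear, AffineMap.smul_linear, AffineMap.add_linear,
        LinearMap.sub_apply, LinearMap.smul_apply, LinearMap.add_apply, hlin, smul_eq_mul]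
      rw [he.bary_of_ne hk hljk.2, he.bary_of_ne hj hljk.1, he.bary_self hj, he.bary_self hk,
        he.bary_of_ne hk hjk, he.bary_of_ne hj hjk.symm]
      ring
    · simp only [AffineMap.coe_sub, AffineMap.coe_smul, AffineMap.coe_add, Pi.sub_apply,
        Pi.smul_apply, Pi.add_apply, smul_eq_mul]
      rw [he.bary_self hl, he.bary_of_ne hl (Ne.symm hljk.1), he.bary_of_ne hl (Ne.symm hljk.2)]
      norm_num

/-- The area of `cellFace e j k` is `|∇λ_k - ∇λ_j|` times the volume of the simplex, up to a factor
that depends on the dimension only. -/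
lemma exists_area_openCellFace (hd : 0 < d) :
    ∃ κ : ℝ, ∀ e : Finset (Space d), IsSimplex e → ∀ j ∈ e, ∀ k ∈ e, j ≠ k →
      Measure.euclideanHausdorffMeasure (d - 1) (openCellFace e j k) ≠ ⊤ ∧
      (Measure.euclideanHausdorffMeasure (d - 1) (openCellFace e j k)).toReal =
        κ * simplexVolume e * ‖grad e k - grad e j‖ := by
  classical
  -- the cylinder over the face in barycentric coordinates; `0` and `Fin.last d` are `j` and `k`
  let S : Set (Fin (d + 1) → ℝ) := {α | α (Fin.last d) - α 0 ∈ Set.Icc (0 : ℝ) 1 ∧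
    (∀ i, 0 < α i - (α (Fin.last d) - α 0) *
      if i = Fin.last d then (1 / 2 : ℝ) else if i = 0 then -(1 / 2 : ℝ) else 0) ∧
    ∀ i, i ≠ 0 → i ≠ Fin.last d → α i < (α 0 + α (Fin.last d)) / 2}
  obtain ⟨κ, hκ⟩ := exists_integral_bary_eq (d := d) (S.indicator 1)
  refine ⟨κ, fun e he j hj k hk hjk => ?_⟩
  have h0l : (0 : Fin (d + 1)) ≠ Fin.last d := by
    intro h
    have := congrArg Fin.val h
    simp at this
    omega
  obtain ⟨σ, hσj, hσk⟩ : ∃ σ : Fin (d + 1) ≃ e, (σ 0 : Space d) = j ∧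
      (σ (Fin.last d) : Space d) = k := by
    obtain ⟨σ, hσ⟩ := Finset.exists_equiv_extend_of_card_eq (α := Fin (d + 1)) (t := e)
      (by simpa using he.card.symm) (s := {0, Fin.last d}) (f := fun i => if i = 0 then j else k)
      (by
        intro x hx
        simp only [Finset.image_insert, Finset.image_singleton, Finset.mem_insert,
          Finset.mem_singleton, if_true, if_neg h0l.symm] at hx
        rcases hx with rfl | rfl <;> assumption)
      (by
        intro a ha b hb hab
        simp only [Finset.coe_insert, Finset.coe_singleton, Set.mem_insert_iff,
          Set.mem_singleton_iff] at ha hb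
        rcases ha with rfl | rfl <;> rcases hb with rfl | rfl <;>
          simp_all [h0l.symm])
    exact ⟨σ, by simpa using hσ 0 (by simp), by simpa [h0l.symm] using hσ (Fin.last d) (by simp)⟩
  have hg := he.grad_sub_ne_zero hj hk hjk
  -- moving along half of the edge from `j` to `k` increases `λ_k - λ_j` by one
  have hcyl := volume_cylinder (w := (2⁻¹ : ℝ) • (k - j)) (p := j + (2⁻¹ : ℝ) • (k - j)) hg
    (by rw [inner_smul_right, he.inner_grad_sub_sub hj hk hjk]; norm_num)
    (measurableSet_openCellFace e j k)
    (fun x hx => by rw [he.inner_grad_sub_sub_midpoint hj hk hjk, hx.2.1, sub_self])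
  simp only [he.inner_grad_sub_sub_midpoint hj hk hjk] at hcyl
  set w := (2⁻¹ : ℝ) • (k - j) with hw
  set P := {x | bary e k x - bary e j x ∈ Set.Icc (0 : ℝ) 1 ∧
    x - (bary e k x - bary e j x) • w ∈ openCellFace e j k} with hP
  have hPm : MeasurableSet P := by
    have h1 : Continuous fun x => bary e k x - bary e j x := by fun_prop
    have h2 : Continuous fun x => x - (bary e k x - bary e j x) • w := by fun_prop
    exact (h1.measurable measurableSet_Icc).inter (h2.measurable (measurableSet_openCellFace e j k))
  have hPfin : volume P ≠ ⊤ := by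
    obtain ⟨R, hR⟩ := (e.finite_toSet.isCompact_convexHull ℝ).isBounded.exists_norm_le
    have : P ⊆ Metric.closedBall 0 (R + ‖w‖) := by
      rintro x ⟨hx1, hx2⟩
      have h3 := hR _ (he.mem_convexHull_iff.2 fun l hl => (hx2.1 l hl).le)
      rw [mem_closedBall_zero_iff]
      calc ‖x‖ = ‖x - (bary e k x - bary e j x) • w + (bary e k x - bary e j x) • w‖ := by
            rw [sub_add_cancel]
        _ ≤ R + ‖(bary e k x - bary e j x) • w‖ := (norm_add_le _ _).trans (by gcongr)
        _ ≤ R + ‖w‖ := by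
            rw [norm_smul, Real.norm_eq_abs, abs_of_nonneg hx1.1]
            have := mul_le_mul_of_nonneg_right hx1.2 (norm_nonneg w)
            linarith
    exact ((measure_mono this).trans_lt measure_closedBall_lt_top).ne
  have hmemP : ∀ x, x ∈ P ↔ (fun i => bary e (σ i) x) ∈ S := by
    intro x
    have hb : ∀ l, bary e l (x - (bary e k x - bary e j x) • w) = bary e l x -
        (bary e k x - bary e j x) *
          if l = k then (1 / 2 : ℝ) else if l = j then -(1 / 2 : ℝ) else 0 := by
      intro l
      rw [sub_eq_add_neg, bary_add, inner_neg_right, inner_smul_right, hw,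
        he.inner_grad_half_edge hj hk hjk]
      ring
    have hik : ∀ i, (σ i : Space d) = k ↔ i = Fin.last d := fun i => by
      rw [← hσk, Subtype.coe_inj, σ.apply_eq_iff_eq]
    have hij : ∀ i, (σ i : Space d) = j ↔ i = 0 := fun i => by
      rw [← hσj, Subtype.coe_inj, σ.apply_eq_iff_eq]
    have hall : ∀ p : Space d → Prop, (∀ l ∈ e, p l) ↔ ∀ i, p (σ i) := fun p =>
      ⟨fun h i => h _ (σ i).2, fun h l hl => by simpa using h (σ.symm ⟨l, hl⟩)⟩
    simp only [hP, Set.mem_ofPred_eq, openCellFace, S, hσj, hσk, hb, if_true, if_neg hjk]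
    rw [hall fun l => 0 < _, hall fun l => l ≠ j → _]
    simp only [hik, hij, ne_eq]
    refine and_congr_right fun _ => and_congr_right fun _ => ?_
    constructor
    · rintro ⟨-, h⟩ i h1 h2
      have := h i h1 h2
      rw [if_neg h2, if_neg h1] at this
      linarith
    · intro h
      refine ⟨by ring, fun i h1 h2 => ?_⟩
      rw [if_neg h2, if_neg h1]
      have := h i h1 h2
      linarith
  have hvol : volume.real P = κ * simplexVolume e := by
    rw [← hκ e he σ, ← integral_indicator_one hPm]
    refine integral_congr_ae (Eventually.of_forall fun x => ?_)
    simp only [Set.indicator, hmemP, Pi.one_apply]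
  have hgn : ‖grad e k - grad e j‖ ≠ 0 := norm_ne_zero_iff.2 hg
  refine ⟨fun htop => hPfin ?_, ?_⟩
  · rw [hcyl, htop]
    exact ENNReal.mul_top (enorm_ne_zero.2 (smul_ne_zero (inv_ne_zero (pow_ne_zero _ hgn)) hg))
  · rw [← hvol, measureReal_def, hcyl, ENNReal.toReal_mul, toReal_enorm, norm_smul, norm_inv,
      norm_pow, norm_norm]
    field_simp

end

namespace PeriodicMesh

variable {d : ℕ} (M : PeriodicMesh d) {e : Finset (Space d)} {j k : M.Node} {x : Space d}

lemma pos_injective : Function.Injective M.pos := Subtype.val_injective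

lemma mem_of_mem_dualCell (he : e ∈ M.elements) (hx : x ∈ convexHull ℝ (e : Set (Space d)))
    (h : x ∈ M.dualCell j) : M.pos j ∈ e :=
  M.mem_of_hat_pos he hx (M.hat_pos_of_mem_dualCell h)

lemma interface_subset_cellFace :
    M.interface j k ⊆ ⋃ e ∈ (M.starAt (M.pos j)).filter (M.pos k ∈ ·),
      cellFace e (M.pos j) (M.pos k) := by
  rintro x ⟨hxj, hxk⟩
  have hj := (M.isClosed_dualCell j).frontier_subset hxj
  have hk := (M.isClosed_dualCell k).frontier_subset hxk
  obtain ⟨e, he, hxe⟩ := M.exists_mem_element x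
  have hs := M.isSimplex he
  refine Set.mem_biUnion (x := e) ?_ ⟨fun l _ => hs.bary_nonneg hxe l, fun l _ => ?_, ?_⟩
  · simp only [SetLike.mem_coe, Finset.mem_filter, M.mem_starAt]
    exact ⟨⟨he, M.mem_of_mem_dualCell he hxe hj⟩, M.mem_of_mem_dualCell he hxe hk⟩
  · rw [dualCell_eq] at hj
    have := hj l
    rwa [M.hat_eq he hxe, M.hat_eq he hxe] at this
  · rw [dualCell_eq] at hj hk
    have h1 := hj (M.pos k)
    have h2 := hk (M.pos j)
    rw [M.hat_eq he hxe, M.hat_eq he hxe] at h1 h2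
    exact le_antisymm h2 h1

/-- Near a generic point of the interface, the dual cells are separated by the hyperplane where the
two barycentric coordinates coincide. -/
lemma eventually_mem_dualCell_iff (he : e ∈ M.elements) (hj : M.pos j ∈ e) (hk : M.pos k ∈ e)
    (hx : x ∈ openCellFace e (M.pos j) (M.pos k)) :
    ∀ᶠ y in 𝓝 x,
      (y ∈ M.dualCell j ↔ inner ℝ (grad e (M.pos k) - grad e (M.pos j)) (y - x) ≤ (0 : ℝ)) ∧
      (y ∈ M.dualCell k ↔ 0 ≤ (inner ℝ (grad e (M.pos k) - grad e (M.pos j)) (y - x) : ℝ)) := by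
  obtain ⟨h0, hjk, hlt⟩ := hx
  have h1 : ∀ᶠ y in 𝓝 x, y ∈ openSimplex e := (isOpen_openSimplex e).mem_nhds h0
  have h2 : ∀ᶠ y in 𝓝 x, ∀ l ∈ e, l ≠ M.pos j → l ≠ M.pos k →
      bary e l y < bary e (M.pos j) y ∧ bary e l y < bary e (M.pos k) y := by
    refine (eventually_all_finset e).2 fun l hl => ?_
    by_cases hlj : l = M.pos j
    · exact Eventually.of_forall fun y h => absurd hlj h
    by_cases hlk : l = M.pos k
    · exact Eventually.of_forall fun y _ h => absurd hlk h
    have e1 := hlt l hl hlj hlk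
    have e2 := e1.trans_eq hjk
    have o1 : IsOpen {y | bary e l y < bary e (M.pos j) y} := isOpen_lt (by fun_prop) (by fun_prop)
    have o2 : IsOpen {y | bary e l y < bary e (M.pos k) y} := isOpen_lt (by fun_prop) (by fun_prop)
    filter_upwards [o1.mem_nhds e1, o2.mem_nhds e2] with y y1 y2 _ _ using ⟨y1, y2⟩
  filter_upwards [h1, h2] with y hy1 hy2
  have hye := M.openSimplex_subset he hy1
  have hdiff : inner ℝ (grad e (M.pos k) - grad e (M.pos j)) (y - x) =
      bary e (M.pos k) y - bary e (M.pos j) y := by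
    rw [inner_sub_left, ← bary_sub_bary, ← bary_sub_bary, hjk]
    ring
  rw [hdiff, dualCell_eq, dualCell_eq]
  simp only [Set.mem_ofPred_eq, M.hat_eq he hye]
  refine ⟨⟨fun h => sub_nonpos.2 (h _), fun h l => ?_⟩,
    ⟨fun h => sub_nonneg.2 (h _), fun h l => ?_⟩⟩
  · by_cases hl : l ∈ e
    · by_cases hlj : l = M.pos j
      · rw [hlj]
      by_cases hlk : l = M.pos k
      · rw [hlk]; linarith
      · exact (hy2 l hl hlj hlk).1.le
    · rw [bary_of_notMem hl]; exact (hy1 _ hj).le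
  · by_cases hl : l ∈ e
    · by_cases hlj : l = M.pos j
      · rw [hlj]; linarith
      by_cases hlk : l = M.pos k
      · rw [hlk]
      · exact (hy2 l hl hlj hlk).2.le
    · rw [bary_of_notMem hl]; exact (hy1 _ hk).le

/-- Two closed half-spaces locally given by `⟨g, y - x⟩ ≤ 0` and `0 ≤ ⟨g, y - x⟩` have a unique unit
normal, and `x` is a boundary point of both. -/
lemma unitNormal_eq_of_eventually {K L : Set (Space d)} {g : Space d} (hg : g ≠ 0)
    (h : ∀ᶠ y in 𝓝 x, (y ∈ K ↔ inner ℝ g (y - x) ≤ (0 : ℝ)) ∧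
      (y ∈ L ↔ 0 ≤ (inner ℝ g (y - x) : ℝ))) :
    unitNormal K L x = ‖g‖⁻¹ • g ∧ x ∈ frontier K ∧ x ∈ frontier L := by
  have hgn : 0 < ‖g‖ := norm_pos_iff.2 hg
  have hray : ∀ v : Space d, ∀ᶠ t : ℝ in 𝓝[>] 0,
      (x + t • v ∈ K ↔ inner ℝ g v ≤ (0 : ℝ)) ∧ (x + t • v ∈ L ↔ 0 ≤ (inner ℝ g v : ℝ)) := by
    intro v
    have hc : Tendsto (fun t : ℝ => x + t • v) (𝓝[>] 0) (𝓝 x) := by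
      have : ContinuousAt (fun t : ℝ => x + t • v) 0 := by fun_prop
      simpa [ContinuousAt] using this.mono_left nhdsWithin_le_nhds
    filter_upwards [hc.eventually h, self_mem_nhdsWithin] with t ht htpos
    rw [add_sub_cancel_left, inner_smul_right] at ht
    rw [ht.1, ht.2]
    have htpos' : (0 : ℝ) < t := htpos
    exact ⟨⟨fun h => nonpos_of_mul_nonpos_right h htpos',
        fun h => mul_nonpos_of_nonneg_of_nonpos htpos'.le h⟩,
      mul_nonneg_iff_of_pos_left htpos'⟩
  have hu : ‖‖g‖⁻¹ • g‖ = 1 := by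
    rw [norm_smul, norm_inv, norm_norm, inv_mul_cancel₀ hgn.ne']
  have hex : IsUnitNormal K L x (‖g‖⁻¹ • g) := by
    refine ⟨hu, ?_⟩
    obtain ⟨ε, hε, hball⟩ := Metric.eventually_nhds_iff_ball.1 h
    refine ⟨ε, hε, fun y hy => ?_⟩
    rw [inner_smul_left, (hball y hy).1, (hball y hy).2]
    simp only [conj_trivial]
    have := inv_pos.2 hgn
    exact ⟨fun h => by nlinarith, fun h => by nlinarith⟩
  have huniq : ∀ ν, IsUnitNormal K L x ν → ν = ‖g‖⁻¹ • g := by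
    rintro ν ⟨hν, ε, hε, hball⟩
    by_contra hne
    have h1 : (inner ℝ ν (‖g‖⁻¹ • g) : ℝ) < 1 := by
      refine lt_of_le_of_ne ?_ fun h => hne ((inner_eq_one_iff_of_norm_eq_one hν hu).1 h)
      have := real_inner_le_norm ν (‖g‖⁻¹ • g)
      rwa [hν, hu, one_mul] at this
    -- along this direction the two candidates disagree about the side of the interface
    let v := ν - ‖g‖⁻¹ • g
    have hv1 : 0 < (inner ℝ ν v : ℝ) := by
      rw [inner_sub_right, real_inner_self_eq_norm_sq, hν]
      linarith
    have hv2 : (inner ℝ g v : ℝ) < 0 := by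
      have : (inner ℝ (‖g‖⁻¹ • g) v : ℝ) < 0 := by
        rw [inner_sub_right, real_inner_self_eq_norm_sq, hu, real_inner_comm]
        linarith
      rw [inner_smul_left] at this
      simp only [conj_trivial] at this
      have := inv_pos.2 hgn
      by_contra hcon
      push Not at hcon
      nlinarith [mul_nonneg this.le hcon]
    have hc : Tendsto (fun t : ℝ => x + t • v) (𝓝[>] 0) (𝓝 x) := by
      have : ContinuousAt (fun t : ℝ => x + t • v) 0 := by fun_prop
      simpa [ContinuousAt] using this.mono_left nhdsWithin_le_nhds
    obtain ⟨t, ht1, ht2, ht3⟩ := ((hray v).and ((hc.eventually (Metric.ball_mem_nhds x hε)).and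
      self_mem_nhdsWithin)).exists
    have ht3' : (0 : ℝ) < t := ht3
    have := (hball _ ht2).2 (by
      rw [add_sub_cancel_left, inner_smul_right]
      positivity)
    exact absurd (ht1.2.1 this) (not_le.2 hv2)
  have hxx := h.self_of_nhds
  simp only [sub_self, inner_zero_right, le_refl, iff_true] at hxx
  refine ⟨?_, ?_, ?_⟩
  · have hex' : ∃ ν, IsUnitNormal K L x ν := ⟨_, hex⟩
    rw [unitNormal, dif_pos hex']
    exact huniq _ hex'.choose_spec
  · refine ⟨subset_closure hxx.1, fun hint => ?_⟩
    have hc : Tendsto (fun t : ℝ => x + t • g) (𝓝[>] 0) (𝓝 x) := by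
      have : ContinuousAt (fun t : ℝ => x + t • g) 0 := by fun_prop
      simpa [ContinuousAt] using this.mono_left nhdsWithin_le_nhds
    obtain ⟨t, ht1, ht2⟩ := ((hray g).and
      (hc.eventually (mem_interior_iff_mem_nhds.1 hint))).exists
    have := ht1.1.1 ht2
    rw [real_inner_self_eq_norm_sq] at this
    nlinarith
  · refine ⟨subset_closure hxx.2, fun hint => ?_⟩
    have hc : Tendsto (fun t : ℝ => x + t • -g) (𝓝[>] 0) (𝓝 x) := by
      have : ContinuousAt (fun t : ℝ => x + t • -g) 0 := by fun_prop
      simpa [ContinuousAt] using this.mono_left nhdsWithin_le_nhds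
    obtain ⟨t, ht1, ht2⟩ := ((hray (-g)).and
      (hc.eventually (mem_interior_iff_mem_nhds.1 hint))).exists
    have := ht1.2.1 ht2
    rw [inner_neg_right, real_inner_self_eq_norm_sq] at this
    nlinarith

lemma unitNormal_eq_of_mem_openCellFace (he : e ∈ M.elements) (hj : M.pos j ∈ e)
    (hk : M.pos k ∈ e) (hjk : j ≠ k) (hx : x ∈ openCellFace e (M.pos j) (M.pos k)) :
    unitNormal (M.dualCell j) (M.dualCell k) x =
      ‖grad e (M.pos k) - grad e (M.pos j)‖⁻¹ • (grad e (M.pos k) - grad e (M.pos j)) ∧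
    x ∈ M.interface j k := by
  obtain ⟨h1, h2, h3⟩ := unitNormal_eq_of_eventually
    ((M.isSimplex he).grad_sub_ne_zero hj hk (M.pos_injective.ne hjk))
    (M.eventually_mem_dualCell_iff he hj hk hx)
  exact ⟨h1, h2, h3⟩

/-- The area vector of an interface is the sum over the elements that contain the edge `jk` of
`|e| (∇λ_k - ∇λ_j)`, up to a factor that depends on the dimension only. -/
theorem exists_areaVec_eq (hd : 0 < d) : ∃ κ : ℝ, ∀ (M : PeriodicMesh d) (j k : M.Node), j ≠ k →
    M.areaVec j k = κ • ∑ e ∈ M.starAt (M.pos j) with M.pos k ∈ e,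
      simplexVolume e • (grad e (M.pos k) - grad e (M.pos j)) := by
  obtain ⟨κ, hκ⟩ := exists_area_openCellFace hd
  refine ⟨κ, fun M j k hjk => ?_⟩
  set F := (M.starAt (M.pos j)).filter (M.pos k ∈ ·) with hF
  have hFe : ∀ e ∈ F, e ∈ M.elements ∧ M.pos j ∈ e ∧ M.pos k ∈ e := by
    intro e he
    rw [hF, Finset.mem_filter, M.mem_starAt] at he
    exact ⟨he.1.1, he.1.2, he.2⟩
  have hpos := M.pos_injective.ne hjk
  have hae : M.interface j k =ᵐ[Measure.euclideanHausdorffMeasure (d - 1)]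
      ⋃ e ∈ F, openCellFace e (M.pos j) (M.pos k) := by
    refine EventuallyLE.antisymm ?_ (LE.le.eventuallyLE ?_)
    swap
    · refine Set.iUnion₂_subset fun e he x hx => ?_
      obtain ⟨h1, h2, h3⟩ := hFe e he
      exact (M.unitNormal_eq_of_mem_openCellFace h1 h2 h3 hjk hx).2
    · rw [ae_le_set]
      refine measure_mono_null (t := ⋃ e ∈ F, (cellFace e (M.pos j) (M.pos k) \
        openCellFace e (M.pos j) (M.pos k))) ?_ ?_
      · rintro x ⟨hx1, hx2⟩
        obtain ⟨e, he, hxe⟩ := Set.mem_iUnion₂.1 (M.interface_subset_cellFace hx1)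
        exact Set.mem_biUnion (x := e) he
          ⟨hxe, fun h => hx2 (Set.mem_biUnion (x := e) he h)⟩
      · refine (measure_biUnion_null_iff (Finset.countable_toSet _)).2 fun e he => ?_
        obtain ⟨h1, h2, h3⟩ := hFe e he
        exact (M.isSimplex h1).hausdorffMeasure_cellFace_diff h2 h3 hpos
  have hconst : ∀ e ∈ F, Set.EqOn (fun x => unitNormal (M.dualCell j) (M.dualCell k) x)
      (fun _ => ‖grad e (M.pos k) - grad e (M.pos j)‖⁻¹ • (grad e (M.pos k) - grad e (M.pos j)))
      (openCellFace e (M.pos j) (M.pos k)) := by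
    intro e he x hx
    obtain ⟨h1, h2, h3⟩ := hFe e he
    exact (M.unitNormal_eq_of_mem_openCellFace h1 h2 h3 hjk hx).1
  rw [areaVec, setIntegral_congr_set hae, integral_biUnion_finset F
    (fun e _ => measurableSet_openCellFace e _ _), Finset.smul_sum]
  · refine Finset.sum_congr rfl fun e he => ?_
    obtain ⟨h1, h2, h3⟩ := hFe e he
    have hn : ‖grad e (M.pos k) - grad e (M.pos j)‖ ≠ 0 :=
      norm_ne_zero_iff.2 ((M.isSimplex h1).grad_sub_ne_zero h2 h3 hpos)
    rw [setIntegral_congr_fun (measurableSet_openCellFace e _ _) (hconst e he), setIntegral_const,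
      measureReal_def, (hκ e (M.isSimplex h1) _ h2 _ h3 hpos).2, smul_smul, smul_smul,
      mul_inv_cancel_right₀ hn]
  · intro e he e' he' hne
    refine Set.disjoint_left.2 fun x hx hx' => hne ?_
    exact M.eq_of_mem_openSimplex (hFe e he).1 (hFe e' he').1 hx.1
      (M.openSimplex_subset (hFe e' he').1 hx'.1)
  · intro e he
    obtain ⟨h1, h2, h3⟩ := hFe e he
    refine IntegrableOn.congr_fun ?_ (hconst e he).symm (measurableSet_openCellFace e _ _)
    exact integrableOn_const (hκ e (M.isSimplex h1) _ h2 _ h3 hpos).1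

lemma areaVec_eq_zero_of_notMem (hjk : j ≠ k) (hk : k ∉ M.neighbors j) : M.areaVec j k = 0 := by
  have : Measure.euclideanHausdorffMeasure (d - 1) (M.interface j k) = 0 := by
    by_contra h
    exact hk (by simpa [neighbors, neighborSet] using ⟨hjk.symm, h⟩)
  rw [areaVec, Measure.restrict_eq_zero.2 this, integral_zero_measure]

end PeriodicMesh

namespace PeriodicMesh

/-! ### Sums over a period -/

section

variable {d : ℕ} (M : PeriodicMesh d)

lemma latticeVec_neg (z : Fin d → ℤ) : (latticeVec (-z) : Space d) = -latticeVec z := by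
  ext i; simp [latticeVec]

lemma latticeVec_injective : Function.Injective (latticeVec (d := d)) := by
  intro z z' h
  ext i
  have := congrFun (congrArg WithLp.ofLp h) i
  simpa [latticeVec] using this

lemma pos_shift (z : Fin d → ℤ) (j : M.Node) : M.pos (M.shift z j) = M.pos j + latticeVec z := rfl

lemma shift_neg_shift (z : Fin d → ℤ) (j : M.Node) : M.shift (-z) (M.shift z j) = j := by
  apply M.pos_injective
  rw [pos_shift, pos_shift, latticeVec_neg, add_neg_cancel_right]

/-- The nodes are the integer translates of the nodes of a period cell. -/
noncomputable def periodEquiv {T : Finset M.Node} (hT : M.IsPeriodCell T) :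
    T × (Fin d → ℤ) ≃ M.Node :=
  Equiv.ofBijective (fun q => M.shift q.2 q.1) (by
    constructor
    · rintro ⟨⟨k, hk⟩, z⟩ ⟨⟨k', hk'⟩, z'⟩ h
      have h' : M.shift z k = M.shift z' k' := h
      obtain rfl : k = k' := (hT (M.shift z k)).unique ⟨hk, z, rfl⟩ ⟨hk', z', h'⟩
      have h2 := congrArg M.pos h'
      rw [pos_shift, pos_shift, add_right_inj] at h2
      rw [latticeVec_injective h2]
    · intro j
      obtain ⟨k, ⟨hk, z, rfl⟩, -⟩ := hT j
      exact ⟨⟨⟨k, hk⟩, z⟩, rfl⟩)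

/-- Contributions that are antisymmetric with respect to a pair of nodes and translation-invariant
cancel in the sum over a period. -/
lemma sum_finsum_eq_zero_of_antisymm {V : Type*} [AddCommGroup V] [Module ℝ V] {T : Finset M.Node}
    (hT : M.IsPeriodCell T) {W : M.Node → M.Node → V} (hanti : ∀ j k, W j k = -W k j)
    (hshift : ∀ z j k, W (M.shift z j) (M.shift z k) = W j k)
    (hfin : ∀ j, (Function.support (W j)).Finite) : ∑ j ∈ T, ∑ᶠ k, W j k = 0 := by
  let S : M.Node → M.Node → V := fun j k => ∑ᶠ z : Fin d → ℤ, W j (M.shift z k)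
  have h1 : ∀ j, ∑ᶠ k, W j k = ∑ k ∈ T, S j k := by
    intro j
    rw [← finsum_comp_equiv (M.periodEquiv hT), finsum_curry, finsum_eq_sum_of_fintype]
    · refine Eq.trans ?_ (Finset.sum_coe_sort T (S j))
      rfl
    · exact (hfin j).preimage (M.periodEquiv hT).injective.injOn
  have h2 : ∀ j k, S j k = -S k j := by
    intro j k
    have : ∀ z : Fin d → ℤ, W j (M.shift z k) = -W k (M.shift (-z) j) := by
      intro z
      rw [hanti, ← hshift (-z) (M.shift z k) j, shift_neg_shift]
    simp only [S, this, finsum_neg_distrib]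
    exact congrArg Neg.neg
      (finsum_comp_equiv (Equiv.neg (Fin d → ℤ)) (f := fun z => W k (M.shift z j)))
  have h3 : ∑ j ∈ T, ∑ k ∈ T, S j k = -∑ j ∈ T, ∑ k ∈ T, S j k := by
    conv_lhs => rw [Finset.sum_comm]
    simp only [← Finset.sum_neg_distrib]
    exact Finset.sum_congr rfl fun j _ => Finset.sum_congr rfl fun k _ => h2 k j
  simp only [h1]
  rw [eq_neg_iff_add_eq_zero, ← two_smul ℝ] at h3
  exact (smul_eq_zero.1 h3).resolve_left two_ne_zero

lemma map_mem_elements {e : Finset (Space d)} (he : e ∈ M.elements) (z : Fin d → ℤ) :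
    e.map (addRightEmbedding (latticeVec z)) ∈ M.elements :=
  ⟨M.periodic e he.1 z, by simpa using he.2⟩

lemma starAt_shift (p : Space d) (z : Fin d → ℤ) :
    M.starAt (p + latticeVec z) = (M.starAt p).map
      ⟨Finset.map (addRightEmbedding (latticeVec z)), Finset.map_injective _⟩ := by
  ext e
  simp only [mem_starAt, Finset.mem_map, Function.Embedding.coeFn_mk]
  constructor
  · rintro ⟨he, hp⟩
    have hback : (e.map (addRightEmbedding (latticeVec (-z)))).map
        (addRightEmbedding (latticeVec z)) = e := by
      ext x
      simp [latticeVec_neg]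
    refine ⟨_, ⟨M.map_mem_elements he (-z), ?_⟩, hback⟩
    rw [Finset.mem_map]
    exact ⟨_, hp, by simp [latticeVec_neg]⟩
  · rintro ⟨e', ⟨he', hp'⟩, rfl⟩
    exact ⟨M.map_mem_elements he' z, by simpa using hp'⟩

/-- In a sum over a period, a translation-invariant quantity may be redistributed arbitrarily
between the vertices of each element. -/
lemma sum_starAt_eq_zero {V : Type*} [AddCommGroup V] [Module ℝ V] {T : Finset M.Node}
    (hT : M.IsPeriodCell T) {Z : Finset (Space d) → Space d → V}
    (hsum : ∀ e ∈ M.elements, ∑ l ∈ e, Z e l = 0)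
    (hshift : ∀ e ∈ M.elements, ∀ l ∈ e, ∀ z : Fin d → ℤ,
      Z (e.map (addRightEmbedding (latticeVec z))) (l + latticeVec z) = Z e l) :
    ∑ j ∈ T, ∑ e ∈ M.starAt (M.pos j), Z e (M.pos j) = 0 := by
  classical
  let W : M.Node → M.Node → V := fun j k =>
    ∑ e ∈ M.starAt (M.pos j) with M.pos k ∈ e, (Z e (M.pos j) - Z e (M.pos k))
  have hfin : ∀ j, (Function.support (W j)).Finite := by
    intro j
    refine Set.Finite.subset (((M.starAt (M.pos j)).biUnion id).finite_toSet.preimage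
      M.pos_injective.injOn) fun k hk => ?_
    obtain ⟨e, he, -⟩ := Finset.exists_ne_zero_of_sum_ne_zero hk
    rw [Finset.mem_filter] at he
    simp only [Set.mem_preimage, Finset.mem_coe, Finset.mem_biUnion, id]
    exact ⟨e, he.1, he.2⟩
  have hW : ∑ j ∈ T, ∑ᶠ k, W j k = 0 := by
    refine M.sum_finsum_eq_zero_of_antisymm hT (fun j k => ?_) (fun z j k => ?_) hfin
    · simp only [W, ← Finset.sum_neg_distrib, neg_sub]
      refine Finset.sum_congr ?_ fun _ _ => rfl
      ext e
      simp only [Finset.mem_filter, mem_starAt]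
      tauto
    · simp only [W, pos_shift, starAt_shift, Finset.filter_map, Finset.sum_map,
        Function.Embedding.coeFn_mk]
      refine Finset.sum_congr ?_ fun e he => ?_
      · ext e
        simp
      · simp only [Finset.mem_filter] at he
        have h1 := M.mem_starAt.1 he.1
        rw [hshift e h1.1 _ h1.2, hshift e h1.1 _ (by simpa using he.2)]
  have hsumW : ∀ j, ∑ᶠ k, W j k = ((d : ℝ) + 1) • ∑ e ∈ M.starAt (M.pos j), Z e (M.pos j) := by
    intro j
    -- the nodes of the elements around `j`
    let U : Finset M.Node := (hfin j).toFinset ∪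
      ((M.starAt (M.pos j)).biUnion id).preimage M.pos M.pos_injective.injOn
    rw [finsum_eq_sum_of_support_subset (s := U) _ (by
      intro k hk
      simp only [U, Finset.coe_union, Set.mem_union, Set.Finite.coe_toFinset]
      exact Or.inl hk)]
    simp only [W, Finset.sum_filter]
    rw [Finset.sum_comm, Finset.smul_sum]
    refine Finset.sum_congr rfl fun e he => ?_
    have heM := (M.mem_starAt.1 he).1
    rw [← Finset.sum_filter]
    have himage : (U.filter (M.pos · ∈ e)).map ⟨M.pos, M.pos_injective⟩ = e := by
      ext l
      simp only [Finset.mem_map, Finset.mem_filter, Function.Embedding.coeFn_mk]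
      constructor
      · rintro ⟨k, ⟨-, hk⟩, rfl⟩
        exact hk
      · intro hl
        obtain ⟨k, rfl⟩ := M.exists_node heM hl
        refine ⟨k, ⟨?_, hl⟩, rfl⟩
        simp only [U, Finset.mem_union, Finset.mem_preimage, Finset.mem_biUnion, id]
        exact Or.inr ⟨e, he, hl⟩
    have h1 : ∑ k ∈ U.filter (M.pos · ∈ e), (Z e (M.pos j) - Z e (M.pos k)) =
        ∑ l ∈ e, (Z e (M.pos j) - Z e l) := by
      have := Finset.sum_map (U.filter (M.pos · ∈ e)) ⟨M.pos, M.pos_injective⟩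
        fun l => Z e (M.pos j) - Z e l
      rw [himage] at this
      exact this.symm
    rw [h1, Finset.sum_sub_distrib, hsum e heM, sub_zero, Finset.sum_const, heM.2,
      ← Nat.cast_smul_eq_nsmul ℝ]
    push_cast
    rfl
  simp only [hsumW, ← Finset.smul_sum] at hW
  exact (smul_eq_zero.1 hW).resolve_left (by positivity)

end

/-! ### Sums over the neighbors of a node -/

section

variable {d : ℕ} (M : PeriodicMesh d)

/-- The sum of a quantity depending linearly on the area vectors, elementwise. -/
lemma sum_neighbors_eq {V : Type*} [AddCommGroup V] [Module ℝ V] {κ : ℝ}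
    (hκ : ∀ j k : M.Node, j ≠ k → M.areaVec j k =
      κ • ∑ e ∈ M.starAt (M.pos j) with M.pos k ∈ e,
        simplexVolume e • (grad e (M.pos k) - grad e (M.pos j)))
    (j : M.Node) (Φ : Space d → Space d →ₗ[ℝ] V) :
    ∑ k ∈ M.neighbors j, Φ (M.pos k) (M.areaVec j k) =
      κ • ∑ e ∈ M.starAt (M.pos j), simplexVolume e •
        ∑ l ∈ e, Φ l (grad e l - grad e (M.pos j)) := by
  classical
  let U : Finset (Space d) := (M.neighbors j).map ⟨M.pos, M.pos_injective⟩ ∪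
    (M.starAt (M.pos j)).biUnion id
  let N : Space d → Space d := fun l => κ • ∑ e ∈ M.starAt (M.pos j) with l ∈ e,
    simplexVolume e • (grad e l - grad e (M.pos j))
  have h1 : ∑ k ∈ M.neighbors j, Φ (M.pos k) (M.areaVec j k) = ∑ l ∈ U, Φ l (N l) := by
    have : ∑ k ∈ M.neighbors j, Φ (M.pos k) (M.areaVec j k) =
        ∑ l ∈ (M.neighbors j).map ⟨M.pos, M.pos_injective⟩, Φ l (N l) := by
      rw [Finset.sum_map]
      refine Finset.sum_congr rfl fun k hk => ?_
      have hjk : j ≠ k := by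
        rintro rfl
        simp [neighbors, neighborSet] at hk
      rw [hκ j k hjk]
      rfl
    rw [this]
    refine Finset.sum_subset Finset.subset_union_left fun l hl hl' => ?_
    have hlU := (Finset.mem_union.1 hl).resolve_left hl'
    obtain ⟨e, he, hle⟩ := Finset.mem_biUnion.1 hlU
    obtain ⟨k, rfl⟩ := M.exists_node (M.mem_starAt.1 he).1 hle
    have hN : N (M.pos k) = 0 := by
      by_cases hjk : j = k
      · subst hjk
        simp [N]
      · have hkN : k ∉ M.neighbors j := fun h => hl' (Finset.mem_map_of_mem _ h)
        rw [← M.areaVec_eq_zero_of_notMem hjk hkN, hκ j k hjk]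
    rw [hN, map_zero]
  rw [h1]
  simp only [N, map_smul, map_sum, ← Finset.smul_sum]
  congr 1
  simp only [Finset.sum_filter]
  rw [Finset.sum_comm]
  refine Finset.sum_congr rfl fun e he => ?_
  rw [← Finset.sum_filter, Finset.smul_sum]
  have : U.filter (· ∈ e) = e := by
    rw [Finset.filter_mem_eq_inter, Finset.inter_eq_right]
    exact fun l hl => Finset.mem_union_right _ (Finset.mem_biUnion.2 ⟨e, he, hl⟩)
  rw [this]

/-- Interchange of summation over a family of finite sets and over their elements. -/
lemma sum_sum_mem_eq_zero {α V : Type*} [AddCommGroup V] [DecidableEq α] (F : Finset (Finset α))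
    (f : Finset α → α → V) (h : ∀ l, ∑ e ∈ F with l ∈ e, f e l = 0) :
    ∑ e ∈ F, ∑ l ∈ e, f e l = 0 := by
  have h1 : ∀ e ∈ F, ∑ l ∈ e, f e l = ∑ l ∈ F.biUnion id, if l ∈ e then f e l else 0 := by
    intro e he
    rw [← Finset.sum_filter]
    refine Finset.sum_congr ?_ fun _ _ => rfl
    rw [Finset.filter_mem_eq_inter, Eq.comm, Finset.inter_eq_right]
    exact fun l hl => Finset.mem_biUnion.2 ⟨e, he, hl⟩
  rw [Finset.sum_congr rfl h1, Finset.sum_comm]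
  exact Finset.sum_eq_zero fun l _ => by rw [← Finset.sum_filter, h l]

lemma sum_simplexVolume_smul_grad (p : Space d) :
    ∑ e ∈ M.starAt p, simplexVolume e • grad e p = 0 := by
  classical
  have := M.sum_simplexVolume_smul_sum_grad (Finset.mem_singleton_self p)
  simp only [Finset.singleton_subset_iff, Finset.sum_singleton] at this
  rwa [Finset.filter_true_of_mem fun e he => (M.mem_starAt.1 he).2] at this

lemma sum_simplexVolume_smul_grad_add_grad {p l : Space d} (hl : l ≠ p)
    [DecidableEq (Space d)] :
    ∑ e ∈ M.starAt p with l ∈ e, simplexVolume e • (grad e p + grad e l) = 0 := by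
  have := M.sum_simplexVolume_smul_sum_grad (Finset.mem_insert_self p {l})
  simp only [Finset.sum_pair hl.symm, Finset.insert_subset_iff, Finset.singleton_subset_iff] at this
  rw [← this]
  refine Finset.sum_congr ?_ fun _ _ => rfl
  ext e
  simp only [Finset.mem_filter, mem_starAt]
  tauto

/-- The gradient identity for a triple of vertices that need not be distinct. The weights are those
of `∫ ∇(λ_p λ_l λ_m)`. -/
lemma sum_simplexVolume_smul_grad_triple (p l m : Space d) [DecidableEq (Space d)] :
    ∑ e ∈ M.starAt p with l ∈ e ∧ m ∈ e, simplexVolume e •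
      ((if l = m then (2 : ℝ) else 1) • grad e p + (if p = m then (2 : ℝ) else 1) • grad e l +
        (if p = l then (2 : ℝ) else 1) • grad e m) = 0 := by
  have hmem : ∀ e ∈ M.starAt p, p ∈ e := fun e he => (M.mem_starAt.1 he).2
  by_cases hpl : p = l
  · subst hpl
    by_cases hpm : p = m
    · subst hpm
      have h := M.sum_simplexVolume_smul_grad p
      rw [Finset.filter_true_of_mem fun e he => ⟨hmem e he, hmem e he⟩]
      replace h := congrArg (fun u => (6 : ℝ) • u) h
      simp only [Finset.smul_sum, smul_zero] at h
      refine Eq.trans ?_ h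
      refine Finset.sum_congr rfl fun e _ => ?_
      simp only [if_true]
      module
    · have h := M.sum_simplexVolume_smul_grad_add_grad (Ne.symm hpm)
      replace h := congrArg (fun u => (2 : ℝ) • u) h
      simp only [Finset.smul_sum, smul_zero] at h
      refine Eq.trans ?_ h
      refine Finset.sum_congr (Finset.filter_congr fun e he => ?_) fun e _ => ?_
      · simp [hmem e he]
      · simp only [if_true, if_neg hpm]
        module
  by_cases hpm : p = m
  · subst hpm
    have h := M.sum_simplexVolume_smul_grad_add_grad (Ne.symm hpl)
    replace h := congrArg (fun u => (2 : ℝ) • u) h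
    simp only [Finset.smul_sum, smul_zero] at h
    refine Eq.trans ?_ h
    refine Finset.sum_congr (Finset.filter_congr fun e he => ?_) fun e _ => ?_
    · simp [hmem e he]
    · simp only [if_true, if_neg hpl, if_neg (Ne.symm hpl)]
      module
  by_cases hlm : l = m
  · subst hlm
    have h := M.sum_simplexVolume_smul_grad_add_grad (Ne.symm hpl)
    replace h := congrArg (fun u => (2 : ℝ) • u) h
    simp only [Finset.smul_sum, smul_zero] at h
    refine Eq.trans ?_ h
    refine Finset.sum_congr (Finset.filter_congr fun e he => ?_) fun e _ => ?_
    · simp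
    · simp only [if_true, if_neg hpl]
      module
  · have h := M.sum_simplexVolume_smul_sum_grad (Finset.mem_insert_self p {l, m})
    rw [← h]
    refine Finset.sum_congr (Finset.filter_congr fun e he => ?_) fun e _ => ?_
    · simp [Finset.insert_subset_iff, hmem e he]
    · rw [Finset.sum_insert (by simp [hpl, hpm]), Finset.sum_pair hlm]
      simp only [if_neg hpl, if_neg hpm, if_neg hlm]
      module

end

end PeriodicMesh

/-! ### Tensor identities in a simplex -/

section

variable {V : Type*} [AddCommGroup V] [Module ℝ V]

lemma symm_trilinear_sub_cube {E : Type*} [AddCommGroup E] [Module ℝ E]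
    (S : E →ₗ[ℝ] E →ₗ[ℝ] E →ₗ[ℝ] V) (h₁ : ∀ u v w, S u v w = S v u w)
    (h₂ : ∀ u v w, S u v w = S u w v) (a b : E) :
    S (a - b) (a - b) (a - b) =
      S a a a - (3 : ℝ) • S a a b + (3 : ℝ) • S b b a - S b b b := by
  simp only [map_sub, LinearMap.sub_apply]
  rw [h₂ a b a, h₁ b a a, h₂ a b a, h₂ b a b, h₁ a b b, h₂ b a b]
  module

/-- The symmetric trilinear form of the three vectors that join the centroid of a triangle to its
vertices (times three), expanded. -/
lemma symm_trilinear_medians {E : Type*} [AddCommGroup E] [Module ℝ E]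
    (S : E →ₗ[ℝ] E →ₗ[ℝ] E →ₗ[ℝ] V) (h₁ : ∀ u v w, S u v w = S v u w)
    (h₂ : ∀ u v w, S u v w = S u w v) (a b c : E) :
    S ((2 : ℝ) • a - b - c) ((2 : ℝ) • b - a - c) ((2 : ℝ) • c - a - b) =
      (2 : ℝ) • (S a a a + S b b b + S c c c) -
      (3 : ℝ) • (S a a b + S a a c + S b b a + S b b c + S c c a + S c c b) +
      (12 : ℝ) • S a b c := by
  have e : ∀ u v, S u v u = S u u v ∧ S v u u = S u u v := fun u v =>
    ⟨h₂ u v u, (h₁ v u u).trans (h₂ u v u)⟩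
  simp only [map_sub, LinearMap.sub_apply, map_smul, LinearMap.smul_apply]
  rw [(e a b).1, (e a b).2, (e a c).1, (e a c).2, (e b a).1, (e b a).2, (e b c).1, (e b c).2,
    (e c a).1, (e c a).2, (e c b).1, (e c b).2, h₂ a c b, h₁ b a c, (h₂ b c a).trans (h₁ b a c),
    h₁ c a b, h₂ a c b, (h₁ c b a).trans ((h₂ b c a).trans (h₁ b a c))]
  module

/-- The algebraic core of the third-order identity. The points of `s` have zero sum and so do the
gradients, which is reflected in `h₀` and `h₃`: here `t m p q r` stands for `τ(∇λ_m, p, q, r)`,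
where `τ` is symmetric in its last three arguments and the origin is at the centroid. After this
normalization both sides are combinations of only two sums, `∑ t p p p p` and `∑ t p l l p`. -/
lemma sum_tensor_identity {ι : Type*} [DecidableEq ι] (s : Finset ι) (t : ι → ι → ι → ι → V)
    (h₁ : ∀ m p q r, t m p q r = t m q p r) (h₂ : ∀ m p q r, t m p q r = t m p r q)
    (h₀ : ∀ p q r, ∑ m ∈ s, t m p q r = 0) (h₃ : ∀ m p q, ∑ r ∈ s, t m p q r = 0) :
    ((s.card : ℝ) + 1) • (∑ p ∈ s, ∑ l ∈ s,
        (t l l l l - (3 : ℝ) • t l l l p + (3 : ℝ) • t l p p l - t l p p p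
          - (t p l l l - (3 : ℝ) • t p l l p + (3 : ℝ) • t p p p l - t p p p p)
          - (6 / ((s.card : ℝ) + 1)) •
            ∑ m ∈ s, (t m l l m - (2 : ℝ) • t m l p m + t m p p m))) =
      ∑ p ∈ s, ∑ l ∈ s, ∑ m ∈ s, (if l = m then (2 : ℝ) else 1) •
        ((2 : ℝ) • (t p p p p + t p l l l + t p m m m) -
          (3 : ℝ) • (t p p p l + t p p p m + t p l l p + t p l l m + t p m m p + t p m m l) +
          (12 : ℝ) • t p p l m) := by
  set P := ∑ p ∈ s, t p p p p with hP
  set Q := ∑ p ∈ s, ∑ l ∈ s, t p l l p with hQ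
  set N : ℝ := (s.card : ℝ) with hN
  have hc : ∀ v : V, ∑ _p ∈ s, v = N • v := fun v => by
    rw [Finset.sum_const, hN, Nat.cast_smul_eq_nsmul]
  have z1 : ∑ p ∈ s, ∑ l ∈ s, t p l l l = 0 := by
    rw [Finset.sum_comm]; simp only [h₀, Finset.sum_const_zero]
  have q1 : ∑ p ∈ s, ∑ l ∈ s, t l p p l = Q := Finset.sum_comm
  have z2 : ∑ p ∈ s, ∑ l ∈ s, t l l l p = 0 := by
    rw [Finset.sum_comm]; simp only [h₃, Finset.sum_const_zero]
  have z3 : ∑ p ∈ s, ∑ l ∈ s, ∑ m ∈ s, t m l p m = 0 := by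
    have : ∀ l m, ∑ p ∈ s, t m l p m = 0 := fun l m => by
      rw [← h₃ m l m]; exact Finset.sum_congr rfl fun p _ => h₂ _ _ _ _
    rw [Finset.sum_comm]
    refine Finset.sum_eq_zero fun l _ => ?_
    rw [Finset.sum_comm]
    simp only [this, Finset.sum_const_zero]
  have z4 : ∑ p ∈ s, ∑ l ∈ s, ∑ m ∈ s, t p m m l = 0 := by
    refine Finset.sum_eq_zero fun p _ => ?_
    rw [Finset.sum_comm]
    simp only [h₃, Finset.sum_const_zero]
  have q2 : ∀ p l, t p p l l = t p l l p := fun p l => (h₁ p p l l).trans (h₂ p l p l)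
  have hL : ∑ p ∈ s, ∑ l ∈ s,
        (t l l l l - (3 : ℝ) • t l l l p + (3 : ℝ) • t l p p l - t l p p p
          - (t p l l l - (3 : ℝ) • t p l l p + (3 : ℝ) • t p p p l - t p p p p)
          - (6 / (N + 1)) • ∑ m ∈ s, (t m l l m - (2 : ℝ) • t m l p m + t m p p m)) =
      (2 * N) • P + (6 : ℝ) • Q - (6 / (N + 1) * (2 * N)) • Q := by
    simp only [Finset.sum_add_distrib, Finset.sum_sub_distrib, ← Finset.smul_sum, z1, z2, z3, q1,
      h₀, h₃, hc, ← hP, ← hQ]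
    module
  have hR : ∀ p l m, (if l = m then (2 : ℝ) else 1) •
        ((2 : ℝ) • (t p p p p + t p l l l + t p m m m) -
          (3 : ℝ) • (t p p p l + t p p p m + t p l l p + t p l l m + t p m m p + t p m m l) +
          (12 : ℝ) • t p p l m) =
        ((2 : ℝ) • (t p p p p + t p l l l + t p m m m) -
          (3 : ℝ) • (t p p p l + t p p p m + t p l l p + t p l l m + t p m m p + t p m m l) +
          (12 : ℝ) • t p p l m) + if l = m then
        ((2 : ℝ) • t p p p p - (2 : ℝ) • t p l l l - (6 : ℝ) • t p p p l + (6 : ℝ) • t p l l p)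
        else 0 := by
    intro p l m
    split_ifs with h
    · subst h
      rw [q2 p l]
      module
    · module
  rw [hL]
  simp only [hR, Finset.sum_add_distrib, Finset.sum_sub_distrib, ← Finset.smul_sum,
    Finset.sum_ite_eq, Finset.sum_ite_mem, Finset.inter_self, z1, z4, h₃, hc,
    ← hP, ← hQ]
  have hN1 : N + 1 ≠ 0 := by positivity
  rw [smul_sub, smul_smul, show (N + 1) * (6 / (N + 1) * (2 * N)) = 12 * N by field_simp; ring]
  module

end

section

variable {d : ℕ} {V : Type*} [AddCommGroup V] [Module ℝ V] {e : Finset (Space d)}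

/-- `∑ l ⊗ ∇λ_l` is the identity tensor. -/
lemma IsSimplex.sum_bilin_grad (he : IsSimplex e) (B : Space d →ₗ[ℝ] Space d →ₗ[ℝ] V)
    (c : Space d) : ∑ l ∈ e, B (l - c) (grad e l) =
      ∑ a, B (EuclideanSpace.single a 1) (EuclideanSpace.single a 1) := by
  have h0 : ∑ l ∈ e, B (l - c) (grad e l) = ∑ l ∈ e, B l (grad e l) := by
    simp only [map_sub, LinearMap.sub_apply, Finset.sum_sub_distrib, ← map_sum, he.sum_grad,
      map_zero, sub_zero]
  have h1 : ∀ g : Space d, g = ∑ a, (inner ℝ g (EuclideanSpace.single a 1) : ℝ) •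
      (EuclideanSpace.single a 1 : Space d) := by
    intro g
    have := (EuclideanSpace.basisFun (Fin d) ℝ).sum_repr' g
    simp only [EuclideanSpace.basisFun_apply] at this
    conv_lhs => rw [← this]
    exact Finset.sum_congr rfl fun a _ => by rw [real_inner_comm]
  have h2 : ∀ l ∈ e, B l (grad e l) = ∑ a,
      B ((inner ℝ (grad e l) (EuclideanSpace.single a 1) : ℝ) • l) (EuclideanSpace.single a 1) := by
    intro l _
    conv_lhs => rw [h1 (grad e l)]
    simp only [map_sum, map_smul, LinearMap.smul_apply]
  rw [h0, Finset.sum_congr rfl h2, Finset.sum_comm]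
  refine Finset.sum_congr rfl fun a _ => ?_
  rw [← LinearMap.sum_apply, ← map_sum, he.sum_inner_grad_smul]

/-- The third-order identity in a simplex: the defect between the two constant tensors that arise in
the flux and in the mass term is a combination of the sums `∇λ_p + ∇λ_l + ∇λ_m`, with weights that
depend on the points `p`, `l`, `m` only. -/
lemma IsSimplex.sum_quadrilinear (he : IsSimplex e) [DecidableEq (Space d)]
    (τ : Space d →ₗ[ℝ] Space d →ₗ[ℝ] Space d →ₗ[ℝ] Space d →ₗ[ℝ] V)
    (h₁ : ∀ g u v w, τ g u v w = τ g v u w) (h₂ : ∀ g u v w, τ g u v w = τ g u w v) :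
    ((d : ℝ) + 2) • (∑ p ∈ e, ∑ l ∈ e,
      (τ (grad e l - grad e p) (l - p) (l - p) (l - p) - (6 / ((d : ℝ) + 2)) •
        ∑ a, τ (EuclideanSpace.single a 1) (l - p) (l - p) (EuclideanSpace.single a 1))) =
      ∑ p ∈ e, ∑ l ∈ e, ∑ m ∈ e, (if l = m then (2 : ℝ) else 1) •
        τ (grad e p) ((2 : ℝ) • p - l - m) ((2 : ℝ) • l - p - m) ((2 : ℝ) • m - p - l) := by
  let c : Space d := ((d : ℝ) + 1)⁻¹ • ∑ l ∈ e, l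
  let t : Space d → Space d → Space d → Space d → V := fun m p q r =>
    τ (grad e m) (p - c) (q - c) (r - c)
  have hcard : (e.card : ℝ) = d + 1 := by rw [he.card]; push_cast; rfl
  have hd1 : (d : ℝ) + 1 ≠ 0 := by positivity
  have hsumc : ∑ l ∈ e, (l - c) = 0 := by
    rw [Finset.sum_sub_distrib, Finset.sum_const, he.card, ← Nat.cast_smul_eq_nsmul ℝ]
    simp only [c, smul_smul]
    push_cast
    rw [mul_inv_cancel₀ hd1, one_smul, sub_self]
  have key := sum_tensor_identity e t (fun m p q r => h₁ _ _ _ _) (fun m p q r => h₂ _ _ _ _)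
    (fun p q r => by simp only [t, ← LinearMap.sum_apply, ← map_sum, he.sum_grad, map_zero,
      LinearMap.zero_apply])
    (fun m p q => by simp only [t, ← map_sum, hsumc, map_zero])
  rw [hcard, show (d : ℝ) + 1 + 1 = d + 2 by ring] at key
  refine Eq.trans ?_ (key.trans ?_)
  · congr 1
    refine Finset.sum_congr rfl fun p _ => Finset.sum_congr rfl fun l _ => ?_
    have hlp : l - p = (l - c) - (p - c) := by abel
    have hB : ∑ a, τ (EuclideanSpace.single a 1) (l - p) (l - p) (EuclideanSpace.single a 1) =
        ∑ m ∈ e, τ (grad e m) (l - p) (l - p) (m - c) := by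
      let B : Space d →ₗ[ℝ] Space d →ₗ[ℝ] V := LinearMap.mk₂ ℝ
        (fun u g => τ g (l - p) (l - p) u) (fun _ _ _ => map_add _ _ _)
        (fun _ _ _ => map_smul _ _ _) (fun _ _ _ => by simp) (fun _ _ _ => by simp)
      exact (he.sum_bilin_grad B c).symm
    rw [hB, hlp, map_sub τ, LinearMap.sub_apply, LinearMap.sub_apply, LinearMap.sub_apply,
      symm_trilinear_sub_cube (τ (grad e l)) (h₁ _) (h₂ _),
      symm_trilinear_sub_cube (τ (grad e p)) (h₁ _) (h₂ _)]
    congr 2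
    refine Finset.sum_congr rfl fun m _ => ?_
    simp only [map_sub _ (l - c) (p - c), LinearMap.sub_apply, t]
    rw [h₁ _ (p - c) (l - c)]
    module
  · refine Finset.sum_congr rfl fun p _ => Finset.sum_congr rfl fun l _ =>
      Finset.sum_congr rfl fun m _ => ?_
    have e1 : ∀ x y z : Space d, (2 : ℝ) • x - y - z =
        (2 : ℝ) • (x - c) - (y - c) - (z - c) := fun x y z => by module
    rw [e1 p, e1 l, e1 m, symm_trilinear_medians (τ (grad e p)) (h₁ _) (h₂ _)]

end

namespace PeriodicMesh

variable {d : ℕ} (M : PeriodicMesh d) {V : Type*} [AddCommGroup V] [Module ℝ V]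

/-- Exactness on linear functions of the sums over the faces of a dual cell. -/
lemma sum_starAt_bilin (p : Space d) (B : Space d →ₗ[ℝ] Space d →ₗ[ℝ] V) :
    ∑ e ∈ M.starAt p, simplexVolume e • ∑ l ∈ e, B (l - p) (grad e l - grad e p) =
      (2 * ∑ e ∈ M.starAt p, simplexVolume e) •
        ∑ a, B (EuclideanSpace.single a 1) (EuclideanSpace.single a 1) := by
  classical
  have h0 : ∑ e ∈ M.starAt p, ∑ l ∈ e, simplexVolume e • B (l - p) (grad e p + grad e l) = 0 := by
    refine sum_sum_mem_eq_zero _ _ fun l => ?_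
    by_cases hl : l = p
    · simp [hl]
    · rw [← map_zero (B (l - p)), ← M.sum_simplexVolume_smul_grad_add_grad hl, map_sum]
      exact Finset.sum_congr rfl fun e _ => (map_smul _ _ _).symm
  have h1 : ∀ e ∈ M.starAt p, simplexVolume e • ∑ l ∈ e, B (l - p) (grad e l - grad e p) =
      (2 * simplexVolume e) • (∑ a, B (EuclideanSpace.single a 1) (EuclideanSpace.single a 1)) -
        ∑ l ∈ e, simplexVolume e • B (l - p) (grad e p + grad e l) := by
    intro e he
    rw [← (M.isSimplex (M.mem_starAt.1 he).1).sum_bilin_grad B p, Finset.smul_sum,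
      Finset.smul_sum, ← Finset.sum_sub_distrib]
    refine Finset.sum_congr rfl fun l _ => ?_
    rw [map_sub, map_add]
    module
  rw [Finset.sum_congr rfl h1, Finset.sum_sub_distrib, h0, sub_zero, ← Finset.sum_smul,
    Finset.mul_sum]

lemma sum_starAt_linear (p : Space d) (L : Space d →ₗ[ℝ] V) :
    ∑ e ∈ M.starAt p, simplexVolume e • ∑ l ∈ e, L (grad e l - grad e p) = 0 := by
  have h1 : ∀ e ∈ M.starAt p, simplexVolume e • ∑ l ∈ e, L (grad e l - grad e p) =
      (-((d : ℝ) + 1)) • L (simplexVolume e • grad e p) := by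
    intro e he
    have hs := M.isSimplex (M.mem_starAt.1 he).1
    rw [← map_sum, Finset.sum_sub_distrib, hs.sum_grad, Finset.sum_const, hs.card, zero_sub,
      ← Nat.cast_smul_eq_nsmul ℝ, map_neg, map_smul, map_smul]
    push_cast
    module
  rw [Finset.sum_congr rfl h1, ← Finset.smul_sum, ← map_sum, M.sum_simplexVolume_smul_grad,
    map_zero, smul_zero]

/-- The third-order identity, summed over a period. In each simplex the summand is, up to its
distribution between the vertices, a combination of the sums `∇λ_p + ∇λ_l + ∇λ_m`; these cancel
over the elements that share the vertices `p`, `l`, `m`. -/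
theorem sum_period_quadrilinear {T : Finset M.Node} (hT : M.IsPeriodCell T)
    (τ : Space d →ₗ[ℝ] Space d →ₗ[ℝ] Space d →ₗ[ℝ] Space d →ₗ[ℝ] V)
    (h₁ : ∀ g u v w, τ g u v w = τ g v u w) (h₂ : ∀ g u v w, τ g u v w = τ g u w v) :
    ∑ j ∈ T, ∑ e ∈ M.starAt (M.pos j), simplexVolume e • ∑ l ∈ e,
      (τ (grad e l - grad e (M.pos j)) (l - M.pos j) (l - M.pos j) (l - M.pos j) -
        (6 / ((d : ℝ) + 2)) • ∑ a, τ (EuclideanSpace.single a 1) (l - M.pos j) (l - M.pos j)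
          (EuclideanSpace.single a 1)) = 0 := by
  classical
  let Y : Finset (Space d) → Space d → V := fun e p => ∑ l ∈ e,
      (τ (grad e l - grad e p) (l - p) (l - p) (l - p) -
        (6 / ((d : ℝ) + 2)) • ∑ a, τ (EuclideanSpace.single a 1) (l - p) (l - p)
          (EuclideanSpace.single a 1))
  let C : Space d → Space d → Space d → Space d → V := fun g p l m =>
    τ g ((2 : ℝ) • p - l - m) ((2 : ℝ) • l - p - m) ((2 : ℝ) • m - p - l)
  let G : Finset (Space d) → Space d → Space d → Space d → Space d := fun e p l m =>
    (if l = m then (2 : ℝ) else 1) • grad e p + (if p = m then (2 : ℝ) else 1) • grad e l +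
      (if p = l then (2 : ℝ) else 1) • grad e m
  let Y' : Finset (Space d) → Space d → V := fun e p => ∑ l ∈ e, ∑ m ∈ e, C (G e p l m) p l m
  have hY' : ∀ e ∈ M.elements, ∑ p ∈ e, Y' e p = (3 * ((d : ℝ) + 2)) • ∑ p ∈ e, Y e p := by
    intro e he
    rw [mul_smul, (M.isSimplex he).sum_quadrilinear τ h₁ h₂]
    have hC : ∀ g p l m, C g p l m = C g l p m ∧ C g p l m = C g m l p := by
      intro g p l m
      simp only [C]
      constructor
      · rw [h₁, sub_right_comm ((2 : ℝ) • m)]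
      · rw [h₁, h₂, h₁, sub_right_comm ((2 : ℝ) • m), sub_right_comm ((2 : ℝ) • l),
          sub_right_comm ((2 : ℝ) • p)]
    have hexp : ∀ p l m, C (G e p l m) p l m =
        (if l = m then (2 : ℝ) else 1) • C (grad e p) p l m +
        (if p = m then (2 : ℝ) else 1) • C (grad e l) l p m +
        (if l = p then (2 : ℝ) else 1) • C (grad e m) m l p := by
      intro p l m
      rw [← (hC (grad e l) p l m).1, ← (hC (grad e m) p l m).2]
      simp only [C, G, map_add, map_smul, LinearMap.add_apply, LinearMap.smul_apply,
        eq_comm (a := p) (b := l)]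
    simp only [Y', hexp, Finset.sum_add_distrib]
    have s2 : ∑ p ∈ e, ∑ l ∈ e, ∑ m ∈ e, (if p = m then (2 : ℝ) else 1) • C (grad e l) l p m =
        ∑ p ∈ e, ∑ l ∈ e, ∑ m ∈ e, (if l = m then (2 : ℝ) else 1) • C (grad e p) p l m :=
      Finset.sum_comm
    have s3 : ∑ p ∈ e, ∑ l ∈ e, ∑ m ∈ e, (if l = p then (2 : ℝ) else 1) • C (grad e m) m l p =
        ∑ p ∈ e, ∑ l ∈ e, ∑ m ∈ e, (if l = m then (2 : ℝ) else 1) • C (grad e p) p l m := by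
      rw [Finset.sum_comm]
      conv_rhs => rw [Finset.sum_comm]
      exact Finset.sum_congr rfl fun l _ => Finset.sum_comm
    rw [s2, s3]
    module
  have hface : ∀ p, ∑ e ∈ M.starAt p, simplexVolume e • Y' e p = 0 := by
    intro p
    simp only [Y', Finset.smul_sum]
    refine sum_sum_mem_eq_zero _ _ fun l => sum_sum_mem_eq_zero _ _ fun m => ?_
    rw [Finset.filter_filter]
    have h := M.sum_simplexVolume_smul_grad_triple p l m
    have h' := congrArg (fun g => C g p l m) h
    simp only [C, map_sum, map_zero, LinearMap.sum_apply, LinearMap.zero_apply] at h'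
    refine Eq.trans (Finset.sum_congr rfl fun e _ => ?_) h'
    simp only [C, G]
    rw [map_smul τ]
    rfl
  have hred := M.sum_starAt_eq_zero hT
    (Z := fun e p => simplexVolume e • ((3 * ((d : ℝ) + 2)) • Y e p - Y' e p)) ?_ ?_
  · simp only [smul_sub, Finset.sum_sub_distrib, hface, sub_zero] at hred
    have hc : (3 * ((d : ℝ) + 2)) ≠ 0 := by positivity
    refine (smul_eq_zero.1 (Eq.trans ?_ hred)).resolve_left hc
    simp only [Finset.smul_sum (r := 3 * ((d : ℝ) + 2))]
    refine Finset.sum_congr rfl fun j _ => ?_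
    refine Finset.sum_congr rfl fun e _ => ?_
    rw [smul_comm]
  · intro e he
    rw [← Finset.smul_sum, Finset.sum_sub_distrib, ← Finset.smul_sum, hY' e he, sub_self, smul_zero]
  · intro e he p hp z
    have hs := M.isSimplex he
    have e1 : ∀ x y w v : Space d, (2 : ℝ) • (x + v) - (y + v) - (w + v) = (2 : ℝ) • x - y - w :=
      fun x y w v => by module
    simp only [Y, Y', C, G, Finset.sum_map, addRightEmbedding_apply, grad_translate hs,
      simplexVolume_translate, add_sub_add_right_eq_sub, e1, add_left_inj]

end PeriodicMesh

/-! ### Polynomials and their derivatives -/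

section

variable {d n p : ℕ} {f g : Space d → Fin n → ℂ}

lemma totalDegree_pderiv_le {σ R : Type*} [CommSemiring R] (i : σ) {q : MvPolynomial σ R} {p : ℕ}
    (hq : q.totalDegree ≤ p + 1) : (MvPolynomial.pderiv i q).totalDegree ≤ p := by
  classical
  rw [q.as_sum, map_sum]
  refine MvPolynomial.totalDegree_finsetSum_le fun s hs => ?_
  rw [MvPolynomial.pderiv_monomial]
  by_cases h0 : s i = 0
  · simp [h0]
  · refine (MvPolynomial.totalDegree_monomial_le _ _).trans ?_
    have h1 := (MvPolynomial.le_totalDegree hs).trans hq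
    have h2 : (Finsupp.single i 1) + (s - Finsupp.single i 1) = s :=
      add_tsub_cancel_of_le (by simpa using Nat.one_le_iff_ne_zero.2 h0)
    have h3 := congrArg Finsupp.degree h2
    rw [map_add, Finsupp.degree_single] at h3
    have h4 : Finsupp.degree s ≤ p + 1 := h1
    change Finsupp.degree _ ≤ p
    omega

lemma hasFDerivAt_eval (q : MvPolynomial (Fin d) ℂ) (r : Space d) :
    HasFDerivAt (fun r : Space d => MvPolynomial.eval (fun i => (r i : ℂ)) q)
      (∑ i, (EuclideanSpace.proj i : Space d →L[ℝ] ℝ).smulRight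
        (MvPolynomial.eval (fun i => (r i : ℂ)) (MvPolynomial.pderiv i q))) r := by
  induction q using MvPolynomial.induction_on with
  | C a =>
    refine (hasFDerivAt_const a r).congr_fderiv ?_ |>.congr_of_eventuallyEq ?_
    · ext h
      simp
    · exact Filter.Eventually.of_forall fun r => by simp
  | add p q hp hq =>
    refine (hp.add hq).congr_fderiv ?_ |>.congr_of_eventuallyEq ?_
    · ext h
      simp [Finset.sum_add_distrib]
    · exact Filter.Eventually.of_forall fun r => by simp
  | mul_X q i hq =>
    have hX : HasFDerivAt (fun r : Space d => (r i : ℂ))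
        (Complex.ofRealCLM.comp (EuclideanSpace.proj i : Space d →L[ℝ] ℝ)) r :=
      (Complex.ofRealCLM.comp (EuclideanSpace.proj i : Space d →L[ℝ] ℝ)).hasFDerivAt
    refine (hq.mul hX).congr_fderiv ?_ |>.congr_of_eventuallyEq ?_
    · ext h
      simp [MvPolynomial.pderiv_X, Finset.sum_add_distrib, Pi.single_apply, Finset.mul_sum,
        apply_ite]
      ring_nf
    · exact Filter.Eventually.of_forall fun r => by simp

lemma contDiff_eval (q : MvPolynomial (Fin d) ℂ) :
    ContDiff ℝ ⊤ (fun r : Space d => MvPolynomial.eval (fun i => (r i : ℂ)) q) := by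
  induction q using MvPolynomial.induction_on with
  | C a => simpa using contDiff_const
  | add p q hp hq => simpa using hp.add hq
  | mul_X q i hq =>
    have hX : ContDiff ℝ ⊤ (fun r : Space d => (r i : ℂ)) :=
      (Complex.ofRealCLM.comp (EuclideanSpace.proj i : Space d →L[ℝ] ℝ)).contDiff
    simpa using hq.mul hX

lemma IsPolynomial.contDiff (hf : IsPolynomial p f) : ContDiff ℝ ⊤ f := by
  obtain ⟨q, -, hq⟩ := hf
  rw [contDiff_pi]
  intro a
  simp only [hq]
  exact contDiff_eval (q a)

lemma IsPolynomial.differentiable (hf : IsPolynomial p f) : Differentiable ℝ f :=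
  hf.contDiff.differentiable (by simp)

lemma IsPolynomial.dirDeriv (hf : IsPolynomial (p + 1) f) (h : Space d) :
    IsPolynomial p (dirDeriv h f) := by
  obtain ⟨q, hdeg, hq⟩ := hf
  refine ⟨fun a => ∑ i, MvPolynomial.C (h i : ℂ) * MvPolynomial.pderiv i (q a), fun a => ?_,
    fun r a => ?_⟩
  · refine MvPolynomial.totalDegree_finsetSum_le fun i _ => ?_
    refine (MvPolynomial.totalDegree_mul _ _).trans ?_
    rw [MvPolynomial.totalDegree_C, zero_add]
    exact totalDegree_pderiv_le i (hdeg a)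
  · have hf' : f = fun r a => MvPolynomial.eval (fun i => (r i : ℂ)) (q a) := by
      ext r a; exact hq r a
    have := (hasFDerivAt_pi.2 fun a => hasFDerivAt_eval (q a) r).fderiv
    rw [FluxCorrection.dirDeriv, hf', this]
    simp

lemma IsPolynomial.mono {p' : ℕ} (hf : IsPolynomial p f) (hp : p ≤ p') : IsPolynomial p' f := by
  obtain ⟨q, hdeg, hq⟩ := hf
  exact ⟨q, fun a => (hdeg a).trans hp, hq⟩

lemma IsPolynomial.add (hf : IsPolynomial p f) (hg : IsPolynomial p g) :
    IsPolynomial p (fun r => f r + g r) := by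
  obtain ⟨q, hdeg, hq⟩ := hf
  obtain ⟨q', hdeg', hq'⟩ := hg
  refine ⟨fun a => q a + q' a, fun a => ?_, fun r a => ?_⟩
  · exact (MvPolynomial.totalDegree_add _ _).trans (max_le (hdeg a) (hdeg' a))
  · simp [hq, hq']

lemma IsPolynomial.act (hf : IsPolynomial p f) (B : Matrix (Fin n) (Fin n) ℝ) :
    IsPolynomial p (fun r => act B (f r)) := by
  obtain ⟨q, hdeg, hq⟩ := hf
  refine ⟨fun a => ∑ b, MvPolynomial.C (B a b : ℂ) * q b, fun a => ?_, fun r a => ?_⟩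
  · refine MvPolynomial.totalDegree_finsetSum_le fun b _ => ?_
    refine (MvPolynomial.totalDegree_mul _ _).trans ?_
    rw [MvPolynomial.totalDegree_C, zero_add]
    exact hdeg b
  · simp [FluxCorrection.act, Matrix.mulVec, dotProduct, hq]

lemma IsPolynomial.const_smul (hf : IsPolynomial p f) (c : ℝ) :
    IsPolynomial p (fun r => c • f r) := by
  obtain ⟨q, hdeg, hq⟩ := hf
  refine ⟨fun a => MvPolynomial.C (c : ℂ) * q a, fun a => ?_, fun r a => ?_⟩
  · refine (MvPolynomial.totalDegree_mul _ _).trans ?_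
    rw [MvPolynomial.totalDegree_C, zero_add]
    exact hdeg a
  · simp [hq]

lemma IsPolynomial.zero : IsPolynomial p (fun _ : Space d => (0 : Fin n → ℂ)) :=
  ⟨fun _ => 0, by simp, by simp⟩

lemma IsPolynomial.sum {ι : Type*} (s : Finset ι) {F : ι → Space d → Fin n → ℂ}
    (hF : ∀ i ∈ s, IsPolynomial p (F i)) : IsPolynomial p (fun r => ∑ i ∈ s, F i r) := by
  classical
  induction s using Finset.induction_on with
  | empty => simpa using IsPolynomial.zero
  | insert a s ha ih =>
    simp only [Finset.sum_insert ha]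
    exact (hF a (Finset.mem_insert_self a s)).add
      (ih fun i hi => hF i (Finset.mem_insert_of_mem hi))

lemma IsPolynomial.apply_eq (hf : IsPolynomial 0 f) (r r' : Space d) : f r = f r' := by
  obtain ⟨q, hdeg, hq⟩ := hf
  ext a
  rw [hq, hq, MvPolynomial.totalDegree_eq_zero_iff_eq_C.1 (Nat.le_zero.1 (hdeg a))]
  simp

lemma IsPolynomial.dirDeriv_eq_zero (hf : IsPolynomial 0 f) (h : Space d) :
    FluxCorrection.dirDeriv h f = fun _ => 0 := by
  have : f = fun _ => f 0 := by ext1 r; exact hf.apply_eq r 0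
  rw [this]
  ext1 r
  simp [FluxCorrection.dirDeriv]

/-- Taylor's formula for polynomials. -/
lemma IsPolynomial.taylor (hf : IsPolynomial p f) (r h : Space d) (t : ℝ) :
    f (r + t • h) = ∑ m ∈ Finset.range (p + 1),
      (t ^ m / m.factorial) • ((FluxCorrection.dirDeriv h)^[m] f) r := by
  induction p generalizing f t with
  | zero => simpa using hf.apply_eq _ _
  | succ p ih =>
    let u : ℝ → Fin n → ℂ := fun t => f (r + t • h) - ∑ m ∈ Finset.range (p + 1 + 1),
      (t ^ m / m.factorial) • ((FluxCorrection.dirDeriv h)^[m] f) r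
    have h1 : ∀ t, HasDerivAt (fun t : ℝ => f (r + t • h))
        (FluxCorrection.dirDeriv h f (r + t • h)) t := by
      intro t
      have hl : HasDerivAt (fun t : ℝ => r + t • h) h t := by
        simpa using ((hasDerivAt_id t).smul_const h).const_add r
      exact (hf.differentiable (r + t • h)).hasFDerivAt.comp_hasDerivAt t hl
    have h2 : ∀ t : ℝ, HasDerivAt (fun t : ℝ => ∑ m ∈ Finset.range (p + 1 + 1),
        (t ^ m / m.factorial) • ((FluxCorrection.dirDeriv h)^[m] f) r)
        (∑ m ∈ Finset.range (p + 1),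
          (t ^ m / m.factorial) • ((FluxCorrection.dirDeriv h)^[m + 1] f) r) t := by
      intro t
      have : ∀ m ∈ Finset.range (p + 1 + 1), HasDerivAt
          (fun t : ℝ => (t ^ m / m.factorial) • ((FluxCorrection.dirDeriv h)^[m] f) r)
          ((m * t ^ (m - 1) / m.factorial) • ((FluxCorrection.dirDeriv h)^[m] f) r) t :=
        fun m _ => ((hasDerivAt_pow m t).div_const _).smul_const _
      refine (HasDerivAt.fun_sum this).congr_deriv ?_
      rw [Finset.sum_range_succ']
      simp only [Nat.cast_zero, zero_mul, zero_div, zero_smul, add_zero]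
      refine Finset.sum_congr rfl fun m _ => ?_
      congr 1
      rw [Nat.factorial_succ, Nat.add_sub_cancel]
      push_cast
      field_simp
    have hu : ∀ t, HasDerivAt u 0 t := by
      intro t
      refine ((h1 t).sub (h2 t)).congr_deriv ?_
      rw [sub_eq_zero, ih (hf.dirDeriv h) t]
      rfl
    have h3 := is_const_of_deriv_eq_zero (fun t => (hu t).differentiableAt)
      (fun t => (hu t).deriv) t 0
    have h4 : u 0 = 0 := by
      simp only [u]
      rw [Finset.sum_range_succ']
      simp
    rw [h4] at h3
    exact sub_eq_zero.1 h3

lemma IsPolynomial.taylor_two (hf : IsPolynomial 2 f) (r h : Space d) :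
    f (r + h) = f r + FluxCorrection.dirDeriv h f r +
      (1 / 2 : ℝ) • FluxCorrection.dirDeriv h (FluxCorrection.dirDeriv h f) r := by
  have := hf.taylor r h 1
  simpa [Finset.sum_range_succ] using this

lemma IsPolynomial.taylor_three (hf : IsPolynomial 3 f) (r h : Space d) :
    f (r + h) = f r + FluxCorrection.dirDeriv h f r +
      (1 / 2 : ℝ) • FluxCorrection.dirDeriv h (FluxCorrection.dirDeriv h f) r +
      (1 / 6 : ℝ) • FluxCorrection.dirDeriv h
        (FluxCorrection.dirDeriv h (FluxCorrection.dirDeriv h f)) r := by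
  have := hf.taylor r h 1
  simpa [Finset.sum_range_succ, Nat.factorial] using this

lemma dirDeriv_dirDeriv (hf : ContDiff ℝ ⊤ f) (v w r : Space d) :
    dirDeriv v (dirDeriv w f) r = fderiv ℝ (fderiv ℝ f) r v w := by
  have h1 : DifferentiableAt ℝ (fderiv ℝ f) r :=
    (hf.fderiv_right (m := ⊤) (by simp)).differentiable (by simp) r
  have := (h1.hasFDerivAt.clm_apply (hasFDerivAt_const w r)).fderiv
  rw [dirDeriv, show dirDeriv w f = fun r => fderiv ℝ f r w from rfl, this]
  simp

lemma dirDeriv_comm (hf : ContDiff ℝ ⊤ f) (v w : Space d) :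
    dirDeriv v (dirDeriv w f) = dirDeriv w (dirDeriv v f) := by
  ext1 r
  rw [dirDeriv_dirDeriv hf, dirDeriv_dirDeriv hf]
  exact (hf.contDiffAt.isSymmSndFDerivAt (by simp)).eq v w

/-- The third derivative of a polynomial at the origin as a trilinear form. -/
noncomputable def thirdDeriv (f : Space d → Fin n → ℂ) :
    Space d →ₗ[ℝ] Space d →ₗ[ℝ] Space d →ₗ[ℝ] (Fin n → ℂ) :=
  LinearMap.mk₂ ℝ
    (fun u v => (fderiv ℝ (fderiv ℝ (fderiv ℝ f)) 0 u v).toLinearMap)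
    (fun _ _ _ => by simp) (fun _ _ _ => by simp) (fun _ _ _ => by simp) (fun _ _ _ => by simp)

lemma IsPolynomial.thirdDeriv_apply (hf : IsPolynomial 3 f) (u v w r : Space d) :
    thirdDeriv f u v w =
      FluxCorrection.dirDeriv u (FluxCorrection.dirDeriv v (FluxCorrection.dirDeriv w f)) r := by
  rw [(((hf.dirDeriv w).dirDeriv v).dirDeriv u).apply_eq r 0]
  have h1 : ContDiff ℝ ⊤ (fderiv ℝ f) := hf.contDiff.fderiv_right (by simp)
  have h2 : Differentiable ℝ (fderiv ℝ (fderiv ℝ f)) :=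
    (h1.fderiv_right (m := ⊤) (by simp)).differentiable (by simp)
  have h3 : FluxCorrection.dirDeriv v (FluxCorrection.dirDeriv w f) =
      fun r => fderiv ℝ (fderiv ℝ f) r v w := by
    ext1 r; exact dirDeriv_dirDeriv hf.contDiff v w r
  have h4 := (((h2 0).hasFDerivAt.clm_apply (hasFDerivAt_const v 0)).clm_apply
    (hasFDerivAt_const w 0)).fderiv
  rw [h3, FluxCorrection.dirDeriv, h4]
  simp [thirdDeriv]

end

/-! ### The upwind flux -/

section

variable {d n : ℕ}

/-- The absolute value of a diagonalizable matrix does not depend on the diagonalization: a matrix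
that intertwines two diagonal matrices intertwines their absolute values. -/
lemma matrixAbs_eq {B S : Matrix (Fin n) (Fin n) ℝ} {lam : Fin n → ℝ} (hS : IsUnit S.det)
    (hB : B = S * Matrix.diagonal lam * S⁻¹) :
    matrixAbs B = S * Matrix.diagonal (fun i => |lam i|) * S⁻¹ := by
  have h : ∃ p : Matrix (Fin n) (Fin n) ℝ × (Fin n → ℝ),
      IsUnit p.1.det ∧ B = p.1 * Matrix.diagonal p.2 * p.1⁻¹ := ⟨(S, lam), hS, hB⟩
  rw [matrixAbs, dif_pos h]
  obtain ⟨hR, hBR⟩ := h.choose_spec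
  generalize h.choose.1 = R at *
  generalize h.choose.2 = mu at *
  have hRR : R⁻¹ * R = 1 := Matrix.nonsing_inv_mul R hR
  have hRR' : R * R⁻¹ = 1 := Matrix.mul_nonsing_inv R hR
  have hSS : S⁻¹ * S = 1 := Matrix.nonsing_inv_mul S hS
  have hSS' : S * S⁻¹ = 1 := Matrix.mul_nonsing_inv S hS
  have h1 : Matrix.diagonal mu * (R⁻¹ * S) = (R⁻¹ * S) * Matrix.diagonal lam := by
    calc Matrix.diagonal mu * (R⁻¹ * S)
        = (R⁻¹ * R) * Matrix.diagonal mu * (R⁻¹ * S) := by rw [hRR, Matrix.one_mul]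
      _ = R⁻¹ * (R * Matrix.diagonal mu * R⁻¹) * S := by simp only [Matrix.mul_assoc]
      _ = R⁻¹ * (S * Matrix.diagonal lam * S⁻¹) * S := by rw [← hBR, hB]
      _ = (R⁻¹ * S) * Matrix.diagonal lam * (S⁻¹ * S) := by simp only [Matrix.mul_assoc]
      _ = (R⁻¹ * S) * Matrix.diagonal lam := by rw [hSS, Matrix.mul_one]
  have h2 : Matrix.diagonal (fun i => |mu i|) * (R⁻¹ * S) =
      (R⁻¹ * S) * Matrix.diagonal (fun i => |lam i|) := by
    ext a b
    have := congrFun (congrFun h1 a) b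
    rw [Matrix.diagonal_mul, Matrix.mul_diagonal] at this ⊢
    by_cases h0 : (R⁻¹ * S) a b = 0
    · simp [h0]
    · rw [mul_comm] at this
      rw [mul_left_cancel₀ h0 this, mul_comm]
  calc R * Matrix.diagonal (fun i => |mu i|) * R⁻¹
      = R * Matrix.diagonal (fun i => |mu i|) * R⁻¹ * (S * S⁻¹) := by rw [hSS', Matrix.mul_one]
    _ = R * (Matrix.diagonal (fun i => |mu i|) * (R⁻¹ * S)) * S⁻¹ := by simp only [Matrix.mul_assoc]
    _ = (R * R⁻¹) * S * Matrix.diagonal (fun i => |lam i|) * S⁻¹ := by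
        rw [h2]; simp only [Matrix.mul_assoc]
    _ = S * Matrix.diagonal (fun i => |lam i|) * S⁻¹ := by rw [hRR', Matrix.one_mul]

lemma matrixAbs_neg {B S : Matrix (Fin n) (Fin n) ℝ} {lam : Fin n → ℝ} (hS : IsUnit S.det)
    (hB : B = S * Matrix.diagonal lam * S⁻¹) : matrixAbs (-B) = matrixAbs B := by
  have h : -B = S * Matrix.diagonal (fun i => -lam i) * S⁻¹ := by
    rw [hB, ← Matrix.diagonal_neg, Matrix.mul_neg, Matrix.neg_mul]
  rw [matrixAbs_eq hS hB, matrixAbs_eq hS h]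
  simp only [abs_neg]

lemma matrixAbs_zero : matrixAbs (0 : Matrix (Fin n) (Fin n) ℝ) = 0 := by
  rw [matrixAbs_eq (S := 1) (lam := fun _ => 0) (by simp) (by simp)]
  simp

lemma act_add (B : Matrix (Fin n) (Fin n) ℝ) (u v : Fin n → ℂ) :
    act B (u + v) = act B u + act B v := Matrix.mulVec_add _ _ _

lemma act_smul (B : Matrix (Fin n) (Fin n) ℝ) (c : ℝ) (u : Fin n → ℂ) :
    act B (c • u) = c • act B u := Matrix.mulVec_smul _ _ _

lemma add_act (B C : Matrix (Fin n) (Fin n) ℝ) (u : Fin n → ℂ) :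
    act (B + C) u = act B u + act C u := by
  rw [act, Matrix.map_add _ Complex.ofReal_add, Matrix.add_mulVec]
  rfl

lemma smul_act (B : Matrix (Fin n) (Fin n) ℝ) (c : ℝ) (u : Fin n → ℂ) :
    act (c • B) u = c • act B u := by
  ext a
  simp [act, Matrix.mulVec, dotProduct, Finset.smul_sum, mul_assoc]

lemma neg_act (B : Matrix (Fin n) (Fin n) ℝ) (u : Fin n → ℂ) : act (-B) u = -act B u := by
  have := smul_act B (-1) u
  simpa using this

/-- `(ξ, u) ↦ (A · ξ) u` as a bilinear map. -/
noncomputable def symbolAct (A : Fin d → Matrix (Fin n) (Fin n) ℝ) :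
    Space d →ₗ[ℝ] (Fin n → ℂ) →ₗ[ℝ] (Fin n → ℂ) :=
  LinearMap.mk₂ ℝ (fun ξ u => act (symbol A ξ) u)
    (fun ξ η u => by
      rw [← add_act]; congr 1; simp [symbol, add_smul, Finset.sum_add_distrib])
    (fun c ξ u => by
      rw [← smul_act]; congr 1; simp [symbol, mul_smul, Finset.smul_sum])
    (fun ξ u v => act_add _ _ _) (fun c ξ u => act_smul _ _ _)

lemma symbolAct_apply (A : Fin d → Matrix (Fin n) (Fin n) ℝ) (ξ : Space d) (u : Fin n → ℂ) :
    symbolAct A ξ u = act (symbol A ξ) u := rfl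

lemma symbolAct_single (A : Fin d → Matrix (Fin n) (Fin n) ℝ) (a : Fin d) (u : Fin n → ℂ) :
    symbolAct A (EuclideanSpace.single a 1) u = act (A a) u := by
  rw [symbolAct_apply]
  congr 1
  simp [symbol]

lemma symbol_neg (A : Fin d → Matrix (Fin n) (Fin n) ℝ) (ξ : Space d) :
    symbol A (-ξ) = -symbol A ξ := by
  simp [symbol]

lemma sum_smul_partialDeriv (f : Space d → Fin n → ℂ) (h r : Space d) :
    ∑ i, h i • partialDeriv i f r = dirDeriv h f r := by
  have : h = ∑ i, h i • (EuclideanSpace.single i 1 : Space d) := by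
    ext b
    simp [Pi.single_apply]
  conv_rhs => rw [this]
  simp only [dirDeriv, partialDeriv, map_sum, map_smul]

variable (M : PeriodicMesh d) {A : Fin d → Matrix (Fin n) (Fin n) ℝ}

lemma flux_of_areaVec_eq_zero (G : (M.Node → Fin n → ℂ) → (M.Node → Fin d → Fin n → ℂ))
    {j k : M.Node} (h : M.areaVec j k = 0) (u : M.Node → Fin n → ℂ) : flux M A G j k u = 0 := by
  have : symbol A (0 : Space d) = 0 := by simp [symbol]
  simp only [flux, h, this, matrixAbs_zero, add_zero, sub_zero, smul_zero]
  simp [act]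

/-- The upwind flux is conservative. -/
lemma flux_swap (hA : IsHyperbolic A)
    (G : (M.Node → Fin n → ℂ) → (M.Node → Fin d → Fin n → ℂ)) {j k : M.Node}
    (h : M.areaVec k j = -M.areaVec j k) (u : M.Node → Fin n → ℂ) :
    flux M A G k j u = -flux M A G j k u := by
  obtain ⟨S, lam, hS, hB⟩ := hA (M.areaVec j k)
  simp only [flux, h, symbol_neg, matrixAbs_neg hS hB]
  rw [neg_add, ← neg_act, ← neg_act, add_comm]
  congr 2
  · module
  · module

lemma flux_add (G : (M.Node → Fin n → ℂ) →ₗ[ℂ] (M.Node → Fin d → Fin n → ℂ)) (j k : M.Node)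
    (u v : M.Node → Fin n → ℂ) :
    flux M A G j k (fun l => u l + v l) = flux M A G j k u + flux M A G j k v := by
  have hR : ∀ j k, reconstruction M G j k (fun l => u l + v l) =
      reconstruction M G j k u + reconstruction M G j k v := by
    intro j k
    have : G (fun l => u l + v l) = G u + G v := map_add G u v
    simp only [reconstruction, this, Pi.add_apply, smul_add, Finset.sum_add_distrib]
    abel
  simp only [flux, hR, act_add]
  abel

variable {M} (X : ExtendedGalerkin M A)

/-- On quadratic polynomials the two reconstructed values at the middle of an edge coincide, so that
the upwinding has no effect. -/
lemma ExtendedGalerkin.flux_sample {f : Space d → Fin n → ℂ} (hf : IsPolynomial 2 f)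
    (j k : M.Node) : flux M A X.G j k (M.sample f) =
      symbolAct A (M.areaVec j k)
        (f (M.pos j) + (1 / 2 : ℝ) • dirDeriv (M.pos k - M.pos j) f (M.pos j)) := by
  have hR : ∀ j k, reconstruction M X.G j k (M.sample f) =
      f (M.pos j) + (1 / 2 : ℝ) • dirDeriv (M.pos k - M.pos j) f (M.pos j) := by
    intro j k
    rw [reconstruction, ← sum_smul_partialDeriv, Finset.smul_sum]
    congr 1
    refine Finset.sum_congr rfl fun i _ => ?_
    rw [X.G_exact f hf, smul_smul]
    congr 1
    simp only [PiLp.sub_apply]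
    ring
  have hkj : f (M.pos k) + (1 / 2 : ℝ) • dirDeriv (M.pos j - M.pos k) f (M.pos k) =
      f (M.pos j) + (1 / 2 : ℝ) • dirDeriv (M.pos k - M.pos j) f (M.pos j) := by
    set h := M.pos k - M.pos j with hh
    have e1 : M.pos k = M.pos j + h := by rw [hh]; abel
    have e2 : M.pos j - M.pos k = -h := by rw [hh]; abel
    have e3 : dirDeriv (-h) f (M.pos k) = -dirDeriv h f (M.pos k) := map_neg _ _
    have t1 := hf.taylor_two (M.pos j) h
    have t2 := ((hf.dirDeriv h).mono (show 1 ≤ 2 by norm_num)).taylor_two (M.pos j) h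
    rw [((hf.dirDeriv h).dirDeriv h).dirDeriv_eq_zero h] at t2
    rw [e2, e3, e1, t1, t2]
    module
  rw [flux, hR j k, hR k j, hkj, ← add_act, symbolAct_apply]
  congr 1
  module

/-- A conservative flux with exact derivatives, whose difference with the upwind flux vanishes on
quadratic polynomials. -/
noncomputable def centralFlux (M : PeriodicMesh d) (A : Fin d → Matrix (Fin n) (Fin n) ℝ)
    (j k : M.Node) (f : Space d → Fin n → ℂ) : Fin n → ℂ :=
  symbolAct A (M.areaVec j k) ((1 / 2 : ℝ) • (f (M.pos j) + f (M.pos k)) + (1 / 4 : ℝ) •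
    (dirDeriv (M.pos k - M.pos j) f (M.pos j) - dirDeriv (M.pos k - M.pos j) f (M.pos k)))

lemma centralFlux_eq {f : Space d → Fin n → ℂ} (hf : IsPolynomial 3 f) (j k : M.Node) :
    centralFlux M A j k f = symbolAct A (M.areaVec j k)
      (f (M.pos j) + (1 / 2 : ℝ) • dirDeriv (M.pos k - M.pos j) f (M.pos j) - (1 / 24 : ℝ) •
        thirdDeriv f (M.pos k - M.pos j) (M.pos k - M.pos j) (M.pos k - M.pos j)) := by
  rw [centralFlux, hf.thirdDeriv_apply _ _ _ (M.pos j)]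
  congr 1
  set h := M.pos k - M.pos j with hh
  have e1 : M.pos k = M.pos j + h := by rw [hh]; abel
  have t1 := hf.taylor_three (M.pos j) h
  have t2 := (hf.dirDeriv h).taylor_two (M.pos j) h
  rw [e1, t1, t2]
  module

lemma centralFlux_swap {j k : M.Node} (h : M.areaVec k j = -M.areaVec j k)
    (f : Space d → Fin n → ℂ) : centralFlux M A k j f = -centralFlux M A j k f := by
  have e : ∀ r, dirDeriv (M.pos j - M.pos k) f r = -dirDeriv (M.pos k - M.pos j) f r := fun r => by
    rw [← neg_sub (M.pos k)]; exact map_neg _ _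
  rw [centralFlux, centralFlux, h, e, e, map_neg, LinearMap.neg_apply]
  congr 2
  module

lemma centralFlux_add {f g : Space d → Fin n → ℂ} (hf : Differentiable ℝ f)
    (hg : Differentiable ℝ g) (j k : M.Node) :
    centralFlux M A j k (fun r => f r + g r) = centralFlux M A j k f + centralFlux M A j k g := by
  have e : ∀ h r, dirDeriv h (fun r => f r + g r) r = dirDeriv h f r + dirDeriv h g r := by
    intro h r
    rw [dirDeriv, fderiv_fun_add (hf r) (hg r)]
    rfl
  rw [centralFlux, centralFlux, centralFlux, e, e, ← map_add]
  congr 1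
  module

lemma thirdDeriv_symm₁ {f : Space d → Fin n → ℂ} (hf : IsPolynomial 3 f) (u v w : Space d) :
    thirdDeriv f u v w = thirdDeriv f v u w := by
  rw [hf.thirdDeriv_apply _ _ _ 0, hf.thirdDeriv_apply _ _ _ 0,
    dirDeriv_comm (hf.dirDeriv w).contDiff]

lemma thirdDeriv_symm₂ {f : Space d → Fin n → ℂ} (hf : IsPolynomial 3 f) (u v w : Space d) :
    thirdDeriv f u v w = thirdDeriv f u w v := by
  rw [hf.thirdDeriv_apply _ _ _ 0, hf.thirdDeriv_apply _ _ _ 0, dirDeriv_comm hf.contDiff]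

end

/-! ### The truncation error -/

section

variable {d n : ℕ} {M : PeriodicMesh d} {A : Fin d → Matrix (Fin n) (Fin n) ℝ}

lemma IsPolynomial.thirdDeriv_eq_zero {f : Space d → Fin n → ℂ} (hf : IsPolynomial 2 f) :
    thirdDeriv f = 0 := by
  ext1 u
  ext1 v
  ext1 w
  rw [(hf.mono (by norm_num)).thirdDeriv_apply u v w 0,
    ((hf.dirDeriv w).dirDeriv v).dirDeriv_eq_zero]
  rfl

lemma PeriodicMesh.areaVec_swap (M : PeriodicMesh d) {κ : ℝ}
    (hκ : ∀ j k : M.Node, j ≠ k → M.areaVec j k =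
      κ • ∑ e ∈ M.starAt (M.pos j) with M.pos k ∈ e,
        simplexVolume e • (grad e (M.pos k) - grad e (M.pos j))) {j k : M.Node} (hjk : j ≠ k) :
    M.areaVec k j = -M.areaVec j k := by
  rw [hκ j k hjk, hκ k j hjk.symm, ← smul_neg, ← Finset.sum_neg_distrib]
  congr 1
  refine Finset.sum_congr ?_ fun e _ => ?_
  · ext e
    simp only [Finset.mem_filter, M.mem_starAt]
    tauto
  · rw [← smul_neg, neg_sub]

lemma PeriodicMesh.areaVec_shift (M : PeriodicMesh d) {κ : ℝ}
    (hκ : ∀ j k : M.Node, j ≠ k → M.areaVec j k =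
      κ • ∑ e ∈ M.starAt (M.pos j) with M.pos k ∈ e,
        simplexVolume e • (grad e (M.pos k) - grad e (M.pos j))) {j k : M.Node} (hjk : j ≠ k)
    (z : Fin d → ℤ) : M.areaVec (M.shift z j) (M.shift z k) = M.areaVec j k := by
  have hne : M.shift z j ≠ M.shift z k := fun h => hjk (by
    rw [← M.shift_neg_shift z j, h, M.shift_neg_shift])
  rw [hκ j k hjk, hκ _ _ hne]
  congr 1
  simp only [M.pos_shift, M.starAt_shift, Finset.filter_map, Finset.sum_map,
    Function.Embedding.coeFn_mk]
  refine Finset.sum_congr ?_ fun e he => ?_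
  · ext e
    simp
  · rw [Finset.mem_filter] at he
    have hs := M.isSimplex (M.mem_starAt.1 he.1).1
    rw [grad_translate hs, grad_translate hs, simplexVolume_translate]

/-- The difference between the upwind flux and the central flux on a function. -/
noncomputable def fluxError (X : ExtendedGalerkin M A) (f : Space d → Fin n → ℂ) (j k : M.Node) :
    Fin n → ℂ :=
  flux M A X.G j k (M.sample f) - centralFlux M A j k f

variable (X : ExtendedGalerkin M A)

lemma fluxError_eq_zero {f : Space d → Fin n → ℂ} (hf : IsPolynomial 2 f) (j k : M.Node) :
    fluxError X f j k = 0 := by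
  rw [fluxError, X.flux_sample hf, centralFlux_eq (hf.mono (by norm_num)), hf.thirdDeriv_eq_zero]
  simp

lemma fluxError_add {f g : Space d → Fin n → ℂ} (hf : Differentiable ℝ f)
    (hg : Differentiable ℝ g) (j k : M.Node) :
    fluxError X (fun r => f r + g r) j k = fluxError X f j k + fluxError X g j k := by
  have : M.sample (fun r => f r + g r) = fun l => M.sample f l + M.sample g l := rfl
  rw [fluxError, fluxError, fluxError, this, flux_add, centralFlux_add hf hg]
  abel

lemma fluxError_of_areaVec_eq_zero {f : Space d → Fin n → ℂ} {j k : M.Node}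
    (h : M.areaVec j k = 0) : fluxError X f j k = 0 := by
  rw [fluxError, flux_of_areaVec_eq_zero M X.G h, centralFlux, h, map_zero]
  simp

/-- On cubic polynomials, the flux error is invariant under translations of the pair of nodes: a
translation changes the function by a quadratic polynomial. -/
lemma fluxError_shift {κ : ℝ} (hκ : ∀ j k : M.Node, j ≠ k → M.areaVec j k =
      κ • ∑ e ∈ M.starAt (M.pos j) with M.pos k ∈ e,
        simplexVolume e • (grad e (M.pos k) - grad e (M.pos j)))
    {f : Space d → Fin n → ℂ} (hf : IsPolynomial 3 f) {j k : M.Node} (hjk : j ≠ k)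
    (z : Fin d → ℤ) : fluxError X f (M.shift z j) (M.shift z k) = fluxError X f j k := by
  have hn := M.areaVec_shift hκ hjk z
  by_cases hk : k ∈ M.neighbors j
  swap
  · have h0 := M.areaVec_eq_zero_of_notMem hjk hk
    rw [fluxError_of_areaVec_eq_zero X h0, fluxError_of_areaVec_eq_zero X (hn.trans h0)]
  set v : Space d := latticeVec z
  let g : Space d → Fin n → ℂ := fun r => dirDeriv v f r +
    (1 / 2 : ℝ) • dirDeriv v (dirDeriv v f) r +
    (1 / 6 : ℝ) • dirDeriv v (dirDeriv v (dirDeriv v f)) r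
  have hg : IsPolynomial 2 g := by
    have h1 := hf.dirDeriv v
    have h2 := h1.dirDeriv v
    have h3 := h2.dirDeriv v
    exact (h1.add ((h2.mono (by norm_num)).const_smul _)).add ((h3.mono (by norm_num)).const_smul _)
  have hfg : (fun r => f (r + v)) = fun r => f r + g r := by
    ext1 r
    rw [hf.taylor_three r v]
    simp only [g]
    abel
  have hder : ∀ h r, dirDeriv h f (r + v) = dirDeriv h (fun r => f (r + v)) r := by
    intro h r
    rw [dirDeriv, dirDeriv, fderiv_comp_add_right]
  have h1 : fluxError X f (M.shift z j) (M.shift z k) =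
      fluxError X (fun r => f (r + v)) j k := by
    rw [fluxError, fluxError, X.flux_shift j k hk z, centralFlux, centralFlux, hn]
    simp only [M.pos_shift, add_sub_add_right_eq_sub]
    rw [hder, hder]
    rfl
  rw [h1, hfg, fluxError_add X hf.differentiable hg.differentiable, fluxError_eq_zero X hg,
    add_zero]

/-- The flux error on a cubic polynomial is antisymmetric and translation-invariant, so it makes no
contribution to the mean error. -/
lemma sum_fluxError_eq_zero (hA : IsHyperbolic A) {κ : ℝ}
    (hκ : ∀ j k : M.Node, j ≠ k → M.areaVec j k =
      κ • ∑ e ∈ M.starAt (M.pos j) with M.pos k ∈ e,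
        simplexVolume e • (grad e (M.pos k) - grad e (M.pos j)))
    {f : Space d → Fin n → ℂ} (hf : IsPolynomial 3 f) {T : Finset M.Node}
    (hT : M.IsPeriodCell T) :
    ∑ j ∈ T, ∑ k ∈ M.neighbors j, fluxError X f j k = 0 := by
  classical
  let W : M.Node → M.Node → Fin n → ℂ := fun j k => if j = k then 0 else fluxError X f j k
  have hsupp : ∀ j, Function.support (W j) ⊆ M.neighbors j := by
    intro j k hk
    by_contra hkn
    refine hk ?_
    simp only [W]
    split_ifs with hjk
    · rfl
    · exact fluxError_of_areaVec_eq_zero X (M.areaVec_eq_zero_of_notMem hjk hkn)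
  rw [← M.sum_finsum_eq_zero_of_antisymm hT (W := W) (fun j k => ?_) (fun z j k => ?_)
    fun j => (M.neighbors j).finite_toSet.subset (hsupp j)]
  · refine Finset.sum_congr rfl fun j _ => ?_
    rw [finsum_eq_sum_of_support_subset _ (hsupp j)]
    refine Finset.sum_congr rfl fun k hk => ?_
    have hjk : j ≠ k := by
      rintro rfl
      simp [PeriodicMesh.neighbors, PeriodicMesh.neighborSet] at hk
    simp only [W, if_neg hjk]
  · by_cases hjk : j = k
    · simp [W, hjk]
    · have hn := M.areaVec_swap hκ hjk
      simp only [W, if_neg hjk, if_neg (Ne.symm hjk), fluxError]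
      rw [flux_swap M hA X.G hn, centralFlux_swap hn]
      abel
  · by_cases hjk : j = k
    · simp [W, hjk]
    · have hne : M.shift z j ≠ M.shift z k := fun h => hjk (by
        rw [← M.shift_neg_shift z j, h, M.shift_neg_shift])
      simp only [W, if_neg hjk, if_neg hne, fluxError_shift X hκ hf hjk z]

lemma dirDeriv_sum_act {F : Fin d → Space d → Fin n → ℂ} (hF : ∀ i, Differentiable ℝ (F i))
    (h : Space d) : dirDeriv h (fun r => ∑ i, act (A i) (F i r)) =
      fun r => ∑ i, act (A i) (dirDeriv h (F i) r) := by
  ext1 r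
  let L : Fin d → (Fin n → ℂ) →L[ℝ] (Fin n → ℂ) := fun i =>
    LinearMap.toContinuousLinearMap (symbolAct A (EuclideanSpace.single i 1))
  have hL : ∀ i u, L i u = act (A i) u := fun i u => symbolAct_single A i u
  have h1 : HasFDerivAt (fun r => ∑ i, act (A i) (F i r))
      (∑ i, (L i).comp (fderiv ℝ (F i) r)) r := by
    simp only [← hL]
    exact HasFDerivAt.fun_sum fun i _ => (L i).hasFDerivAt.comp r (hF i r).hasFDerivAt
  rw [dirDeriv, h1.fderiv, _root_.sum_apply]
  exact Finset.sum_congr rfl fun i _ => hL i _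

/-- `(A · g) f'''(u, v, w)` as a quadrilinear map. -/
noncomputable def symbolThirdDeriv (A : Fin d → Matrix (Fin n) (Fin n) ℝ)
    (f : Space d → Fin n → ℂ) :
    Space d →ₗ[ℝ] Space d →ₗ[ℝ] Space d →ₗ[ℝ] Space d →ₗ[ℝ] (Fin n → ℂ) :=
  LinearMap.mk₂ ℝ (fun g u => (thirdDeriv f u).compr₂ (symbolAct A g))
    (fun _ _ _ => by ext; simp) (fun _ _ _ => by ext; simp) (fun _ _ _ => by ext; simp)
    (fun _ _ _ => by ext; simp)

lemma symbolThirdDeriv_apply (f : Space d → Fin n → ℂ) (g u v w : Space d) :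
    symbolThirdDeriv A f g u v w = symbolAct A g (thirdDeriv f u v w) := rfl

lemma isPolynomial_advection {p : ℕ} {f : Space d → Fin n → ℂ} (hf : IsPolynomial (p + 1) f) :
    IsPolynomial p (advection A f) :=
  IsPolynomial.sum _ fun i _ => (hf.dirDeriv _).act (A i)

lemma dirDeriv_dirDeriv_advection {f : Space d → Fin n → ℂ} (hf : IsPolynomial 3 f)
    (h r : Space d) : dirDeriv h (dirDeriv h (advection A f)) r =
      ∑ a, symbolThirdDeriv A f (EuclideanSpace.single a 1) h h (EuclideanSpace.single a 1) := by
  have h1 : dirDeriv h (advection A f) =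
      fun r => ∑ i, act (A i) (dirDeriv h (partialDeriv i f) r) :=
    dirDeriv_sum_act (fun i => (hf.dirDeriv _).differentiable) h
  rw [h1, dirDeriv_sum_act (F := fun i => dirDeriv h (partialDeriv i f))
    (fun i => ((hf.dirDeriv _).dirDeriv h).differentiable) h]
  refine Finset.sum_congr rfl fun a _ => ?_
  rw [symbolThirdDeriv_apply, symbolAct_single, hf.thirdDeriv_apply _ _ _ r]
  rfl

/-- The truncation error on a cubic polynomial: the error of the flux plus a local third-order term;
the terms of lower order cancel by the exactness of the sums over the faces of the dual cell. -/
lemma cellVolume_smul_truncationError (hd : 0 < d) {κ : ℝ}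
    (hκ : ∀ j k : M.Node, j ≠ k → M.areaVec j k =
      κ • ∑ e ∈ M.starAt (M.pos j) with M.pos k ∈ e,
        simplexVolume e • (grad e (M.pos k) - grad e (M.pos j)))
    {f : Space d → Fin n → ℂ} (hf : IsPolynomial 3 f) (j : M.Node) :
    M.cellVolume j • truncationError M A X.mass X.stiff f j =
      ∑ k ∈ M.neighbors j, fluxError X f j k +
      (-(κ / 24)) • ∑ e ∈ M.starAt (M.pos j), simplexVolume e • ∑ l ∈ e,
        (symbolThirdDeriv A f (grad e l - grad e (M.pos j)) (l - M.pos j) (l - M.pos j)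
            (l - M.pos j) - (6 / ((d : ℝ) + 2)) • ∑ a, symbolThirdDeriv A f
            (EuclideanSpace.single a 1) (l - M.pos j) (l - M.pos j)
            (EuclideanSpace.single a 1)) := by
  have hd0 : (d : ℝ) ≠ 0 := by exact_mod_cast hd.ne'
  have hd2 : (d : ℝ) + 2 ≠ 0 := by positivity
  set p := M.pos j with hp
  set τ := symbolThirdDeriv A f with hτ
  set b : Fin n → ℂ := advection A f p with hb
  let S₃ : Space d → Fin n → ℂ := fun h =>
    ∑ a, τ (EuclideanSpace.single a 1) h h (EuclideanSpace.single a 1)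
  -- the parts of the sum that are of order zero, one and three in the edge vector
  let Φ₀ : Space d →ₗ[ℝ] (Fin n → ℂ) := (symbolAct A).flip (f p)
  let Φ₁ : Space d →ₗ[ℝ] Space d →ₗ[ℝ] (Fin n → ℂ) := LinearMap.mk₂ ℝ
    (fun h ξ => (1 / 2 : ℝ) • symbolAct A ξ (fderiv ℝ f p h) -
      (1 / (2 * (d : ℝ)) * inner ℝ h ξ) • b)
    (fun h h' ξ => by rw [map_add, map_add, inner_add_left]; module)
    (fun c h ξ => by rw [map_smul, map_smul, real_inner_smul_left]; module)
    (fun h ξ ξ' => by rw [map_add, LinearMap.add_apply, inner_add_right]; module)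
    (fun c h ξ => by rw [map_smul, LinearMap.smul_apply, real_inner_smul_right]; module)
  let Φ₃ : Space d → Space d →ₗ[ℝ] (Fin n → ℂ) := fun h =>
    { toFun := fun ξ => -(1 / 24 : ℝ) • τ ξ h h h +
        ((d : ℝ) / (4 * ((d : ℝ) + 2)) * (1 / (2 * (d : ℝ)) * inner ℝ h ξ)) • S₃ h
      map_add' := fun ξ ξ' => by
        rw [map_add, LinearMap.add_apply, LinearMap.add_apply, LinearMap.add_apply,
          inner_add_right]
        module
      map_smul' := fun c ξ => by
        rw [map_smul, LinearMap.smul_apply, LinearMap.smul_apply, LinearMap.smul_apply,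
          real_inner_smul_right, RingHom.id_apply]
        module }
  have hsplit : M.cellVolume j • truncationError M A X.mass X.stiff f j =
      ∑ k ∈ M.neighbors j, fluxError X f j k +
      (∑ k ∈ M.neighbors j, Φ₀ (M.areaVec j k) +
        ∑ k ∈ M.neighbors j, Φ₁ (M.pos k - p) (M.areaVec j k) +
        ∑ k ∈ M.neighbors j, Φ₃ (M.pos k - p) (M.areaVec j k)) := by
    rw [truncationError, ExtendedGalerkin.mass, ExtendedGalerkin.stiff, smul_add, smul_neg,
      smul_inv_smul₀ (M.cellVolume_ne_zero j), smul_inv_smul₀ (M.cellVolume_ne_zero j),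
      ← Finset.sum_neg_distrib, ← Finset.sum_add_distrib, ← Finset.sum_add_distrib,
      ← Finset.sum_add_distrib, ← Finset.sum_add_distrib]
    refine Finset.sum_congr rfl fun k hk => ?_
    have hflux : flux M A X.G j k (M.sample f) = fluxError X f j k + centralFlux M A j k f := by
      rw [fluxError, sub_add_cancel]
    rw [hflux, centralFlux_eq hf, X.s_exact j k hk _ (isPolynomial_advection hf),
      dirDeriv_dirDeriv_advection hf, edgeVolume, map_sub, map_add, map_smul, map_smul,
      ← symbolThirdDeriv_apply]
    change _ = _ + (symbolAct A (M.areaVec j k) (f p) +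
      ((1 / 2 : ℝ) • symbolAct A (M.areaVec j k) (fderiv ℝ f p (M.pos k - p)) -
        (1 / (2 * (d : ℝ)) * inner ℝ (M.pos k - p) (M.areaVec j k)) • b) +
      (-(1 / 24 : ℝ) • τ (M.areaVec j k) (M.pos k - p) (M.pos k - p) (M.pos k - p) +
        ((d : ℝ) / (4 * ((d : ℝ) + 2)) *
          (1 / (2 * (d : ℝ)) * inner ℝ (M.pos k - p) (M.areaVec j k))) • S₃ (M.pos k - p)))
    simp only [dirDeriv, ← hp, ← hb, ← hτ, S₃]
    module
  have h₀ : ∑ k ∈ M.neighbors j, Φ₀ (M.areaVec j k) = 0 := by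
    rw [M.sum_neighbors_eq hκ j fun _ => Φ₀, M.sum_starAt_linear, smul_zero]
  have h₁ : ∑ k ∈ M.neighbors j, Φ₁ (M.pos k - p) (M.areaVec j k) = 0 := by
    -- the trace of `Φ₁` is `A·∇f / 2 - (1 / (2d)) d A·∇f`
    have htr : ∑ a, Φ₁ (EuclideanSpace.single a 1) (EuclideanSpace.single a 1) = 0 := by
      simp only [Φ₁, LinearMap.mk₂_apply, Finset.sum_sub_distrib, symbolAct_single,
        ← Finset.smul_sum, ← Finset.sum_smul]
      have e1 : ∑ a, act (A a) (fderiv ℝ f p (EuclideanSpace.single a 1)) = b := rfl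
      have e2 : ∀ a : Fin d, (inner ℝ (EuclideanSpace.single a (1 : ℝ) : Space d)
          (EuclideanSpace.single a 1) : ℝ) = 1 := fun a => by simp
      rw [e1]
      simp only [e2, Finset.sum_const, Finset.card_univ, Fintype.card_fin, nsmul_eq_mul, mul_one]
      rw [← sub_smul]
      convert zero_smul ℝ b using 2
      field_simp
      norm_num
    rw [M.sum_neighbors_eq hκ j fun l => Φ₁ (l - p), M.sum_starAt_bilin, htr, smul_zero, smul_zero]
  rw [hsplit, h₀, h₁, zero_add, zero_add, M.sum_neighbors_eq hκ j fun l => Φ₃ (l - p)]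
  congr 1
  rw [show -(κ / 24) = κ * -(1 / 24 : ℝ) by ring, mul_smul, Finset.smul_sum (r := -(1 / 24 : ℝ))]
  congr 1
  refine Finset.sum_congr rfl fun e he => ?_
  rw [smul_comm, Finset.smul_sum (r := -(1 / 24 : ℝ))]
  congr 1
  refine Finset.sum_congr rfl fun l hl => ?_
  obtain ⟨heM, hpe⟩ := M.mem_starAt.1 he
  change -(1 / 24 : ℝ) • τ (grad e l - grad e p) (l - p) (l - p) (l - p) +
    ((d : ℝ) / (4 * ((d : ℝ) + 2)) * (1 / (2 * (d : ℝ)) *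
      inner ℝ (l - p) (grad e l - grad e p))) • S₃ (l - p) = _
  by_cases hlp : l = p
  · subst hlp
    simp [S₃]
  · rw [real_inner_comm, (M.isSimplex heM).inner_grad_sub_sub hpe hl (Ne.symm hlp)]
    -- the scalar product of the edge with `∇λ_l - ∇λ_p` is `2`, so that the mass term has the
    -- coefficient `1 / (4 (d + 2))`, against `1 / 24` for the flux term
    have : (d : ℝ) / (4 * ((d : ℝ) + 2)) * (1 / (2 * (d : ℝ)) * 2) =
        1 / 24 * (6 / ((d : ℝ) + 2)) := by
      field_simp
      norm_num
    rw [this]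
    simp only [S₃]
    module

end

end FluxCorrection

theorem mainTheorem3 {d n : ℕ} (hd : 0 < d) (M : FluxCorrection.PeriodicMesh d)
    (A : Fin d → Matrix (Fin n) (Fin n) ℝ) (hA : FluxCorrection.IsHyperbolic A)
    (X : FluxCorrection.ExtendedGalerkin M A) :
    FluxCorrection.HasZeroMeanError M A X.mass X.stiff 2 := by
  obtain ⟨κ, hκ⟩ := FluxCorrection.PeriodicMesh.exists_areaVec_eq hd
  constructor
  · intro f hf j
    have h := FluxCorrection.cellVolume_smul_truncationError X hd (hκ M)
      (hf.mono (by norm_num : 2 ≤ 3)) j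
    rw [Finset.sum_eq_zero fun k _ => FluxCorrection.fluxError_eq_zero X hf j k] at h
    simp only [FluxCorrection.symbolThirdDeriv_apply, hf.thirdDeriv_eq_zero,
      LinearMap.zero_apply, map_zero, Finset.sum_const_zero, smul_zero, sub_zero, add_zero] at h
    exact (smul_eq_zero.1 h).resolve_left (M.cellVolume_ne_zero j)
  · intro f hf T hT
    simp only [FluxCorrection.cellVolume_smul_truncationError X hd (hκ M) hf,
      Finset.sum_add_distrib, ← Finset.smul_sum]
    rw [FluxCorrection.sum_fluxError_eq_zero X hA (hκ M) hf hT,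
      M.sum_period_quadrilinear hT (FluxCorrection.symbolThirdDeriv A f)
        (fun g u v w => ?_) (fun g u v w => ?_), smul_zero, add_zero]
    · rw [FluxCorrection.symbolThirdDeriv_apply, FluxCorrection.thirdDeriv_symm₁ hf]
      rfl
    · rw [FluxCorrection.symbolThirdDeriv_apply, FluxCorrection.thirdDeriv_symm₂ hf]
      rfl
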